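/- **Model.** Fix $\zeta\ge 1$ and let $d(x)=L_\zeta^{-1}e^{-|x|^\zeta/\zeta}$ with $L_\zeta=\int_{\mathbb R}e^{-|x|^\zeta/\zeta}\,dx$, and $\overline D(u)=\int_u^\infty d(x)\,dx$. For each sample size $m\ge 2$ let $(X_i,H_i)\in\mathbb R\times\{0,1\}$, $1\le i\le m$, be i.i.d. with $\pi_{0,m}=P(H_1=0)$, $\pi_{1,m}=P(H_1=1)=1-\pi_{0,m}$ and $\tau_m=\pi_{0,m}/\pi_{1,m}=m^\beta$, where $0<\beta\le 1$. Given $H_1=0$, $X_1$ has density $d$. Given $H_1=1$, it has density * (location model) $d(x-\mu_m)$ with $\mu_m>0$; in this case assume $\zeta>1$, put $p_i=\overline D(X_i)$ and $\gamma=1-1/\zeta$; * (scale model) $d(x/\sigma_m)/\sigma_m$ with $\sigma_m>1$; in this case assume $\zeta\ge1$, put $p_i=2\overline D(|X_i|)$ and $\gamma=1$. Let $F_m(t)=P(p_1\le t\mid H_1=1)$ and $f_m=F_m'$ on $(0,1)$. The Bayes threshold is $t^B_m=f_m^{-1}(\tau_m)\in(0,1)$ and its power is $C_m=F_m(t_m^B)$.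 Assume (BP): there are constants $0<C_-\le C_+<1$ such that $C_-\le C_m\le C_+$ for all $m\ge 2$. **Thresholds.** For $\alpha\in(0,\pi_{0,m})$, the BFDR threshold $t_m^\star(\alpha)$ is the unique $t\in(0,1)$ such that $\pi_{0,m}t/(\pi_{0,m}t+\pi_{1,m}F_m(t))=\alpha$. For $\alpha\in(0,1)$, the FDR threshold is $\hat t_m^{\mathrm{FDR}}(\alpha)=\max\bigl(\hat t^{\mathrm{BH}}_m(\alpha),\alpha/m\bigr)$, where $\hat t^{\mathrm{BH}}_m(\alpha)=\max\{t\in[0,1]:\widehat G_m(t)\ge t/\alpha\}$ and $\widehat G_m(t)=m^{-1}\#\{i:p_i\le t\}$. **Risk.** Let $R_m$ be either one of the two misclassification risks of a (possibly data-dependent) threshold $\hat t_m$: the transductive risk $$m^{-1}\sum_{i=1}^m P(p_i\le\hat t_m,\,H_i=0)+m^{-1}\sum_{i=1}^mP(p_i>\hat t_m,\,H_i=1)$$ or the inductive risk $E\bigl[\pi_{0,m}\hat t_m+\pi_{1,m}(1-F_m(\hat t_m))\bigr]$. A threshold $\hat t_m$ is *asymptotically optimal* if $R_m(\hat t_m)\sim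 R_m(t_m^B)$ as $m\to\infty$. It is *asymptotically optimal at rate $\rho_m$* if $\rho_m\to0$ and there is a constant $D>0$ such that $R_m(\hat t_m)-R_m(t_m^B)\le D\,R_m(t_m^B)\,\rho_m$ for all large $m$. **Statement.** Consider the condition $$\alpha_m\to0\quad\text{and}\quad\log\alpha_m=o\bigl((\log m)^\gamma\bigr)\qquad(\ast)$$ and put $$\rho_m=\alpha_m+\frac{\bigl(\log\bigl(\alpha_m^{-1}/(\log m)^\gamma\bigr)\bigr)_+}{(\log m)^\gamma}.$$ The following hold for each of the two risks. 1. Let $\alpha_m\in(0,\pi_{0,m})$ for all large $m$. The BFDR threshold $t_m^\star(\alpha_m)$ is asymptotically optimal if and only if $(\ast)$ holds, and in that case it is asymptotically optimal at rate $\rho_m$. 2. Let $\alpha_m\in(0,1)$ for all large $m$. If $(\ast)$ holds, then the FDR threshold $\hat t_m^{\mathrm{FDR}}(\alpha_m)$ is asymptotically optimal, and it is so at rate $\rho_m$. 3. Let $\alpha_m>0$ for all large $m$. If $\alpha_m$ is of exact order $(\log m)^{-\gamma}$ (that is, $c\,(\log m)^{-\gamma}\le\alpha_m\le c'(\log m)^{-\gamma}$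 for some constants $c,c'>0$ and all large $m$), then $t_m^\star(\alpha_m)$ and $\hat t_m^{\mathrm{FDR}}(\alpha_m)$ are both asymptotically optimal, and they are so at rate $(\log m)^{-\gamma}$. -/

import Mathlib

open MeasureTheory Filter Topology Asymptotics Set

noncomputable section

namespace SubbotinFDR

/-- The two types of alternative distribution. -/
inductive ModelKind where
  | location
  | scale

/-- The two misclassification risks: transductive and inductive. -/
inductive RiskKind where
  | transductiveRisk
  | inductiveRisk

/-- Normalizing constant `L_ζ = ∫ exp (-|x|^ζ / ζ) dx`. -/
def normConst (ζ : ℝ) : ℝ := ∫ x : ℝ, Real.exp (-(|x| ^ ζ / ζ))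

/-- The `ζ`-Subbotin density `d`. -/
def density (ζ x : ℝ) : ℝ := (normConst ζ)⁻¹ * Real.exp (-(|x| ^ ζ / ζ))

/-- Upper tail function of the `ζ`-Subbotin density. -/
def upperTail (ζ u : ℝ) : ℝ := ∫ x in Ici u, density ζ x

/-- Density under label 1, with signal parameter `θ`:
`d(x - θ)` (location, `θ = μ`) or `d(x / θ) / θ` (scale, `θ = σ`). -/
def altDensity : ModelKind → ℝ → ℝ → ℝ → ℝ
  | .location, ζ, θ, x => density ζ (x - θ)
  | .scale, ζ, θ, x => density ζ (x / θ) / θ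

/-- The `p`-value attached to an observation `x`. -/
def pValue : ModelKind → ℝ → ℝ → ℝ
  | .location, ζ, x => upperTail ζ x
  | .scale, ζ, x => 2 * upperTail ζ |x|

/-- Admissible shape parameters (the Laplace location model is excluded). -/
def AdmissibleShape : ModelKind → ℝ → Prop
  | .location, ζ => 1 < ζ
  | .scale, ζ => 1 ≤ ζ

/-- Admissible signal parameters: `μ > 0` (location), `σ > 1` (scale). -/
def AdmissibleSignal : ModelKind → ℝ → Prop
  | .location, μ => 0 < μ
  | .scale, σ => 1 < σ

/-- The exponent `γ`. -/
def gammaExp : ModelKind → ℝ → ℝ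
  | .location, ζ => 1 - 1 / ζ
  | .scale, _ => 1

/-- Parameters of the two-group mixture model: type, shape `ζ`, sparsity `τ = π₀ / π₁`
and signal parameter (`μ` or `σ`). -/
structure Model where
  kind : ModelKind
  shape : ℝ
  sparsity : ℝ
  signal : ℝ

namespace Model

variable (M : Model)

/-- Probability of label 0. -/
def pi0 : ℝ := M.sparsity / (1 + M.sparsity)

/-- Probability of label 1. -/
def pi1 : ℝ := 1 / (1 + M.sparsity)

/-- Law of an observation under label 0. -/
def nullLaw : Measure ℝ :=
  volume.withDensity fun x => ENNReal.ofReal (density M.shape x)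

/-- Law of an observation under label 1. -/
def altLaw : Measure ℝ :=
  volume.withDensity fun x => ENNReal.ofReal (altDensity M.kind M.shape M.signal x)

/-- Joint law of one labelled observation `(X, H)`; `false` is label 0, `true` is label 1. -/
def pairLaw : Measure (ℝ × Bool) :=
  ENNReal.ofReal M.pi0 • M.nullLaw.map (fun x => (x, false)) +
    ENNReal.ofReal M.pi1 • M.altLaw.map (fun x => (x, true))

/-- Law of the i.i.d. labelled sample `(X_i, H_i)`, `i < m`. -/
def sampleLaw (m : ℕ) : Measure (Fin m → ℝ × Bool) := Measure.pi fun _ => M.pairLaw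

/-- The family of `p`-values of a sample. -/
def pValues {m : ℕ} (ω : Fin m → ℝ × Bool) : Fin m → ℝ :=
  fun i => pValue M.kind M.shape (ω i).1

/-- C.d.f. `F` of a `p`-value under label 1. -/
def altCdf (t : ℝ) : ℝ := M.altLaw.real {x | pValue M.kind M.shape x ≤ t}

/-- Density `f = F'` of a `p`-value under label 1. -/
def altPDensity (t : ℝ) : ℝ := deriv M.altCdf t

/-- Bayes threshold `f⁻¹(τ)`, the point `t ∈ (0,1)` with `f t = τ`. -/
def bayesThreshold : ℝ := Function.invFunOn M.altPDensity (Ioo 0 1) M.sparsity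

/-- Power of the Bayes procedure. -/
def bayesPower : ℝ := M.altCdf M.bayesThreshold

/-- Bayesian false discovery rate `P(H = 0 | p ≤ t) = π₀ t / G(t)`, where
`G(t) = π₀ t + π₁ F(t)`. -/
def bfdr (t : ℝ) : ℝ := M.pi0 * t / (M.pi0 * t + M.pi1 * M.altCdf t)

/-- BFDR threshold at level `α`: the point `t ∈ (0,1)` with `bfdr t = α`. -/
def bfdrThreshold (α : ℝ) : ℝ := Function.invFunOn M.bfdr (Ioo 0 1) α

/-- Risks of a data-driven threshold, that is, of a function `T` of the `p`-values: the procedure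
gives label 1 to the `p`-values that are at most `T`. -/
def risk : RiskKind → (m : ℕ) → ((Fin m → ℝ) → ℝ) → ℝ
  | .transductiveRisk, m, T =>
      (m : ℝ)⁻¹ * ∑ i : Fin m, (M.sampleLaw m).real
          {ω | M.pValues ω i ≤ T (M.pValues ω) ∧ (ω i).2 = false} +
        (m : ℝ)⁻¹ * ∑ i : Fin m, (M.sampleLaw m).real
          {ω | T (M.pValues ω) < M.pValues ω i ∧ (ω i).2 = true}
  | .inductiveRisk, m, T =>
      ∫ ω, (M.pi0 * T (M.pValues ω) + M.pi1 * (1 - M.altCdf (T (M.pValues ω))))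
        ∂(M.sampleLaw m)

/-- Risk of a deterministic threshold. -/
def detRisk (k : RiskKind) (m : ℕ) (t : ℝ) : ℝ := M.risk k m fun _ => t

end Model

/-- Empirical c.d.f. of `p`-values. -/
def empCdf {m : ℕ} (p : Fin m → ℝ) (t : ℝ) : ℝ :=
  (m : ℝ)⁻¹ * ((Finset.univ.filter fun i => p i ≤ t).card : ℝ)

/-- Benjamini-Hochberg threshold at level `α` (the supremum is attained). -/
def bhThreshold {m : ℕ} (α : ℝ) (p : Fin m → ℝ) : ℝ :=
  sSup {t | t ∈ Icc (0 : ℝ) 1 ∧ t / α ≤ empCdf p t}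

/-- FDR threshold at level `α`: never below the Bonferroni threshold. -/
def fdrThreshold {m : ℕ} (α : ℝ) (p : Fin m → ℝ) : ℝ :=
  max (bhThreshold α p) (α / m)

/-- The model for sample size `m`, in the sparsity regime `τ_m = m ^ β`. -/
def modelSeq (kind : ModelKind) (ζ β : ℝ) (signal : ℕ → ℝ) (m : ℕ) : Model where
  kind := kind
  shape := ζ
  sparsity := (m : ℝ) ^ β
  signal := signal m

/-- The power of the Bayes procedure stays away from 0 and 1. -/
def BoundedPower (M : ℕ → Model) : Prop :=
  ∃ Cminus Cplus : ℝ, 0 < Cminus ∧ Cplus < 1 ∧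
    ∀ m ≥ 2, Cminus ≤ (M m).bayesPower ∧ (M m).bayesPower ≤ Cplus

/-- Asymptotic optimality of risks `R` with respect to the Bayes risks `RB`. -/
def AsympOptimal (R RB : ℕ → ℝ) : Prop := R ~[atTop] RB

/-- Asymptotic optimality at rate `ρ`, where `ρ m = o(1)`. -/
def AsympOptimalAtRate (R RB ρ : ℕ → ℝ) : Prop :=
  Tendsto ρ atTop (𝓝 0) ∧
    ∃ D : ℝ, 0 < D ∧ ∀ᶠ m in atTop, R m - RB m ≤ D * RB m * ρ m

/-- The condition `α_m → 0` and `log α_m = o((log m)^γ)`. -/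
def LevelCondition (γ : ℝ) (α : ℕ → ℝ) : Prop :=
  Tendsto α atTop (𝓝 0) ∧
    (fun m => Real.log (α m)) =o[atTop] fun m : ℕ => Real.log m ^ γ

/-- The rate `α_m + (log (α_m⁻¹ / (log m)^γ))₊ / (log m)^γ`. -/
def explicitRate (γ : ℝ) (α : ℕ → ℝ) (m : ℕ) : ℝ :=
  α m + max (Real.log ((α m)⁻¹ / Real.log m ^ γ)) 0 / Real.log m ^ γ

/-- Bayes risk for sample size `m`. -/
def bayesRiskSeq (M : ℕ → Model) (k : RiskKind) (m : ℕ) : ℝ :=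
  (M m).detRisk k m (M m).bayesThreshold

/-- Risk of BFDR thresholding at level `α m`, for sample size `m`. -/
def bfdrRiskSeq (M : ℕ → Model) (k : RiskKind) (α : ℕ → ℝ) (m : ℕ) : ℝ :=
  (M m).detRisk k m ((M m).bfdrThreshold (α m))

/-- Risk of FDR thresholding at level `α m`, for sample size `m`. -/
def fdrRiskSeq (M : ℕ → Model) (k : RiskKind) (α : ℕ → ℝ) (m : ℕ) : ℝ :=
  (M m).risk k m (fdrThreshold (α m))

end SubbotinFDR

end

open SubbotinFDR

/-! For a fixed threshold `t` both risks equal `π₁ (τ t + 1 - F t)`, and bounded power makes the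
Bayes risk comparable to `π₁`. So the question is how much `τ t - F t` exceeds its value at the
Bayes threshold. A threshold is described by its cutoff on the scale of the observations. The
alternative is the image of the null under `x ↦ shift + dilation * x`, so the cutoff `x = shift +
dilation * y` has level `tailP x` and power `tailP y`, in both models.

Bounded power confines the standardized Bayes cutoff `y` to a fixed compact interval, while equality
of the likelihood ratio with `τ` determines `x ^ ζ` in terms of `log τ`, `log dilation` and `|y| ^
ζ`. Consequently the log-slope `dilation * x ^ (ζ - 1)` of the null tail, in units of `y`, has exact
order `L = (log m) ^ γ` (`exists_bayesPoint`). Moving `y` by a bounded `s` changes the power by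
order `s`, but changes the weighted level `τ t` exponentially in `s L`; at `s = 0` that level is
already `O(1 / L)`.

Sufficiency: a shift `s` of order `(1 + log₊ (1 / (α L))) / L` makes `τ t` smaller than a given
fraction of `α F t`, and this is the explicit rate up to a constant (`exists_good_threshold`). The
BFDR threshold lies above such a `t`, since `F t / t` is nonincreasing (`altCdf_mul_le`); it thus
loses no more power, and its weighted level is at most `2 α` once `α ≤ 1 / 2`. The FDR threshold has
few false positives by a leave-one-out argument (`integral_bh_zeroOn_le`). It rarely falls below
`t`: by a Chernoff bound if `β < 1`, and thanks to the Bonferroni floor if `β = 1`. Neyman-Pearson,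
applied with all other observations frozen, shows that no threshold beats the Bayes risk
(`pointRisk_bayes_le_risk`), so a rate implies optimality.

Necessity for BFDR: optimality forces `τ t⋆ - F t⋆ + C → 0`. The cutoff cannot lie a fixed distance
to the left of the Bayes cutoff, where `τ t` explodes, nor to the right, where power is lost. The
former gives `τ t⋆ → 0`, hence `α → 0`; the latter gives `τ t⋆ ≥ exp (-s Q L)` up to a constant for
each fixed `s > 0`, hence `log α = o(L)`. -/

namespace SubbotinFDR

/-! ### The Subbotin density and its upper tail. -/

section Density

variable {ζ : ℝ}

lemma continuous_subbotin_exponent (hζ : 1 ≤ ζ) :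
    Continuous fun x : ℝ => Real.exp (-(|x| ^ ζ / ζ)) := by
  have : Continuous fun x : ℝ => |x| ^ ζ :=
    continuous_abs.rpow_const fun x => Or.inr (by linarith)
  fun_prop

lemma integrable_subbotin_exponent (hζ : 1 ≤ ζ) :
    Integrable fun x : ℝ => Real.exp (-(|x| ^ ζ / ζ)) := by
  have hpos : 0 < ζ := by linarith
  have h := integrableOn_rpow_mul_exp_neg_mul_rpow (s := 0) (p := ζ) (b := 1 / ζ)
    (by norm_num) hpos (by positivity)
  have h1 : IntegrableOn (fun x : ℝ => Real.exp (-(|x| ^ ζ / ζ))) (Ioi 0) := by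
    refine h.congr_fun (fun x hx => ?_) measurableSet_Ioi
    simp only [Real.rpow_zero, one_mul]
    rw [abs_of_pos hx]
    congr 1
    ring
  have h2 : IntegrableOn (fun x : ℝ => Real.exp (-(|x| ^ ζ / ζ))) (Iic 0) := by
    have h3 := (integrableOn_Ici_iff_integrableOn_Ioi (f := fun x : ℝ =>
      Real.exp (-(|x| ^ ζ / ζ))) (μ := volume) (b := -0)).2 (by simpa using h1)
    simpa using h3.comp_neg_Iic
  rw [← integrableOn_univ, ← Iic_union_Ioi (a := (0 : ℝ))]
  exact h2.union h1

lemma normConst_pos (hζ : 1 ≤ ζ) : 0 < normConst ζ := by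
  unfold normConst
  refine integral_pos_of_integrable_nonneg_nonzero (x := 0) (continuous_subbotin_exponent hζ)
    (integrable_subbotin_exponent hζ) (fun x => (Real.exp_pos _).le) (Real.exp_pos _).ne'

lemma density_pos (hζ : 1 ≤ ζ) (x : ℝ) : 0 < density ζ x :=
  mul_pos (inv_pos.2 (normConst_pos hζ)) (Real.exp_pos _)

lemma continuous_density (hζ : 1 ≤ ζ) : Continuous (density ζ) :=
  continuous_const.mul (continuous_subbotin_exponent hζ)

lemma integrable_density (hζ : 1 ≤ ζ) : Integrable (density ζ) :=
  (integrable_subbotin_exponent hζ).const_mul _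

lemma integral_density (hζ : 1 ≤ ζ) : ∫ x, density ζ x = 1 := by
  unfold density
  rw [integral_const_mul]
  exact inv_mul_cancel₀ (normConst_pos hζ).ne'

lemma density_neg (x : ℝ) : density ζ (-x) = density ζ x := by simp [density]

lemma density_anti_abs (hζ : 1 ≤ ζ) {x z : ℝ} (h : |x| ≤ |z|) : density ζ z ≤ density ζ x := by
  unfold density
  have := normConst_pos hζ
  gcongr

lemma density_le_zero (hζ : 1 ≤ ζ) (x : ℝ) : density ζ x ≤ density ζ 0 :=
  density_anti_abs hζ (by simp)

lemma upperTail_add (hζ : 1 ≤ ζ) (u v : ℝ) :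
    upperTail ζ u = upperTail ζ v + ∫ x in u..v, density ζ x := by
  have hi := integrable_density hζ
  unfold upperTail
  rw [integral_Ici_eq_integral_Ioi, integral_Ici_eq_integral_Ioi]
  have := intervalIntegral.integral_Ioi_sub_Ioi' (a := u) (b := v)
    (f := density ζ) (μ := volume) hi.integrableOn hi.integrableOn
  linarith

lemma hasStrictDerivAt_upperTail (hζ : 1 ≤ ζ) (u : ℝ) :
    HasStrictDerivAt (upperTail ζ) (-density ζ u) u := by
  have hc := continuous_density hζ
  have h : upperTail ζ = fun u => upperTail ζ 0 - ∫ x in (0 : ℝ)..u, density ζ x := by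
    funext u
    rw [upperTail_add hζ u 0, intervalIntegral.integral_symm]
    ring
  rw [h]
  exact (intervalIntegral.integral_hasStrictDerivAt_right (hc.intervalIntegrable _ _)
    (hc.stronglyMeasurableAtFilter _ _) hc.continuousAt).const_sub _

lemma continuous_upperTail (hζ : 1 ≤ ζ) : Continuous (upperTail ζ) :=
  continuous_iff_continuousAt.2 fun u => (hasStrictDerivAt_upperTail hζ u).hasDerivAt.continuousAt

lemma upperTail_strictAnti (hζ : 1 ≤ ζ) : StrictAnti (upperTail ζ) :=
  strictAnti_of_hasDerivAt_neg (fun u => (hasStrictDerivAt_upperTail hζ u).hasDerivAt)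
    fun u => neg_lt_zero.2 (density_pos hζ u)

lemma upperTail_nonneg (hζ : 1 ≤ ζ) (u : ℝ) : 0 ≤ upperTail ζ u :=
  setIntegral_nonneg measurableSet_Ici fun x _ => (density_pos hζ x).le

lemma upperTail_pos (hζ : 1 ≤ ζ) (u : ℝ) : 0 < upperTail ζ u :=
  (upperTail_nonneg hζ (u + 1)).trans_lt (upperTail_strictAnti hζ (by linarith))

lemma upperTail_neg (hζ : 1 ≤ ζ) (u : ℝ) : upperTail ζ (-u) = 1 - upperTail ζ u := by
  have hi := integrable_density hζ
  have h1 : upperTail ζ u = ∫ x in Iic (-u), density ζ x := by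
    unfold upperTail
    rw [integral_Ici_eq_integral_Ioi, ← integral_comp_neg_Ioi]
    simp [density_neg]
  rw [h1, ← integral_density hζ,
    ← intervalIntegral.integral_Iic_add_Ioi hi.integrableOn hi.integrableOn (b := -u)]
  unfold upperTail
  rw [integral_Ici_eq_integral_Ioi]
  ring

lemma upperTail_zero (hζ : 1 ≤ ζ) : upperTail ζ 0 = 1 / 2 := by
  have := upperTail_neg hζ 0
  rw [neg_zero] at this
  linarith

lemma upperTail_lt_one (hζ : 1 ≤ ζ) (u : ℝ) : upperTail ζ u < 1 := by
  have := upperTail_neg hζ u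
  have := upperTail_pos hζ (-u)
  linarith

/-- Convexity: `u ^ ζ / ζ` lies above its tangent at `x`, whose slope is `x ^ (ζ - 1)`. Bernoulli's
inequality supplies the tangent bound, and this slope is the decay rate used throughout. -/
lemma density_div_rpow {x s : ℝ} (hζ : 1 ≤ ζ) (hx : 0 ≤ x) (hs : 0 ≤ s) :
    density ζ (x + s) ≤ density ζ x * Real.exp (-(s * x ^ (ζ - 1))) := by
  unfold density
  have hN := normConst_pos hζ
  rw [mul_assoc, ← Real.exp_add, abs_of_nonneg hx, abs_of_nonneg (by linarith : 0 ≤ x + s)]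
  gcongr
  have hpos : 0 < ζ := by linarith
  have key : x ^ ζ + ζ * (s * x ^ (ζ - 1)) ≤ (x + s) ^ ζ := by
    rcases hx.eq_or_lt with rfl | hx
    · rcases hζ.eq_or_lt with rfl | h1
      · simp
      · rw [Real.zero_rpow hpos.ne', Real.zero_rpow (by linarith)]
        simpa using Real.rpow_nonneg hs ζ
    · have hb := one_add_mul_self_le_rpow_one_add (s := s / x) (p := ζ)
        (by have : 0 ≤ s / x := by positivity
            linarith) hζ
      have h2 : (x + s) ^ ζ = x ^ ζ * (1 + s / x) ^ ζ := by
        rw [← Real.mul_rpow hx.le (by positivity)]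
        congr 1
        field_simp
      rw [h2, Real.rpow_sub_one hx.ne']
      have := mul_le_mul_of_nonneg_left hb (Real.rpow_nonneg hx.le ζ)
      calc _ = x ^ ζ * (1 + ζ * (s / x)) := by field_simp
        _ ≤ _ := this
  have : ((x + s) ^ ζ) / ζ ≥ x ^ ζ / ζ + s * x ^ (ζ - 1) := by
    rw [ge_iff_le, le_div_iff₀ hpos]
    calc _ = x ^ ζ + ζ * (s * x ^ (ζ - 1)) := by field_simp
      _ ≤ _ := key
  linarith

lemma tendsto_upperTail_atTop (hζ : 1 ≤ ζ) : Tendsto (upperTail ζ) atTop (𝓝 0) := by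
  have h := intervalIntegral_tendsto_integral_Ioi (μ := volume) 0
    (integrable_density hζ).integrableOn tendsto_id
  have h2 : Tendsto (fun u => upperTail ζ 0 - ∫ x in (0 : ℝ)..u, density ζ x) atTop
      (𝓝 (upperTail ζ 0 - ∫ x in Ioi (0 : ℝ), density ζ x)) := h.const_sub _
  have h3 : upperTail ζ 0 = ∫ x in Ioi (0 : ℝ), density ζ x := integral_Ici_eq_integral_Ioi
  rw [← h3, sub_self] at h2
  refine h2.congr fun u => ?_
  rw [upperTail_add hζ 0 u]
  ring

lemma tendsto_upperTail_atBot (hζ : 1 ≤ ζ) : Tendsto (upperTail ζ) atBot (𝓝 1) := by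
  have h := ((tendsto_upperTail_atTop hζ).comp tendsto_neg_atBot_atTop).const_sub 1
  rw [sub_zero] at h
  refine h.congr fun u => ?_
  simp [upperTail_neg hζ u]

/-- Mills-type bound for the upper tail. -/
lemma upperTail_mul_rpow_le {x : ℝ} (hζ : 1 ≤ ζ) (hx : 0 < x) :
    upperTail ζ x * x ^ (ζ - 1) ≤ density ζ x := by
  have hc : 0 < x ^ (ζ - 1) := Real.rpow_pos_of_pos hx _
  have hi : IntegrableOn (fun s => density ζ x * Real.exp (-x ^ (ζ - 1) * s)) (Ioi 0) :=
    (exp_neg_integrableOn_Ioi 0 hc).const_mul _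
  have h0 : upperTail ζ x = ∫ s in Ioi (0 : ℝ), density ζ (x + s) := by
    unfold upperTail
    rw [integral_Ici_eq_integral_Ioi]
    have := (measurePreserving_add_left volume x).setIntegral_preimage_emb
      (measurableEmbedding_addLeft x) (density ζ) (Ioi x)
    simpa using this.symm
  -- Integrating the tangent bound over all `s > 0` leaves an exponential integral equal to `1 / x ^
  -- (ζ - 1)`.
  have h1 : upperTail ζ x ≤ ∫ s in Ioi (0 : ℝ), density ζ x * Real.exp (-x ^ (ζ - 1) * s) := by
    rw [h0]
    refine setIntegral_mono_on ((integrable_density hζ).comp_add_left x).integrableOn hi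
      measurableSet_Ioi fun s hs => ?_
    have := density_div_rpow hζ hx.le (le_of_lt hs)
    simpa only [neg_mul, mul_comm s] using this
  rw [integral_const_mul, integral_exp_mul_Ioi (by linarith)] at h1
  simp only [mul_zero, Real.exp_zero] at h1
  calc _ ≤ density ζ x * (-1 / -x ^ (ζ - 1)) * x ^ (ζ - 1) := by gcongr
    _ = density ζ x := by field_simp

lemma upperTail_sub_le (hζ : 1 ≤ ζ) {u s : ℝ} (hs : 0 ≤ s) :
    upperTail ζ u - upperTail ζ (u + s) ≤ density ζ 0 * s := by
  have hc := continuous_density hζ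
  have h := intervalIntegral.integral_mono_on (μ := volume) (by linarith : u ≤ u + s)
    (hc.intervalIntegrable _ _) (continuous_const.intervalIntegrable _ _)
    fun x _ => density_le_zero hζ x
  rw [intervalIntegral.integral_const] at h
  have := upperTail_add hζ u (u + s)
  simp only [smul_eq_mul] at h
  linarith

lemma mul_le_upperTail_sub (hζ : 1 ≤ ζ) {u s c : ℝ} (hs : 0 ≤ s)
    (hc : ∀ x ∈ Icc u (u + s), c ≤ density ζ x) :
    c * s ≤ upperTail ζ u - upperTail ζ (u + s) := by
  have hd := continuous_density hζ
  have h := intervalIntegral.integral_mono_on (μ := volume) (by linarith : u ≤ u + s)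
    (continuous_const.intervalIntegrable _ _) (hd.intervalIntegrable _ _) hc
  rw [intervalIntegral.integral_const] at h
  have := upperTail_add hζ u (u + s)
  simp only [smul_eq_mul] at h
  linarith

/-- Only the slab `[u, u + s]` is kept, and the density is smallest at its right end. Together with
the exponential density bounds this replaces a sharp lower Mills estimate. -/
lemma mul_density_le_upperTail (hζ : 1 ≤ ζ) {u s : ℝ} (hu : 0 ≤ u) (hs : 0 ≤ s) :
    density ζ (u + s) * s ≤ upperTail ζ u := by
  have := mul_le_upperTail_sub hζ (u := u) hs (c := density ζ (u + s)) fun x hx =>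
    density_anti_abs hζ (by
      rw [abs_of_nonneg (hu.trans hx.1), abs_of_nonneg (by linarith)]; exact hx.2)
  have := upperTail_pos hζ (u + s)
  linarith

end Density

/-! ### Common notation for the location and scale models. -/

namespace ModelKind

/-- Number of tails that enter the `p`-value. -/
def tails : ModelKind → ℝ
  | .location => 1
  | .scale => 2

/-- Observations that parametrize the `p`-values in `(0,1)` bijectively. -/
def domain : ModelKind → Set ℝ
  | .location => univ
  | .scale => Ioi 0

/-- Translation part of the alternative. -/
def shift : ModelKind → ℝ → ℝ
  | .location, μ => μ
  | .scale, _ => 0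

/-- Dilation part of the alternative. -/
def dilation : ModelKind → ℝ → ℝ
  | .location, _ => 1
  | .scale, σ => σ

/-- The statistic on which the `p`-value depends. -/
def statistic : ModelKind → ℝ → ℝ
  | .location, x => x
  | .scale, x => |x|

lemma one_le_tails (k : ModelKind) : 1 ≤ k.tails := by cases k <;> norm_num [tails]

lemma tails_pos (k : ModelKind) : 0 < k.tails := by cases k <;> norm_num [tails]

lemma measurable_statistic (k : ModelKind) : Measurable k.statistic := by
  cases k
  · exact measurable_id
  · exact measurable_norm

end ModelKind

/-- The `p`-value as a function of its statistic. -/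
noncomputable def tailP (k : ModelKind) (ζ x : ℝ) : ℝ := k.tails * upperTail ζ x

lemma pValue_eq_tailP (k : ModelKind) (ζ x : ℝ) : pValue k ζ x = tailP k ζ (k.statistic x) := by
  cases k <;> simp [pValue, tailP, ModelKind.tails, ModelKind.statistic]

lemma altDensity_eq (k : ModelKind) (ζ θ x : ℝ) :
    altDensity k ζ θ x = density ζ ((x - k.shift θ) / k.dilation θ) / k.dilation θ := by
  cases k <;> simp [altDensity, ModelKind.shift, ModelKind.dilation]

lemma AdmissibleShape.one_le {k : ModelKind} {ζ : ℝ} (h : AdmissibleShape k ζ) : 1 ≤ ζ := by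
  cases k
  · exact le_of_lt h
  · exact h

lemma AdmissibleSignal.one_le_dilation {k : ModelKind} {θ : ℝ} (h : AdmissibleSignal k θ) :
    1 ≤ k.dilation θ := by
  cases k
  · exact le_rfl
  · exact le_of_lt h

section TailP

variable {k : ModelKind} {ζ : ℝ}

lemma tailP_pos (hζ : 1 ≤ ζ) (x : ℝ) : 0 < tailP k ζ x :=
  mul_pos k.tails_pos (upperTail_pos hζ x)

lemma tailP_strictAnti (hζ : 1 ≤ ζ) : StrictAnti (tailP k ζ) := fun _ _ h =>
  mul_lt_mul_of_pos_left (upperTail_strictAnti hζ h) k.tails_pos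

lemma continuous_tailP (hζ : 1 ≤ ζ) : Continuous (tailP k ζ) :=
  continuous_const.mul (continuous_upperTail hζ)

lemma tailP_mem_Ioo (hζ : 1 ≤ ζ) {x : ℝ} (hx : x ∈ k.domain) : tailP k ζ x ∈ Ioo (0 : ℝ) 1 := by
  refine ⟨tailP_pos hζ x, ?_⟩
  cases k
  · simpa [tailP, ModelKind.tails] using upperTail_lt_one hζ x
  · have := upperTail_strictAnti hζ (show (0 : ℝ) < x from hx)
    rw [upperTail_zero hζ] at this
    simp only [tailP, ModelKind.tails]
    linarith

lemma exists_tailP_eq (hζ : 1 ≤ ζ) {t : ℝ} (ht : t ∈ Ioo (0 : ℝ) 1) :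
    ∃ x ∈ k.domain, tailP k ζ x = t := by
  have hk := k.one_le_tails
  have h0 : 0 < t / k.tails := div_pos ht.1 k.tails_pos
  have h1 : t / k.tails < 1 := (div_lt_one k.tails_pos).2 (ht.2.trans_le hk)
  obtain ⟨x, hx⟩ := mem_range_of_exists_le_of_exists_ge (continuous_upperTail hζ)
    (((tendsto_upperTail_atTop hζ).eventually (gt_mem_nhds h0)).exists.imp fun _ h => h.le)
    (((tendsto_upperTail_atBot hζ).eventually (lt_mem_nhds h1)).exists.imp fun _ h => h.le)
  have hxt : tailP k ζ x = t := by
    rw [tailP, hx]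
    exact mul_div_cancel₀ _ k.tails_pos.ne'
  refine ⟨x, ?_, hxt⟩
  cases k
  · trivial
  · refine (upperTail_strictAnti hζ).lt_iff_gt.1 ?_
    rw [upperTail_zero hζ, hx]
    simp only [ModelKind.tails]
    linarith [ht.2]

lemma tailP_sub_le (hζ : 1 ≤ ζ) {u s : ℝ} (hs : 0 ≤ s) :
    tailP k ζ u - tailP k ζ (u + s) ≤ k.tails * density ζ 0 * s := by
  have := mul_le_mul_of_nonneg_left (upperTail_sub_le hζ (u := u) hs) k.tails_pos.le
  simp only [tailP]
  linarith

end TailP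

lemma withDensity_real_eq {f : ℝ → ℝ} (hf : Integrable f) (h0 : ∀ x, 0 ≤ f x) {A : Set ℝ}
    (hA : MeasurableSet A) :
    (volume.withDensity fun x => ENNReal.ofReal (f x)).real A = ∫ x in A, f x := by
  rw [Measure.real, withDensity_apply _ hA,
    ← ofReal_integral_eq_lintegral_ofReal hf.integrableOn (Eventually.of_forall h0),
    ENNReal.toReal_ofReal (setIntegral_nonneg hA fun x _ => h0 x)]

/-! ### Laws of observations and `p`-values under the two labels. -/

namespace Model

/-- Admissible parameters in a sparse regime. -/
structure Regular (M : Model) : Prop where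
  shape : AdmissibleShape M.kind M.shape
  signal : AdmissibleSignal M.kind M.signal
  sparsity : 1 < M.sparsity

/-- Translation part of the alternative. -/
noncomputable def shift (M : Model) : ℝ := M.kind.shift M.signal

/-- Dilation part of the alternative. -/
noncomputable def dilation (M : Model) : ℝ := M.kind.dilation M.signal

/-- Likelihood ratio of label 1 against label 0. -/
noncomputable def likRatio (M : Model) (x : ℝ) : ℝ :=
  density M.shape ((x - M.shift) / M.dilation) / (M.dilation * density M.shape x)

variable {M : Model}

lemma Regular.one_le (h : M.Regular) : 1 ≤ M.shape := h.shape.one_le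

lemma Regular.one_le_dilation (h : M.Regular) : 1 ≤ M.dilation := h.signal.one_le_dilation

lemma Regular.dilation_pos (h : M.Regular) : 0 < M.dilation :=
  zero_lt_one.trans_le h.one_le_dilation

lemma Regular.sparsity_pos (h : M.Regular) : 0 < M.sparsity := zero_lt_one.trans h.sparsity

lemma Regular.pi1_pos (h : M.Regular) : 0 < M.pi1 := by
  have := h.sparsity_pos
  unfold pi1
  positivity

lemma pi0_eq : M.pi0 = M.sparsity * M.pi1 := by
  unfold pi0 pi1
  ring

lemma Regular.pi0_pos (h : M.Regular) : 0 < M.pi0 := by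
  rw [pi0_eq]
  exact mul_pos h.sparsity_pos h.pi1_pos

lemma Regular.pi0_add_pi1 (h : M.Regular) : M.pi0 + M.pi1 = 1 := by
  have := h.sparsity_pos
  unfold pi0 pi1
  field_simp
  ring

lemma mem_domain_iff (h : M.Regular) {y : ℝ} :
    M.shift + M.dilation * y ∈ M.kind.domain ↔ y ∈ M.kind.domain := by
  have := h.dilation_pos
  obtain ⟨k, ζ, τ, θ⟩ := M
  cases k
  · simp [ModelKind.domain]
  · simp only [ModelKind.domain, shift, ModelKind.shift, zero_add, mem_Ioi]
    exact mul_pos_iff_of_pos_left this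

lemma integrable_altDensity (h : M.Regular) :
    Integrable (altDensity M.kind M.shape M.signal) := by
  have h1 : Integrable fun x => density M.shape ((x - M.shift) / M.dilation) / M.dilation :=
    (((integrable_density h.one_le).comp_div h.dilation_pos.ne').comp_sub_right
      M.shift).div_const _
  refine h1.congr (Eventually.of_forall fun x => ?_)
  rw [altDensity_eq]
  rfl

lemma altDensity_pos (h : M.Regular) (x : ℝ) : 0 < altDensity M.kind M.shape M.signal x := by
  rw [altDensity_eq]
  exact div_pos (density_pos h.one_le _) h.dilation_pos

lemma altDensity_eq_likRatio (h : M.Regular) (x : ℝ) :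
    altDensity M.kind M.shape M.signal x = M.likRatio x * density M.shape x := by
  have := density_pos h.one_le x
  have := h.dilation_pos
  rw [altDensity_eq]
  change density M.shape ((x - M.shift) / M.dilation) / M.dilation = _
  unfold likRatio
  field_simp

lemma nullLaw_real (h : M.Regular) {A : Set ℝ} (hA : MeasurableSet A) :
    M.nullLaw.real A = ∫ x in A, density M.shape x :=
  withDensity_real_eq (integrable_density h.one_le) (fun x => (density_pos h.one_le x).le) hA

lemma altLaw_real (h : M.Regular) {A : Set ℝ} (hA : MeasurableSet A) :
    M.altLaw.real A = ∫ x in A, altDensity M.kind M.shape M.signal x :=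
  withDensity_real_eq (integrable_altDensity h) (fun x => (altDensity_pos h x).le) hA

/-- The alternative is the image of the null law under `x ↦ shift + dilation * x`. -/
lemma altLaw_real_preimage (h : M.Regular) {S : Set ℝ} (hS : MeasurableSet S) :
    M.altLaw.real {x | (x - M.shift) / M.dilation ∈ S} = M.nullLaw.real S := by
  have hb := h.dilation_pos
  have hA : MeasurableSet {x | (x - M.shift) / M.dilation ∈ S} :=
    ((measurable_id.sub_const _).div_const _) hS
  rw [altLaw_real h hA, nullLaw_real h hS, ← integral_indicator hA, ← integral_indicator hS]
  have h1 : ({x | (x - M.shift) / M.dilation ∈ S}.indicator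
      (altDensity M.kind M.shape M.signal)) = fun x =>
      (fun z => S.indicator (density M.shape) (z / M.dilation) / M.dilation) (x - M.shift) := by
    funext x
    by_cases hx : (x - M.shift) / M.dilation ∈ S
    · rw [indicator_of_mem (by exact hx), altDensity_eq]
      simp only [indicator_of_mem hx]
      rfl
    · rw [indicator_of_notMem (by exact hx)]
      simp [indicator_of_notMem hx]
  rw [h1, integral_sub_right_eq_self (μ := volume)
    (fun z => S.indicator (density M.shape) (z / M.dilation) / M.dilation), integral_div,
    Measure.integral_comp_div, abs_of_pos hb, smul_eq_mul]
  field_simp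

lemma isProbabilityMeasure_nullLaw (h : M.Regular) : IsProbabilityMeasure M.nullLaw := by
  constructor
  have h1 := nullLaw_real h MeasurableSet.univ
  rw [Measure.restrict_univ, integral_density h.one_le, Measure.real] at h1
  rw [← ENNReal.ofReal_toReal (a := M.nullLaw univ)]
  · simp [h1]
  · intro h2
    simp [h2] at h1

lemma isProbabilityMeasure_altLaw (h : M.Regular) : IsProbabilityMeasure M.altLaw := by
  constructor
  have h0 := isProbabilityMeasure_nullLaw h
  have h1 := altLaw_real_preimage h MeasurableSet.univ
  simp only [mem_univ, ofPred_true, Measure.real, measure_univ, ENNReal.toReal_one] at h1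
  rw [← ENNReal.ofReal_toReal (a := M.altLaw univ)]
  · simp [h1]
  · intro h2
    simp [h2] at h1

lemma pValue_le_iff (h : M.Regular) {x z : ℝ} :
    pValue M.kind M.shape x ≤ tailP M.kind M.shape z ↔ z ≤ M.kind.statistic x := by
  rw [pValue_eq_tailP]
  exact (tailP_strictAnti h.one_le).le_iff_ge

lemma measurable_pValue (h : M.Regular) : Measurable (pValue M.kind M.shape) := by
  have : pValue M.kind M.shape = tailP M.kind M.shape ∘ M.kind.statistic :=
    funext fun x => pValue_eq_tailP _ _ _
  rw [this]
  exact (continuous_tailP h.one_le).measurable.comp M.kind.measurable_statistic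

lemma pValue_pos (h : M.Regular) (x : ℝ) : 0 < pValue M.kind M.shape x := by
  rw [pValue_eq_tailP]
  exact tailP_pos h.one_le _

lemma measurableSet_statistic (M : Model) (z : ℝ) : MeasurableSet {x | z ≤ M.kind.statistic x} :=
  measurableSet_le measurable_const M.kind.measurable_statistic

lemma nullLaw_statistic (h : M.Regular) {z : ℝ} (hz : z ∈ M.kind.domain) :
    M.nullLaw.real {x | z ≤ M.kind.statistic x} = tailP M.kind M.shape z := by
  have hζ := h.one_le
  rw [nullLaw_real h (M.measurableSet_statistic z)]
  obtain ⟨k, ζ, τ, θ⟩ := M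
  cases k
  · simp only [ModelKind.statistic, tailP, ModelKind.tails, one_mul, upperTail]
    rfl
  · simp only [ModelKind.domain, mem_Ioi] at hz
    have hi := integrable_density hζ
    have hs : {x : ℝ | z ≤ ModelKind.statistic .scale x} = Iic (-z) ∪ Ici z := by
      ext x
      simp only [ModelKind.statistic, le_abs, mem_ofPred_eq, mem_union, mem_Iic, mem_Ici]
      constructor <;> rintro (h | h)
      · exact Or.inr h
      · exact Or.inl (by linarith)
      · exact Or.inr (by linarith)
      · exact Or.inl h
    simp only at hs hζ hi ⊢
    rw [hs, setIntegral_union (by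
      rw [Set.disjoint_left]
      intro x hx hx'
      simp only [mem_Iic, mem_Ici] at hx hx'
      linarith) measurableSet_Ici hi.integrableOn hi.integrableOn]
    have h1 : ∫ x in Iic (-z), density ζ x = upperTail ζ z := by
      unfold upperTail
      rw [integral_Ici_eq_integral_Ioi, ← integral_comp_neg_Ioi]
      simp [density_neg]
    rw [h1]
    simp only [tailP, ModelKind.tails, two_mul]
    rfl

lemma nullLaw_pValue_le (h : M.Regular) {t : ℝ} (ht : t ∈ Icc (0 : ℝ) 1) :
    M.nullLaw.real {x | pValue M.kind M.shape x ≤ t} = t := by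
  have hp := isProbabilityMeasure_nullLaw h
  rcases ht.1.eq_or_lt with rfl | h0
  · have : {x | pValue M.kind M.shape x ≤ 0} = ∅ := by
      ext x
      simpa using pValue_pos h x
    simp [this]
  rcases ht.2.lt_or_eq with h1 | rfl
  · obtain ⟨z, hz, rfl⟩ := exists_tailP_eq (k := M.kind) h.one_le ⟨h0, h1⟩
    simp only [pValue_le_iff h]
    exact nullLaw_statistic h hz
  · have : {x | pValue M.kind M.shape x ≤ 1} =ᵐ[M.nullLaw] univ := by
      have h0 : M.nullLaw {0} = 0 := by
        rw [nullLaw, withDensity_apply _ (measurableSet_singleton 0)]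
        simp
      rw [ae_eq_univ]
      refine measure_mono_null (fun x hx => ?_) h0
      simp only [mem_compl_iff, mem_ofPred_eq, not_le] at hx
      by_contra hne
      refine absurd hx (not_lt.2 ?_)
      rw [pValue_eq_tailP]
      refine (tailP_mem_Ioo h.one_le ?_).2.le
      obtain ⟨k, ζ, τ, θ⟩ := M
      cases k
      · trivial
      · exact abs_pos.2 hne
    rw [measureReal_congr this]
    simp

lemma statistic_preimage (h : M.Regular) (x y : ℝ) :
    M.shift + M.dilation * y ≤ M.kind.statistic x ↔
      y ≤ M.kind.statistic ((x - M.shift) / M.dilation) := by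
  have hb := h.dilation_pos
  obtain ⟨k, ζ, τ, θ⟩ := M
  cases k
  · simp only [shift, dilation, ModelKind.shift, ModelKind.dilation, ModelKind.statistic, div_one,
      one_mul]
    constructor <;> intro h <;> linarith
  · simp only [shift, dilation, ModelKind.shift, ModelKind.dilation, ModelKind.statistic, sub_zero,
      zero_add] at hb ⊢
    rw [abs_div, abs_of_pos hb, le_div_iff₀ hb, mul_comm]

/-- The alternative c.d.f. in the parametrization of `p`-values by observations. -/
lemma altCdf_tailP (h : M.Regular) {y : ℝ} (hy : y ∈ M.kind.domain) :
    M.altCdf (tailP M.kind M.shape (M.shift + M.dilation * y)) = tailP M.kind M.shape y := by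
  have h1 := altLaw_real_preimage h (M.measurableSet_statistic y)
  rw [nullLaw_statistic h hy] at h1
  rw [← h1]
  unfold altCdf
  congr 1
  ext x
  simp only [mem_ofPred_eq]
  rw [pValue_le_iff h, statistic_preimage h]

lemma altCdf_mono (h : M.Regular) : Monotone M.altCdf := fun s t hst => by
  have := isProbabilityMeasure_altLaw h
  exact measureReal_mono fun x hx => le_trans hx hst

lemma altCdf_nonneg (t : ℝ) : 0 ≤ M.altCdf t := measureReal_nonneg

lemma altCdf_le_one (h : M.Regular) (t : ℝ) : M.altCdf t ≤ 1 := by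
  have := isProbabilityMeasure_altLaw h
  exact measureReal_le_one

/-- The parametric formula for the c.d.f. is differentiated through a local inverse of `tailP`; the
number of tails cancels in the quotient of derivatives. -/
lemma altPDensity_tailP (h : M.Regular) {x : ℝ} (hx : x ∈ M.kind.domain) :
    M.altPDensity (tailP M.kind M.shape x) = M.likRatio x := by
  have hζ := h.one_le
  have hb := h.dilation_pos
  have hd : HasStrictDerivAt (tailP M.kind M.shape) (M.kind.tails * -density M.shape x) x :=
    (hasStrictDerivAt_upperTail hζ x).const_mul _
  have hd0 : M.kind.tails * -density M.shape x ≠ 0 := by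
    have := mul_pos M.kind.tails_pos (density_pos hζ x)
    linarith
  set g := hd.localInverse _ _ _ hd0 with hg
  have hg' : HasDerivAt g (M.kind.tails * -density M.shape x)⁻¹ (tailP M.kind M.shape x) :=
    (hd.to_localInverse hd0).hasDerivAt
  have hr : ∀ᶠ t in 𝓝 (tailP M.kind M.shape x), tailP M.kind M.shape (g t) = t :=
    (hd.hasStrictFDerivAt_equiv hd0).eventually_right_inverse
  have hgx : g (tailP M.kind M.shape x) = x :=
    (tailP_strictAnti hζ).injective hr.self_of_nhds
  -- The parametric formula is available only on `domain`, which is open, so the local inverse has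
  -- to be kept inside it.
  have hdom : ∀ᶠ t in 𝓝 (tailP M.kind M.shape x), g t ∈ M.kind.domain := by
    refine hg'.continuousAt.eventually_mem (IsOpen.mem_nhds ?_ (by rwa [hgx]))
    cases M.kind
    · exact isOpen_univ
    · exact isOpen_Ioi
  have hF : M.altCdf =ᶠ[𝓝 (tailP M.kind M.shape x)]
      fun t => tailP M.kind M.shape ((g t - M.shift) / M.dilation) := by
    filter_upwards [hr, hdom] with t ht htd
    have he : g t = M.shift + M.dilation * ((g t - M.shift) / M.dilation) := by
      field_simp
      ring
    rw [← altCdf_tailP h ((mem_domain_iff h).1 (he ▸ htd)), ← he, ht]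
  have hD : HasDerivAt (fun t => tailP M.kind M.shape ((g t - M.shift) / M.dilation))
      (M.kind.tails * -density M.shape ((x - M.shift) / M.dilation) *
        ((M.kind.tails * -density M.shape x)⁻¹ / M.dilation)) (tailP M.kind M.shape x) := by
    have h1 : HasDerivAt (tailP M.kind M.shape)
        (M.kind.tails * -density M.shape ((x - M.shift) / M.dilation))
        ((g (tailP M.kind M.shape x) - M.shift) / M.dilation) := by
      rw [hgx]
      exact ((hasStrictDerivAt_upperTail hζ _).const_mul _).hasDerivAt
    exact HasDerivAt.comp (h := fun t => (g t - M.shift) / M.dilation) _ h1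
      ((hg'.sub_const M.shift).div_const M.dilation)
  unfold altPDensity
  rw [hF.deriv_eq, hD.deriv]
  have := density_pos hζ x
  have := M.kind.tails_pos
  unfold likRatio
  field_simp

end Model

/-! ### Monotone likelihood ratio, Neyman-Pearson bound, Bayes and BFDR thresholds. -/

namespace Model

variable {M : Model}

lemma likRatio_eq_exp (h : M.Regular) (x : ℝ) :
    M.likRatio x =
      Real.exp ((|x| ^ M.shape - |(x - M.shift) / M.dilation| ^ M.shape) / M.shape) /
        M.dilation := by
  have := normConst_pos h.one_le
  have := h.dilation_pos
  unfold likRatio density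
  generalize (x - M.shift) / M.dilation = y
  rw [sub_div, Real.exp_sub, Real.exp_neg, Real.exp_neg]
  field_simp

lemma likRatio_pos (h : M.Regular) (x : ℝ) : 0 < M.likRatio x := by
  rw [likRatio_eq_exp h]
  exact div_pos (Real.exp_pos _) h.dilation_pos

lemma continuous_likRatio (h : M.Regular) : Continuous M.likRatio := by
  have hd := continuous_density h.one_le
  refine Continuous.div (hd.comp (by fun_prop)) (by fun_prop) fun x => ?_
  exact (mul_pos h.dilation_pos (density_pos h.one_le x)).ne'

/-- Increments of the convex function `|x| ^ ζ` over an interval of fixed length `μ` grow as the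
interval moves right. -/
lemma abs_rpow_sub_mono {ζ μ x z : ℝ} (hζ : 1 ≤ ζ) (hμ : 0 ≤ μ) (hxz : x ≤ z) :
    |x| ^ ζ - |x - μ| ^ ζ ≤ |z| ^ ζ - |z - μ| ^ ζ := by
  have hconv : ConvexOn ℝ univ fun x : ℝ => |x| ^ ζ := by
    refine ConvexOn.comp (g := fun x : ℝ => x ^ ζ) (f := fun x : ℝ => |x|) ?_ ?_ ?_
    · refine (convexOn_rpow hζ).subset ?_ ?_
      · rintro _ ⟨x, -, rfl⟩
        exact abs_nonneg x
      · have : (fun x : ℝ => |x|) '' univ = Ici 0 := by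
          ext y
          simp only [image_univ, mem_range, mem_Ici]
          exact ⟨fun ⟨x, hx⟩ => hx ▸ abs_nonneg x, fun hy => ⟨y, abs_of_nonneg hy⟩⟩
        rw [this]
        exact convex_Ici 0
    · exact convexOn_univ_norm
    · rintro _ ⟨x, -, rfl⟩ _ ⟨z, -, rfl⟩ hxz
      exact Real.rpow_le_rpow (abs_nonneg x) hxz (by linarith)
  rcases hxz.eq_or_lt with rfl | hlt
  · exact le_rfl
  -- Both `x` and `z - μ` are convex combinations of `x - μ` and `z`, with the two weights
  -- interchanged. Adding the two convexity inequalities gives the claim.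
  have hden : 0 < z - x + μ := by linarith
  have h1 := hconv.2 (mem_univ (x - μ)) (mem_univ z)
    (show 0 ≤ (z - x) / (z - x + μ) from div_nonneg (by linarith) hden.le)
    (show 0 ≤ μ / (z - x + μ) from div_nonneg hμ hden.le) (by field_simp)
  have h2 := hconv.2 (mem_univ (x - μ)) (mem_univ z)
    (show 0 ≤ μ / (z - x + μ) from div_nonneg hμ hden.le)
    (show 0 ≤ (z - x) / (z - x + μ) from div_nonneg (by linarith) hden.le)
    (by field_simp; ring)
  have e1 : ((z - x) / (z - x + μ)) • (x - μ) + (μ / (z - x + μ)) • z = x := by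
    simp only [smul_eq_mul]
    field_simp
    ring
  have e2 : (μ / (z - x + μ)) • (x - μ) + ((z - x) / (z - x + μ)) • z = z - μ := by
    simp only [smul_eq_mul]
    field_simp
    ring
  simp only [e1] at h1
  simp only [e2] at h2
  have e3 : μ / (z - x + μ) = 1 - (z - x) / (z - x + μ) := by
    field_simp
    ring
  simp only [smul_eq_mul, e3] at h1 h2
  linarith

lemma likRatio_mono (h : M.Regular) {x z : ℝ} (hxz : M.kind.statistic x ≤ M.kind.statistic z) :
    M.likRatio x ≤ M.likRatio z := by
  have hζ := h.one_le
  have hb := h.dilation_pos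
  have hb1 := h.one_le_dilation
  have hs := h.signal
  rw [likRatio_eq_exp h, likRatio_eq_exp h]
  have hpos : 0 < M.shape := by linarith
  refine div_le_div_of_nonneg_right (Real.exp_le_exp.2
    (div_le_div_of_nonneg_right ?_ hpos.le)) hb.le
  obtain ⟨k, ζ, τ, θ⟩ := M
  cases k
  · simp only [shift, dilation, ModelKind.shift, ModelKind.dilation, div_one]
    exact abs_rpow_sub_mono hζ (le_of_lt hs) hxz
  · simp only [shift, dilation, ModelKind.shift, ModelKind.dilation, sub_zero,
      ModelKind.statistic] at *
    have e : ∀ x : ℝ, |x| ^ ζ - |x / θ| ^ ζ = |x| ^ ζ * (1 - (θ ^ ζ)⁻¹) := fun x => by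
      rw [abs_div, abs_of_pos hb, Real.div_rpow (abs_nonneg x) hb.le]
      ring
    rw [e, e]
    refine mul_le_mul_of_nonneg_right (Real.rpow_le_rpow (abs_nonneg x) hxz hpos.le) ?_
    have := inv_le_one_of_one_le₀ (Real.one_le_rpow hb1 hpos.le)
    linarith

lemma statistic_of_mem_domain {k : ModelKind} {x : ℝ} (hx : x ∈ k.domain) :
    k.statistic x = x := by
  cases k
  · rfl
  · exact abs_of_pos hx

/-- Neyman-Pearson: level sets of the `p`-value maximize power minus weighted level. -/
lemma altLaw_sub_nullLaw_le (h : M.Regular) {x₀ : ℝ} (hx : x₀ ∈ M.kind.domain) {A : Set ℝ}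
    (hA : MeasurableSet A) :
    M.altLaw.real A - M.likRatio x₀ * M.nullLaw.real A ≤
      M.altCdf (tailP M.kind M.shape x₀) - M.likRatio x₀ * tailP M.kind M.shape x₀ := by
  have hS := M.measurableSet_statistic x₀
  have hia := integrable_altDensity h
  have hin := (integrable_density h.one_le).const_mul (M.likRatio x₀)
  have key : ∀ B : Set ℝ, MeasurableSet B →
      M.altLaw.real B - M.likRatio x₀ * M.nullLaw.real B =
        ∫ x, B.indicator (fun x => altDensity M.kind M.shape M.signal x -
          M.likRatio x₀ * density M.shape x) x := fun B hB => by
    rw [altLaw_real h hB, nullLaw_real h hB, integral_indicator hB, ← integral_const_mul,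
      integral_sub hia.integrableOn hin.integrableOn]
  have hR : M.altCdf (tailP M.kind M.shape x₀) - M.likRatio x₀ * tailP M.kind M.shape x₀ =
      M.altLaw.real {x | x₀ ≤ M.kind.statistic x} -
        M.likRatio x₀ * M.nullLaw.real {x | x₀ ≤ M.kind.statistic x} := by
    rw [nullLaw_statistic h hx, altCdf]
    simp only [pValue_le_iff h]
  rw [hR, key A hA, key _ hS]
  refine integral_mono ((hia.sub hin).indicator hA) ((hia.sub hin).indicator hS) fun x => ?_
  have hd := density_pos h.one_le x
  have hst := statistic_of_mem_domain hx
  have hg : altDensity M.kind M.shape M.signal x - M.likRatio x₀ * density M.shape x =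
      (M.likRatio x - M.likRatio x₀) * density M.shape x := by
    rw [altDensity_eq_likRatio h]
    ring
  -- By monotonicity of the ratio, the integrand is nonnegative exactly where the level set needs it
  -- and nonpositive off it; so the level set has the larger indicator integral pointwise.
  by_cases hxS : x₀ ≤ M.kind.statistic x
  · have h0 : 0 ≤ (M.likRatio x - M.likRatio x₀) * density M.shape x :=
      mul_nonneg (sub_nonneg.2 (likRatio_mono h (by rwa [hst]))) hd.le
    simp only [indicator_of_mem (show x ∈ {x | x₀ ≤ M.kind.statistic x} from hxS)]
    by_cases hxA : x ∈ A
    · simp [indicator_of_mem hxA]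
    · simp only [indicator_of_notMem hxA]
      rwa [hg]
  · have h0 : (M.likRatio x - M.likRatio x₀) * density M.shape x ≤ 0 :=
      mul_nonpos_of_nonpos_of_nonneg
        (sub_nonpos.2 (likRatio_mono h (by rw [hst]; exact (not_le.1 hxS).le))) hd.le
    simp only [indicator_of_notMem (show x ∉ {x | x₀ ≤ M.kind.statistic x} from hxS)]
    by_cases hxA : x ∈ A
    · simp only [indicator_of_mem hxA]
      rwa [hg]
    · simp [indicator_of_notMem hxA]

lemma likRatio_mul_le_altCdf (h : M.Regular) {x₀ : ℝ} (hx : x₀ ∈ M.kind.domain) :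
    M.likRatio x₀ * tailP M.kind M.shape x₀ ≤ M.altCdf (tailP M.kind M.shape x₀) := by
  have := altLaw_sub_nullLaw_le h hx MeasurableSet.empty
  simp only [measureReal_empty] at this
  linarith

/-- A substitute for concavity of `F`: comparing with the level set of `t` puts `F` below the line
through `(s, F s)` with slope `likRatio x`, and comparing with the empty set bounds this slope by `F
s / s`. -/
lemma altCdf_mul_le (h : M.Regular) {s t : ℝ} (hs : s ∈ Ioo (0 : ℝ) 1) (ht : t ≤ 1)
    (hst : s ≤ t) : M.altCdf t * s ≤ M.altCdf s * t := by
  obtain ⟨x, hx, rfl⟩ := exists_tailP_eq (k := M.kind) h.one_le hs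
  have h1 := altLaw_sub_nullLaw_le h hx
    (A := {x | pValue M.kind M.shape x ≤ t}) ((measurable_pValue h) measurableSet_Iic)
  have h2 := likRatio_mul_le_altCdf h hx
  rw [nullLaw_pValue_le h ⟨hs.1.le.trans hst, ht⟩] at h1
  change M.altCdf t - _ ≤ _ at h1
  set s := tailP M.kind M.shape x
  have h3 : M.altCdf t ≤ M.altCdf s + M.likRatio x * (t - s) := by linarith
  calc M.altCdf t * s ≤ (M.altCdf s + M.likRatio x * (t - s)) * s :=
        mul_le_mul_of_nonneg_right h3 hs.1.le
    _ = M.altCdf s * s + (M.likRatio x * s) * (t - s) := by ring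
    _ ≤ M.altCdf s * s + M.altCdf s * (t - s) := by
        have := mul_le_mul_of_nonneg_right h2 (sub_nonneg.2 hst)
        linarith
    _ = _ := by ring

/-- In the location model the tangent bound gives growth like `exp (θ (x - θ) ^ (ζ - 1))`, which
diverges because `ζ > 1`; this is where the Laplace location model is excluded. In the scale model
the gap `x - x / σ` itself grows, so `ζ = 1` is allowed. -/
lemma exists_likRatio_ge (h : M.Regular) (c B : ℝ) :
    ∃ x, B ≤ x ∧ x ∈ M.kind.domain ∧ c < M.likRatio x := by
  have hζ := h.one_le
  have hb := h.dilation_pos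
  have hb1 := h.one_le_dilation
  have hsh := h.shape
  have hs := h.signal
  have key : ∀ x, M.shift ≤ x → 0 ≤ x - (x - M.shift) / M.dilation →
      Real.exp ((x - (x - M.shift) / M.dilation) *
        ((x - M.shift) / M.dilation) ^ (M.shape - 1)) / M.dilation ≤ M.likRatio x := by
    intro x hx hx2
    have h1 := density_div_rpow hζ (x := (x - M.shift) / M.dilation)
      (s := x - (x - M.shift) / M.dilation) (div_nonneg (by linarith) hb.le) hx2
    rw [add_sub_cancel, Real.exp_neg, ← div_eq_mul_inv, le_div_iff₀ (Real.exp_pos _)] at h1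
    unfold likRatio
    rw [div_le_div_iff₀ hb (mul_pos hb (density_pos hζ x))]
    calc _ = density M.shape x * Real.exp ((x - (x - M.shift) / M.dilation) *
        ((x - M.shift) / M.dilation) ^ (M.shape - 1)) * M.dilation := by ring
      _ ≤ _ := mul_le_mul_of_nonneg_right h1 hb.le
  obtain ⟨k, ζ, τ, θ⟩ := M
  cases k
  · simp only [shift, dilation, ModelKind.shift, ModelKind.dilation, div_one, sub_sub_cancel] at *
    simp only [AdmissibleShape, AdmissibleSignal] at hsh hs
    have ht : Tendsto (fun x : ℝ => Real.exp (θ * (x - θ) ^ (ζ - 1))) atTop atTop := by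
      refine Real.tendsto_exp_atTop.comp (Tendsto.const_mul_atTop hs ?_)
      exact (tendsto_rpow_atTop (by linarith)).comp (tendsto_atTop_add_const_right _ _ tendsto_id)
    obtain ⟨x, hx1, hx2, hx3⟩ := ((ht.eventually_gt_atTop c).and
      ((eventually_ge_atTop B).and (eventually_ge_atTop θ))).exists
    exact ⟨x, hx2, trivial, hx1.trans_le (key x hx3 hs.le)⟩
  · simp only [shift, dilation, ModelKind.shift, ModelKind.dilation, sub_zero] at *
    simp only [AdmissibleSignal] at hs
    have e : ∀ x : ℝ, x - x / θ = (1 - θ⁻¹) * x := fun x => by ring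
    have hθ : 0 < 1 - θ⁻¹ := by
      have := inv_lt_one_of_one_lt₀ hs
      linarith
    have ht : Tendsto (fun x : ℝ => Real.exp ((1 - θ⁻¹) * x) / θ) atTop atTop :=
      (Real.tendsto_exp_atTop.comp (tendsto_id.const_mul_atTop hθ)).atTop_div_const hb
    obtain ⟨x, hx1, hx2, hx3⟩ := ((ht.eventually_gt_atTop c).and
      ((eventually_ge_atTop B).and (eventually_ge_atTop θ))).exists
    have hx0 : 0 ≤ x := by linarith
    refine ⟨x, hx2, show 0 < x by linarith, hx1.trans_le (le_trans ?_ (key x hx0 ?_))⟩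
    · rw [e]
      have h1 : 1 ≤ (x / θ) ^ (ζ - 1) :=
        Real.one_le_rpow ((one_le_div hb).2 hx3) (by linarith)
      have h2 : 0 ≤ (1 - θ⁻¹) * x := by positivity
      exact div_le_div_of_nonneg_right (Real.exp_le_exp.2 (le_mul_of_one_le_right h2 h1)) hb.le
    · rw [e]
      positivity

/-- At the midpoint between the two centres the exponents cancel. With `τ > 1`, this is the left end
for the intermediate value theorem, and it later shows that the Bayes cutoff is positive. -/
lemma likRatio_half_shift_le (h : M.Regular) : M.likRatio (M.shift / 2) ≤ 1 := by
  have hb1 := h.one_le_dilation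
  rw [likRatio_eq_exp h, div_le_one h.dilation_pos]
  refine le_trans (Real.exp_le_one_iff.2 ?_) hb1
  refine div_nonpos_of_nonpos_of_nonneg (le_of_eq ?_) (by linarith [h.one_le])
  obtain ⟨k, ζ, τ, θ⟩ := M
  cases k
  · have : θ / 2 - θ = -(θ / 2) := by ring
    simp [shift, dilation, ModelKind.shift, ModelKind.dilation, this]
  · simp [shift, ModelKind.shift]

lemma exists_likRatio_eq (h : M.Regular) : ∃ x ∈ M.kind.domain, M.likRatio x = M.sparsity := by
  have hτ := h.sparsity
  have h0 := likRatio_half_shift_le h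
  obtain ⟨X, hX1, -, hX2⟩ := exists_likRatio_ge h M.sparsity (M.shift / 2)
  obtain ⟨x, hx, hxe⟩ := intermediate_value_Icc hX1 (continuous_likRatio h).continuousOn
    ⟨h0.trans hτ.le, hX2.le⟩
  refine ⟨x, ?_, hxe⟩
  rcases hx.1.eq_or_lt with rfl | hlt
  · linarith
  obtain ⟨k, ζ, τ, θ⟩ := M
  cases k
  · trivial
  · simpa [shift, ModelKind.shift, ModelKind.domain] using hlt

/-- `invFunOn` picks some solution of `f t = τ`. Uniqueness is not needed: all that follows uses
only that the ratio at the cutoff equals `τ`. -/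
lemma exists_bayesThreshold_eq (h : M.Regular) :
    ∃ x ∈ M.kind.domain, M.bayesThreshold = tailP M.kind M.shape x ∧
      M.likRatio x = M.sparsity := by
  obtain ⟨x, hx, hxe⟩ := exists_likRatio_eq h
  have hex : ∃ t ∈ Ioo (0 : ℝ) 1, M.altPDensity t = M.sparsity :=
    ⟨_, tailP_mem_Ioo h.one_le hx, by rw [altPDensity_tailP h hx, hxe]⟩
  have h1 : M.bayesThreshold ∈ Ioo (0 : ℝ) 1 := Function.invFunOn_mem hex
  have h2 : M.altPDensity M.bayesThreshold = M.sparsity := Function.invFunOn_eq hex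
  obtain ⟨z, hz, hze⟩ := exists_tailP_eq (k := M.kind) h.one_le h1
  refine ⟨z, hz, hze.symm, ?_⟩
  rw [← altPDensity_tailP h hz, hze, h2]

/-- Misclassification risk of one observation for a threshold in `[0,1]`. -/
noncomputable def pointRisk (M : Model) (t : ℝ) : ℝ := M.pi0 * t + M.pi1 * (1 - M.altCdf t)

lemma pointRisk_eq (t : ℝ) :
    M.pointRisk t = M.pi1 * (M.sparsity * t + 1 - M.altCdf t) := by
  rw [pointRisk, pi0_eq]
  ring

lemma pointRisk_bayes_le (h : M.Regular) {A : Set ℝ} (hA : MeasurableSet A) :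
    M.pointRisk M.bayesThreshold ≤ M.pi0 * M.nullLaw.real A + M.pi1 * M.altLaw.real Aᶜ := by
  have := isProbabilityMeasure_altLaw h
  obtain ⟨x, hx, hxt, hxl⟩ := exists_bayesThreshold_eq h
  have h1 := altLaw_sub_nullLaw_le h hx hA
  rw [measureReal_compl hA, pointRisk_eq, pi0_eq, hxt, probReal_univ]
  rw [hxl] at h1
  have := mul_le_mul_of_nonneg_left h1 h.pi1_pos.le
  linarith

lemma pointRisk_bayes_le_pointRisk (h : M.Regular) {t : ℝ} (ht : t ∈ Icc (0 : ℝ) 1) :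
    M.pointRisk M.bayesThreshold ≤ M.pointRisk t := by
  have hA := (measurable_pValue h) (measurableSet_Iic (a := t))
  have := isProbabilityMeasure_altLaw h
  have h1 := pointRisk_bayes_le h hA
  rw [measureReal_compl hA, probReal_univ] at h1
  have h2 := nullLaw_pValue_le h ht
  change M.nullLaw.real (pValue M.kind M.shape ⁻¹' Iic t) = t at h2
  rw [h2] at h1
  exact h1

lemma altCdf_pos (h : M.Regular) {t : ℝ} (ht : t ∈ Ioo (0 : ℝ) 1) : 0 < M.altCdf t := by
  obtain ⟨x, hx, rfl⟩ := exists_tailP_eq (k := M.kind) h.one_le ht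
  exact lt_of_lt_of_le (mul_pos (likRatio_pos h x) ht.1) (likRatio_mul_le_altCdf h hx)

lemma exists_bfdr_eq (h : M.Regular) {α : ℝ} (hα : α ∈ Ioo 0 M.pi0) :
    ∃ t ∈ Ioo (0 : ℝ) 1, M.bfdr t = α := by
  have hζ := h.one_le
  have hb := h.dilation_pos
  have hp0 := h.pi0_pos
  have hp1 := h.pi1_pos
  -- The BFDR as a function of the cutoff, extended continuously beyond `domain` so that the
  -- intermediate value theorem applies up to the boundary.
  set ψ : ℝ → ℝ := fun x => M.pi0 * tailP M.kind M.shape x /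
    (M.pi0 * tailP M.kind M.shape x +
      M.pi1 * tailP M.kind M.shape ((x - M.shift) / M.dilation)) with hψ
  have hden : ∀ x, 0 < M.pi0 * tailP M.kind M.shape x +
      M.pi1 * tailP M.kind M.shape ((x - M.shift) / M.dilation) := fun x =>
    add_pos (mul_pos hp0 (tailP_pos hζ _)) (mul_pos hp1 (tailP_pos hζ _))
  have hc := continuous_tailP (k := M.kind) hζ
  have hcψ : Continuous ψ := by
    refine Continuous.div (hc.const_mul _) ((hc.const_mul _).add
      ((hc.comp (by fun_prop)).const_mul _)) fun x => (hden x).ne'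
  have hF : ∀ x ∈ M.kind.domain, M.altCdf (tailP M.kind M.shape x) =
      tailP M.kind M.shape ((x - M.shift) / M.dilation) := fun x hx => by
    have he : x = M.shift + M.dilation * ((x - M.shift) / M.dilation) := by
      field_simp
      ring
    conv_lhs => rw [he]
    exact altCdf_tailP h ((mem_domain_iff h).1 (he ▸ hx))
  have hψe : ∀ x ∈ M.kind.domain, M.bfdr (tailP M.kind M.shape x) = ψ x := fun x hx => by
    rw [bfdr, hF x hx]
  -- Where the level tends to one the BFDR tends to `π₀ > α`: at minus infinity for location, at the
  -- excluded boundary point `0` for scale.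
  have hlow : ∃ x₁, α < ψ x₁ ∧ ∀ x, x₁ < x → x ∈ M.kind.domain := by
    have hsum := h.pi0_add_pi1
    clear_value ψ
    obtain ⟨k, ζ, τ, θ⟩ := M
    cases k
    · have hT : Tendsto (tailP .location ζ) atBot (𝓝 1) := by
        have := (tendsto_upperTail_atBot hζ).const_mul (ModelKind.tails .location)
        rwa [ModelKind.tails, mul_one] at this
      have h2 : Tendsto (fun x : ℝ => (x - shift ⟨.location, ζ, τ, θ⟩) /
          dilation ⟨.location, ζ, τ, θ⟩) atBot atBot :=
        (tendsto_atBot_add_const_right _ _ tendsto_id).atBot_div_const hb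
      have h3 := (hT.const_mul (pi0 ⟨.location, ζ, τ, θ⟩)).div
        ((hT.const_mul (pi0 ⟨.location, ζ, τ, θ⟩)).add
          ((hT.comp h2).const_mul (pi1 ⟨.location, ζ, τ, θ⟩)))
        (by rw [mul_one, mul_one, hsum]; exact one_ne_zero)
      rw [mul_one, mul_one, hsum, div_one] at h3
      obtain ⟨x, hx⟩ := (h3.eventually (lt_mem_nhds hα.2)).exists
      refine ⟨x, ?_, fun _ _ => trivial⟩
      rw [hψ]
      exact hx
    · refine ⟨0, ?_, fun x hx => hx⟩
      rw [hψ]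
      have h0 : tailP .scale ζ 0 = 1 := by
        rw [tailP, upperTail_zero hζ]
        norm_num [ModelKind.tails]
      simp only [shift, ModelKind.shift, sub_zero, zero_div]
      rw [h0, mul_one, mul_one, hsum, div_one]
      exact hα.2
  obtain ⟨x₁, hx₁, hdom⟩ := hlow
  obtain ⟨X, hX1, hXd, hX2⟩ := exists_likRatio_ge h (M.sparsity / α) x₁
  -- A likelihood ratio above `τ / α` forces `α F t > τ t`, hence a BFDR below `α`.
  have hψX : ψ X < α := by
    have h1 := likRatio_mul_le_altCdf h hXd
    rw [hF X hXd] at h1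
    have ht := tailP_pos (k := M.kind) hζ X
    rw [hψ]
    simp only
    rw [div_lt_iff₀ (hden X), pi0_eq]
    have h2 : M.sparsity / α * tailP M.kind M.shape X <
        tailP M.kind M.shape ((X - M.shift) / M.dilation) :=
      lt_of_lt_of_le (mul_lt_mul_of_pos_right hX2 ht) h1
    have h3 : M.sparsity * tailP M.kind M.shape X <
        α * tailP M.kind M.shape ((X - M.shift) / M.dilation) := by
      have := mul_lt_mul_of_pos_left h2 hα.1
      calc _ = α * (M.sparsity / α * tailP M.kind M.shape X) := by
            have := hα.1.ne'
            field_simp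
        _ < _ := this
    have h4 := mul_lt_mul_of_pos_left h3 hp1
    have h5 : 0 < α * (M.sparsity * M.pi1 * tailP M.kind M.shape X) :=
      mul_pos hα.1 (mul_pos (mul_pos h.sparsity_pos hp1) ht)
    linarith
  obtain ⟨x, hx, hxe⟩ := intermediate_value_Icc' hX1 hcψ.continuousOn ⟨hψX.le, hx₁.le⟩
  have hxd : x ∈ M.kind.domain := by
    refine hdom x (lt_of_le_of_ne hx.1 ?_)
    rintro rfl
    linarith
  exact ⟨_, tailP_mem_Ioo hζ hxd, (hψe x hxd).trans hxe⟩

lemma bfdrThreshold_mem (h : M.Regular) {α : ℝ} (hα : α ∈ Ioo 0 M.pi0) :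
    M.bfdrThreshold α ∈ Ioo (0 : ℝ) 1 := Function.invFunOn_mem (exists_bfdr_eq h hα)

lemma bfdrThreshold_eq (h : M.Regular) {α : ℝ} (hα : α ∈ Ioo 0 M.pi0) :
    (1 - α) * (M.sparsity * M.bfdrThreshold α) = α * M.altCdf (M.bfdrThreshold α) := by
  have hm := bfdrThreshold_mem h hα
  have he : M.bfdr (M.bfdrThreshold α) = α := Function.invFunOn_eq (exists_bfdr_eq h hα)
  have hF := altCdf_pos h hm
  have hp := h.pi1_pos
  rw [bfdr, pi0_eq, div_eq_iff (by
    have := h.sparsity_pos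
    have := hm.1
    positivity)] at he
  have : M.pi1 * ((1 - α) * (M.sparsity * M.bfdrThreshold α)) =
      M.pi1 * (α * M.altCdf (M.bfdrThreshold α)) := by linarith
  exact mul_left_cancel₀ hp.ne' this

end Model

/-! ### Product measures: resampling one coordinate, and a Chernoff bound. -/

section Product

variable {ι X : Type*} [DecidableEq ι] [MeasurableSpace X]
  (μ : Measure X) [IsProbabilityMeasure μ]

/-- Resampling one coordinate does not change a product law. -/
lemma pi_apply_eq_lintegral_update [Fintype ι] (i : ι) {E : Set (ι → X)} (hE : MeasurableSet E) :
    Measure.pi (fun _ : ι => μ) E =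
      ∫⁻ ω, μ {z | Function.update ω i z ∈ E} ∂Measure.pi (fun _ : ι => μ) := by
  have hf : Measurable (E.indicator (1 : (ι → X) → ENNReal)) := measurable_one.indicator hE
  have hg : ∀ ω : ι → X, μ {z | Function.update ω i z ∈ E} =
      lmarginal (fun _ => μ) {i} (E.indicator 1) ω := fun ω => by
    rw [lmarginal_singleton]
    exact (lintegral_indicator_one (measurable_update ω hE)).symm
  rw [← lintegral_indicator_one hE]
  simp only [hg]
  refine lintegral_eq_of_lmarginal_eq {i} hf (hf.lmarginal _) ?_
  funext ω
  conv_rhs => rw [lmarginal_singleton]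
  simp only [lmarginal_singleton, Function.update_idem, lintegral_const, measure_univ, mul_one]

lemma measurable_measureReal_update (i : ι) {E : Set (ι → X)} (hE : MeasurableSet E) :
    Measurable fun ω : ι → X => μ.real {z | Function.update ω i z ∈ E} := by
  have hf : Measurable (E.indicator (1 : (ι → X) → ENNReal)) := measurable_one.indicator hE
  have hg : ∀ ω : ι → X, μ.real {z | Function.update ω i z ∈ E} =
      (lmarginal (fun _ => μ) {i} (E.indicator 1) ω).toReal := fun ω => by
    rw [lmarginal_singleton, Measure.real]
    congr 1
    exact (lintegral_indicator_one (measurable_update ω hE)).symm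
  simp only [hg]
  exact (hf.lmarginal _).ennreal_toReal

lemma integrable_measureReal_update [Fintype ι] (i : ι) {E : Set (ι → X)} (hE : MeasurableSet E) :
    Integrable (fun ω : ι → X => μ.real {z | Function.update ω i z ∈ E})
      (Measure.pi fun _ : ι => μ) :=
  Integrable.of_bound (measurable_measureReal_update μ i hE).aestronglyMeasurable 1
    (Eventually.of_forall fun ω => by
      rw [Real.norm_of_nonneg measureReal_nonneg]
      exact measureReal_le_one)

lemma pi_real_eq_integral_update [Fintype ι] (i : ι) {E : Set (ι → X)} (hE : MeasurableSet E) :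
    (Measure.pi fun _ : ι => μ).real E =
      ∫ ω, μ.real {z | Function.update ω i z ∈ E} ∂Measure.pi (fun _ : ι => μ) := by
  have h1 := ofReal_integral_eq_lintegral_ofReal (integrable_measureReal_update μ i hE)
    (Eventually.of_forall fun _ => measureReal_nonneg)
  have h2 : ∀ ω : ι → X, ENNReal.ofReal (μ.real {z | Function.update ω i z ∈ E}) =
      μ {z | Function.update ω i z ∈ E} := fun ω => ofReal_measureReal
  simp only [h2] at h1
  rw [Measure.real, pi_apply_eq_lintegral_update μ i hE, ← h1,
    ENNReal.toReal_ofReal (integral_nonneg fun _ => measureReal_nonneg)]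

open ProbabilityTheory in
/-- A Chernoff lower-tail bound for the number of successes. -/
lemma pi_real_card_le_half {ι : Type*} [Fintype ι] {A : Set X} [DecidablePred (· ∈ A)]
    (hA : MeasurableSet A) {b : ℝ}
    (hb : b ≤ Fintype.card ι * μ.real A / 2) :
    (Measure.pi fun _ : ι => μ).real
        {ω | ((Finset.univ.filter fun i => ω i ∈ A).card : ℝ) ≤ b} ≤
      Real.exp (-(Fintype.card ι * μ.real A / 10)) := by
  have hcard : ∀ ω : ι → X, ((Finset.univ.filter fun i => ω i ∈ A).card : ℝ) =
      ∑ i, A.indicator (1 : X → ℝ) (ω i) := fun ω => by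
    rw [Finset.card_filter]
    push_cast
    refine Finset.sum_congr rfl fun i _ => ?_
    by_cases h : ω i ∈ A <;> simp [h]
  have hint : ∫ x, Real.exp (-A.indicator (1 : X → ℝ) x) ∂μ =
      1 - (1 - Real.exp (-1)) * μ.real A := by
    have he : (fun x => Real.exp (-A.indicator (1 : X → ℝ) x)) =
        fun x => 1 - A.indicator (fun _ => 1 - Real.exp (-1)) x := by
      funext x
      by_cases h : x ∈ A <;> simp [h]
    rw [he, integral_sub (integrable_const _) ((integrable_const _).indicator hA),
      integral_indicator hA]
    simp [mul_comm]
  have hprod : mgf (fun ω : ι → X => ((Finset.univ.filter fun i => ω i ∈ A).card : ℝ))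
      (Measure.pi fun _ : ι => μ) (-1) =
      (1 - (1 - Real.exp (-1)) * μ.real A) ^ Fintype.card ι := by
    rw [mgf, ← hint, ← integral_fintype_prod_eq_pow (𝕜 := ℝ)]
    refine integral_congr_ae (Eventually.of_forall fun ω => ?_)
    simp only
    rw [hcard, neg_one_mul, ← Finset.sum_neg_distrib, Real.exp_sum]
  have hmeas : Measurable fun ω : ι → X =>
      ((Finset.univ.filter fun i => ω i ∈ A).card : ℝ) := by
    simp only [hcard]
    exact Finset.measurable_sum _ fun i _ =>
      (measurable_one.indicator hA).comp (measurable_pi_apply i)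
  have hmark := measure_le_le_exp_mul_mgf (μ := Measure.pi fun _ : ι => μ)
    (X := fun ω : ι → X => ((Finset.univ.filter fun i => ω i ∈ A).card : ℝ)) (t := -1) b
    (by norm_num) (Integrable.of_bound (hmeas.const_mul _).exp.aestronglyMeasurable 1
      (Eventually.of_forall fun ω => by
      rw [Real.norm_of_nonneg (Real.exp_pos _).le, Real.exp_le_one_iff]
      have : (0 : ℝ) ≤ ((Finset.univ.filter fun i => ω i ∈ A).card : ℝ) := Nat.cast_nonneg _
      linarith))
  rw [hprod] at hmark
  refine hmark.trans ?_
  -- The exponential moment at parameter `-1` yields the exponent `-0.6 n q`, since `1 - exp (-1) ≥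
  -- 0.6`. Against `b ≤ n q / 2` this leaves `-n q / 10`.
  have he : Real.exp (-1) ≤ 0.4 := by
    have := Real.exp_one_gt_d9
    rw [Real.exp_neg, inv_le_comm₀ (Real.exp_pos _) (by norm_num)]
    norm_num
    linarith
  have hq0 : 0 ≤ μ.real A := measureReal_nonneg
  have hq1 : μ.real A ≤ 1 := measureReal_le_one
  have h1 : 1 - (1 - Real.exp (-1)) * μ.real A ≤ Real.exp (-(0.6 * μ.real A)) := by
    have := Real.add_one_le_exp (-(0.6 * μ.real A))
    nlinarith
  have h0 : 0 ≤ 1 - (1 - Real.exp (-1)) * μ.real A := by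
    have := Real.exp_pos (-1)
    nlinarith
  calc _ ≤ Real.exp (-(-1) * b) * Real.exp (-(0.6 * μ.real A)) ^ Fintype.card ι := by gcongr
    _ = Real.exp (b - 0.6 * (Fintype.card ι * μ.real A)) := by
      rw [← Real.exp_nat_mul, ← Real.exp_add]
      congr 1
      ring
    _ ≤ _ := by
      rw [Real.exp_le_exp]
      linarith

end Product

/-! ### Deterministic properties of the Benjamini-Hochberg threshold. -/

section BenjaminiHochberg

variable {m : ℕ} {α : ℝ} {p : Fin m → ℝ}

lemma empCdf_nonneg (p : Fin m → ℝ) (t : ℝ) : 0 ≤ empCdf p t := by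
  unfold empCdf
  positivity

lemma empCdf_le_one (p : Fin m → ℝ) (t : ℝ) : empCdf p t ≤ 1 := by
  unfold empCdf
  rcases Nat.eq_zero_or_pos m with rfl | hm
  · simp
  have hm' : (0 : ℝ) < m := by exact_mod_cast hm
  rw [inv_mul_le_iff₀ hm', mul_one]
  exact_mod_cast (Finset.card_filter_le _ _).trans (by simp)

lemma empCdf_mono_right (p : Fin m → ℝ) : Monotone (empCdf p) := fun s t hst => by
  unfold empCdf
  gcongr

lemma empCdf_anti_left {p q : Fin m → ℝ} (hpq : p ≤ q) (t : ℝ) : empCdf q t ≤ empCdf p t := by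
  unfold empCdf
  gcongr with i
  exact hpq i

lemma empCdf_eq_sum (p : Fin m → ℝ) (t : ℝ) :
    empCdf p t = (m : ℝ)⁻¹ * ∑ i, if p i ≤ t then 1 else 0 := by
  rw [empCdf, Finset.card_filter]
  push_cast
  rfl

lemma zero_mem_bh (α : ℝ) (p : Fin m → ℝ) :
    (0 : ℝ) ∈ {t | t ∈ Icc (0 : ℝ) 1 ∧ t / α ≤ empCdf p t} :=
  ⟨by simp, by simpa using empCdf_nonneg p 0⟩

lemma bddAbove_bh (α : ℝ) (p : Fin m → ℝ) :
    BddAbove {t | t ∈ Icc (0 : ℝ) 1 ∧ t / α ≤ empCdf p t} := ⟨1, fun _ ht => ht.1.2⟩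

lemma le_bhThreshold {t : ℝ} (ht : t ∈ Icc (0 : ℝ) 1) (h : t / α ≤ empCdf p t) :
    t ≤ bhThreshold α p := le_csSup (bddAbove_bh α p) ⟨ht, h⟩

lemma bhThreshold_nonneg (α : ℝ) (p : Fin m → ℝ) : 0 ≤ bhThreshold α p :=
  le_csSup (bddAbove_bh α p) (zero_mem_bh α p)

/-- The empirical c.d.f. is monotone, so each admissible `t` satisfies the bound with the empirical
c.d.f. evaluated at the supremum; hence so does the supremum. -/
lemma bhThreshold_le_empCdf (hα : 0 < α) (p : Fin m → ℝ) :
    bhThreshold α p ≤ α * empCdf p (bhThreshold α p) := by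
  refine csSup_le ⟨0, zero_mem_bh α p⟩ fun t ht => ?_
  have h1 := (div_le_iff₀' hα).1 ht.2
  exact h1.trans (mul_le_mul_of_nonneg_left
    (empCdf_mono_right p (le_csSup (bddAbove_bh α p) ht)) hα.le)

lemma bhThreshold_le (hα : 0 < α) (p : Fin m → ℝ) : bhThreshold α p ≤ α :=
  (bhThreshold_le_empCdf hα p).trans (mul_le_of_le_one_right hα.le (empCdf_le_one p _))

lemma bhThreshold_anti (α : ℝ) {p q : Fin m → ℝ} (hpq : p ≤ q) :
    bhThreshold α q ≤ bhThreshold α p :=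
  csSup_le_csSup (bddAbove_bh α p) ⟨0, zero_mem_bh α q⟩ fun _ ht =>
    ⟨ht.1, ht.2.trans (empCdf_anti_left hpq _)⟩

/-- The threshold can only take the values `α k / m`. Writing it as a finite maximum makes it
measurable in the `p`-values. -/
lemma bhThreshold_eq_sup' (hα : 0 < α) (hα1 : α ≤ 1) (p : Fin m → ℝ) :
    bhThreshold α p = (Finset.range (m + 1)).sup' Finset.nonempty_range_add_one fun k =>
      if (k : ℝ) / m ≤ empCdf p (α * (k / m)) then α * (k / m) else 0 := by
  refine le_antisymm ?_ (Finset.sup'_le _ _ fun k hk => ?_)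
  -- The number of rejections is the index at which the maximum is reached.
  · set N := (Finset.univ.filter fun i => p i ≤ bhThreshold α p).card with hN
    have hNe : empCdf p (bhThreshold α p) = N / m := by rw [empCdf, hN, div_eq_inv_mul]
    have hle := bhThreshold_le_empCdf hα p
    rw [hNe] at hle
    have hNm : N ∈ Finset.range (m + 1) := by
      rw [Finset.mem_range, Nat.lt_succ_iff]
      exact (Finset.card_filter_le _ _).trans (by simp)
    refine le_trans ?_ (Finset.le_sup' _ hNm)
    rw [if_pos]
    · exact hle
    · rw [← hNe]
      exact empCdf_mono_right p (by rwa [hNe])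
  · split_ifs with h
    · have hk1 : (k : ℝ) / m ≤ 1 := by
        refine div_le_one_of_le₀ ?_ (Nat.cast_nonneg m)
        exact_mod_cast Nat.lt_succ_iff.1 (Finset.mem_range.1 hk)
      refine le_bhThreshold ⟨by positivity, ?_⟩ ?_
      · exact mul_le_one₀ hα1 (by positivity) hk1
      · rwa [mul_div_cancel_left₀ _ hα.ne']
    · exact bhThreshold_nonneg α p

lemma measurable_empCdf (t : ℝ) : Measurable fun p : Fin m → ℝ => empCdf p t := by
  simp only [empCdf_eq_sum]
  refine (Finset.measurable_sum _ fun i _ => ?_).const_mul _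
  exact Measurable.ite (measurableSet_le (measurable_pi_apply i) measurable_const)
    measurable_const measurable_const

lemma measurable_bhThreshold (hα : 0 < α) (hα1 : α ≤ 1) :
    Measurable (bhThreshold α : (Fin m → ℝ) → ℝ) := by
  have : (bhThreshold α : (Fin m → ℝ) → ℝ) = (Finset.range (m + 1)).sup' Finset.nonempty_range_add_one
      fun k p => if (k : ℝ) / m ≤ empCdf p (α * (k / m)) then α * (k / m) else 0 := by
    funext p
    rw [bhThreshold_eq_sup' hα hα1, Finset.sup'_apply]
  rw [this]
  refine Finset.measurable_sup' _ fun k _ => ?_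
  exact Measurable.ite (measurableSet_le measurable_const (measurable_empCdf _))
    measurable_const measurable_const

/-- The vector of `p`-values with the coordinates in `S` replaced by zero. -/
def zeroOn (S : Finset (Fin m)) (p : Fin m → ℝ) : Fin m → ℝ := fun i => if i ∈ S then 0 else p i

lemma measurable_zeroOn (S : Finset (Fin m)) : Measurable (zeroOn S) := by
  refine measurable_pi_lambda _ fun i => ?_
  unfold zeroOn
  by_cases h : i ∈ S
  · simp only [h, if_true]
    exact measurable_const
  · simp only [h, if_false]
    exact measurable_pi_apply i

lemma zeroOn_anti {S S' : Finset (Fin m)} (hS : S ⊆ S') (hp : 0 ≤ p) :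
    zeroOn S' p ≤ zeroOn S p := fun i => by
  unfold zeroOn
  by_cases h : i ∈ S
  · simp [h, hS h]
  · by_cases h' : i ∈ S'
    · simpa [h, h'] using hp i
    · simp [h, h']

lemma zeroOn_empty (p : Fin m → ℝ) : zeroOn ∅ p = p := by
  funext i
  simp [zeroOn]

lemma zeroOn_update {S : Finset (Fin m)} {i : Fin m} (hi : i ∈ S) (p : Fin m → ℝ) (v : ℝ) :
    zeroOn S (Function.update p i v) = zeroOn S p := by
  funext j
  unfold zeroOn
  by_cases h : j ∈ S
  · simp [h]
  · simp only [h, if_false]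
    rw [Function.update_of_ne]
    rintro rfl
    exact h hi

end BenjaminiHochberg

/-! ### Risks of data-driven thresholds. -/

namespace Model

variable {M : Model} {m : ℕ}

lemma Regular.pi1_le_one (h : M.Regular) : M.pi1 ≤ 1 := by
  have := h.pi0_add_pi1
  have := h.pi0_pos
  linarith

lemma pairLaw_apply {E : Set (ℝ × Bool)} (hE : MeasurableSet E) :
    M.pairLaw E = ENNReal.ofReal M.pi0 * M.nullLaw {x | (x, false) ∈ E} +
      ENNReal.ofReal M.pi1 * M.altLaw {x | (x, true) ∈ E} := by
  have h1 : ∀ b : Bool, Measurable fun x : ℝ => (x, b) := fun b => measurable_prodMk_right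
  rw [pairLaw, Measure.add_apply, Measure.smul_apply, Measure.smul_apply,
    Measure.map_apply (h1 _) hE, Measure.map_apply (h1 _) hE]
  rfl

lemma isProbabilityMeasure_pairLaw (h : M.Regular) : IsProbabilityMeasure M.pairLaw := by
  have := isProbabilityMeasure_nullLaw h
  have := isProbabilityMeasure_altLaw h
  constructor
  rw [pairLaw_apply MeasurableSet.univ]
  simp only [mem_univ, ofPred_true, measure_univ, mul_one]
  rw [← ENNReal.ofReal_add h.pi0_pos.le h.pi1_pos.le, h.pi0_add_pi1, ENNReal.ofReal_one]

lemma pairLaw_real (h : M.Regular) {E : Set (ℝ × Bool)} (hE : MeasurableSet E) :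
    M.pairLaw.real E = M.pi0 * M.nullLaw.real {x | (x, false) ∈ E} +
      M.pi1 * M.altLaw.real {x | (x, true) ∈ E} := by
  have := isProbabilityMeasure_nullLaw h
  have := isProbabilityMeasure_altLaw h
  rw [Measure.real, pairLaw_apply hE, ENNReal.toReal_add (by finiteness) (by finiteness),
    ENNReal.toReal_mul, ENNReal.toReal_mul, ENNReal.toReal_ofReal h.pi0_pos.le,
    ENNReal.toReal_ofReal h.pi1_pos.le]
  rfl

lemma isProbabilityMeasure_sampleLaw (h : M.Regular) (m : ℕ) :
    IsProbabilityMeasure (M.sampleLaw m) := by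
  have := isProbabilityMeasure_pairLaw h
  unfold sampleLaw
  infer_instance

lemma measurable_pValues (h : M.Regular) :
    Measurable (M.pValues : (Fin m → ℝ × Bool) → Fin m → ℝ) :=
  measurable_pi_lambda _ fun i =>
    (measurable_pValue h).comp (measurable_fst.comp (measurable_pi_apply i))

lemma pValues_nonneg (h : M.Regular) (ω : Fin m → ℝ × Bool) : 0 ≤ M.pValues ω := fun i =>
  (pValue_pos h (ω i).1).le

lemma pValues_update (ω : Fin m → ℝ × Bool) (i : Fin m) (z : ℝ × Bool) :
    M.pValues (Function.update ω i z) =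
      Function.update (M.pValues ω) i (pValue M.kind M.shape z.1) := by
  funext j
  unfold pValues
  by_cases h : j = i
  · subst h
    simp
  · simp [Function.update_of_ne h]

lemma sampleLaw_real_eq (h : M.Regular) (i : Fin m) {E : Set (Fin m → ℝ × Bool)}
    (hE : MeasurableSet E) :
    (M.sampleLaw m).real E = ∫ ω, (M.pi0 * M.nullLaw.real {x | Function.update ω i (x, false) ∈ E} +
      M.pi1 * M.altLaw.real {x | Function.update ω i (x, true) ∈ E}) ∂M.sampleLaw m := by
  have := isProbabilityMeasure_pairLaw h
  unfold sampleLaw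
  rw [pi_real_eq_integral_update M.pairLaw i hE]
  refine integral_congr_ae (Eventually.of_forall fun ω => ?_)
  exact pairLaw_real h (measurable_update ω hE)

lemma integrable_sampleLaw_update (h : M.Regular) (i : Fin m) {E : Set (Fin m → ℝ × Bool)}
    (hE : MeasurableSet E) :
    Integrable (fun ω => M.pi0 * M.nullLaw.real {x | Function.update ω i (x, false) ∈ E} +
      M.pi1 * M.altLaw.real {x | Function.update ω i (x, true) ∈ E}) (M.sampleLaw m) := by
  have := isProbabilityMeasure_pairLaw h
  refine (integrable_measureReal_update M.pairLaw i hE).congr (Eventually.of_forall fun ω => ?_)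
  exact pairLaw_real h (measurable_update ω hE)

lemma measurableSet_snd (i : Fin m) (b : Bool) :
    MeasurableSet {ω : Fin m → ℝ × Bool | (ω i).2 = b} :=
  (measurable_snd.comp (measurable_pi_apply i)) (measurableSet_singleton b)

lemma measurableSet_falsePos (h : M.Regular) {T : (Fin m → ℝ) → ℝ} (hT : Measurable T)
    (i : Fin m) :
    MeasurableSet {ω : Fin m → ℝ × Bool | M.pValues ω i ≤ T (M.pValues ω) ∧ (ω i).2 = false} :=
  (measurableSet_le ((measurable_pi_apply i).comp (measurable_pValues h))
    (hT.comp (measurable_pValues h))).inter (measurableSet_snd i false)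

lemma measurableSet_falseNeg (h : M.Regular) {T : (Fin m → ℝ) → ℝ} (hT : Measurable T)
    (i : Fin m) :
    MeasurableSet {ω : Fin m → ℝ × Bool | T (M.pValues ω) < M.pValues ω i ∧ (ω i).2 = true} :=
  (measurableSet_lt (hT.comp (measurable_pValues h))
    ((measurable_pi_apply i).comp (measurable_pValues h))).inter (measurableSet_snd i true)

lemma integrable_comp_pValues (h : M.Regular) {T : (Fin m → ℝ) → ℝ} (hT : Measurable T)
    (hT1 : ∀ p, T p ∈ Icc (0 : ℝ) 1) : Integrable (fun ω => T (M.pValues ω)) (M.sampleLaw m) := by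
  have := isProbabilityMeasure_sampleLaw h m
  refine Integrable.of_bound (hT.comp (measurable_pValues h)).aestronglyMeasurable 1
    (Eventually.of_forall fun ω => ?_)
  rw [Real.norm_of_nonneg (hT1 _).1]
  exact (hT1 _).2

lemma integrable_altCdf_comp (h : M.Regular) {T : (Fin m → ℝ) → ℝ} (hT : Measurable T) :
    Integrable (fun ω => M.altCdf (T (M.pValues ω))) (M.sampleLaw m) := by
  have := isProbabilityMeasure_sampleLaw h m
  refine Integrable.of_bound ((altCdf_mono h).measurable.comp
    (hT.comp (measurable_pValues h))).aestronglyMeasurable 1 (Eventually.of_forall fun ω => ?_)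
  rw [Real.norm_of_nonneg (altCdf_nonneg _)]
  exact altCdf_le_one h _

/-- If the threshold ignores the `i`-th `p`-value, that `p`-value is uniform given the threshold
and a null label. -/
lemma sampleLaw_falsePos_eq (h : M.Regular) {T : (Fin m → ℝ) → ℝ} (hT : Measurable T)
    (hT1 : ∀ p, T p ∈ Icc (0 : ℝ) 1) (i : Fin m)
    (hi : ∀ p v, T (Function.update p i v) = T p) :
    (M.sampleLaw m).real {ω | M.pValues ω i ≤ T (M.pValues ω) ∧ (ω i).2 = false} =
      M.pi0 * ∫ ω, T (M.pValues ω) ∂M.sampleLaw m := by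
  rw [sampleLaw_real_eq h i (measurableSet_falsePos h hT i), ← integral_const_mul]
  refine integral_congr_ae (Eventually.of_forall fun ω => ?_)
  simp only [mem_ofPred_eq, pValues_update, Function.update_self, hi, and_true, reduceCtorEq,
    and_false, ofPred_false, measureReal_empty, mul_zero, add_zero]
  rw [nullLaw_pValue_le h (hT1 _)]

lemma sampleLaw_falseNeg_const (h : M.Regular) (t : ℝ) (i : Fin m) :
    (M.sampleLaw m).real {ω | t < M.pValues ω i ∧ (ω i).2 = true} =
      M.pi1 * (1 - M.altCdf t) := by
  have := isProbabilityMeasure_sampleLaw h m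
  have := isProbabilityMeasure_altLaw h
  rw [sampleLaw_real_eq h i (measurableSet_falseNeg h (measurable_const (a := t)) i)]
  simp only [mem_ofPred_eq, pValues_update, Function.update_self, and_true, reduceCtorEq,
    and_false, ofPred_false, measureReal_empty, mul_zero, zero_add, integral_const, probReal_univ,
    one_smul]
  have h1 := measureReal_compl (μ := M.altLaw) (measurable_pValue h (measurableSet_Iic (a := t)))
  rw [probReal_univ] at h1
  change _ = M.pi1 * (1 - M.altLaw.real (pValue M.kind M.shape ⁻¹' Iic t))
  rw [← h1]
  congr 2
  ext x
  simp

lemma sampleLaw_label_true (h : M.Regular) (i : Fin m) :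
    (M.sampleLaw m).real {ω | (ω i).2 = true} = M.pi1 := by
  have := isProbabilityMeasure_sampleLaw h m
  have := isProbabilityMeasure_altLaw h
  rw [sampleLaw_real_eq h i (measurableSet_snd i true)]
  simp

/-- The two risks of a deterministic threshold agree. -/
lemma detRisk_eq_pointRisk (h : M.Regular) (k : RiskKind) (hm : 1 ≤ m) {t : ℝ}
    (ht : t ∈ Icc (0 : ℝ) 1) : M.detRisk k m t = M.pointRisk t := by
  have := isProbabilityMeasure_sampleLaw h m
  have hm' : (m : ℝ) ≠ 0 := by
    have : m ≠ 0 := by omega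
    exact_mod_cast this
  cases k
  · simp only [detRisk, risk]
    have h1 : ∀ i : Fin m, (M.sampleLaw m).real {ω | M.pValues ω i ≤ t ∧ (ω i).2 = false} =
        M.pi0 * t := fun i => by
      have := sampleLaw_falsePos_eq h (T := fun _ => t) measurable_const (fun _ => ht) i
        (fun _ _ => rfl)
      simpa using this
    simp only [h1, sampleLaw_falseNeg_const h, Finset.sum_const, Finset.card_univ,
      Fintype.card_fin, nsmul_eq_mul]
    rw [pointRisk]
    field_simp
  · simp [detRisk, risk, pointRisk]

/-- No threshold of the `p`-values beats the Bayes threshold. -/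
lemma pointRisk_bayes_le_risk (h : M.Regular) (k : RiskKind) (hm : 1 ≤ m)
    {T : (Fin m → ℝ) → ℝ} (hT : Measurable T) (hT1 : ∀ p, T p ∈ Icc (0 : ℝ) 1) :
    M.pointRisk M.bayesThreshold ≤ M.risk k m T := by
  have := isProbabilityMeasure_sampleLaw h m
  have hm' : (0 : ℝ) < m := by exact_mod_cast hm
  cases k
  · simp only [risk]
    rw [← mul_add, ← Finset.sum_add_distrib, le_inv_mul_iff₀ hm']
    have key : ∀ i : Fin m, M.pointRisk M.bayesThreshold ≤
        (M.sampleLaw m).real {ω | M.pValues ω i ≤ T (M.pValues ω) ∧ (ω i).2 = false} +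
        (M.sampleLaw m).real {ω | T (M.pValues ω) < M.pValues ω i ∧ (ω i).2 = true} := by
      intro i
      have hA := measurableSet_falsePos h hT i
      have hB := measurableSet_falseNeg h hT i
      rw [sampleLaw_real_eq h i hA, sampleLaw_real_eq h i hB,
        ← integral_add (integrable_sampleLaw_update h i hA) (integrable_sampleLaw_update h i hB)]
      have hc : M.pointRisk M.bayesThreshold =
          ∫ _, M.pointRisk M.bayesThreshold ∂M.sampleLaw m := by simp
      rw [hc]
      refine integral_mono (integrable_const _) ((integrable_sampleLaw_update h i hA).add
        (integrable_sampleLaw_update h i hB)) fun ω => ?_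
      simp only [mem_ofPred_eq, pValues_update, Function.update_self, and_true, reduceCtorEq,
        and_false, ofPred_false, measureReal_empty, mul_zero, zero_add, add_zero]
      have hu : Measurable fun x => Function.update (M.pValues ω) i (pValue M.kind M.shape x) :=
        (measurable_update _).comp (measurable_pValue h)
      -- With the other coordinates frozen, the rule for observation `i` is an arbitrary measurable
      -- rejection region, so the Neyman-Pearson bound applies to it.
      have hS : MeasurableSet {x | pValue M.kind M.shape x ≤
          T (Function.update (M.pValues ω) i (pValue M.kind M.shape x))} :=
        measurableSet_le (measurable_pValue h) (hT.comp hu)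
      refine (pointRisk_bayes_le h hS).trans (le_of_eq ?_)
      congr 3
      ext x
      simp
    calc (m : ℝ) * M.pointRisk M.bayesThreshold =
        ∑ _i : Fin m, M.pointRisk M.bayesThreshold := by simp
      _ ≤ _ := Finset.sum_le_sum fun i _ => key i
  · simp only [risk]
    have hc : M.pointRisk M.bayesThreshold =
        ∫ _, M.pointRisk M.bayesThreshold ∂M.sampleLaw m := by simp
    rw [hc]
    refine integral_mono (integrable_const _) (((integrable_comp_pValues h hT hT1).const_mul _).add
      (((integrable_const 1).sub (integrable_altCdf_comp h hT)).const_mul _)) fun ω => ?_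
    exact pointRisk_bayes_le_pointRisk h (hT1 _)

section BenjaminiHochberg

variable {α : ℝ}

lemma measurable_bh_zeroOn (hα : 0 < α) (hα1 : α ≤ 1) (S : Finset (Fin m)) :
    Measurable fun p => bhThreshold α (zeroOn S p) :=
  (measurable_bhThreshold hα hα1).comp (measurable_zeroOn S)

lemma bh_mem_Icc (hα : 0 < α) (hα1 : α ≤ 1) (p : Fin m → ℝ) :
    bhThreshold α p ∈ Icc (0 : ℝ) 1 :=
  ⟨bhThreshold_nonneg α p, (bhThreshold_le hα p).trans hα1⟩

/-- Setting the `i`-th `p`-value to zero only raises the threshold and makes it independent of that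
`p`-value. Under a null label the rejection probability is then a mean threshold; a true label costs
at most `π₁`. -/
lemma sampleLaw_le_bh_zeroOn (h : M.Regular) (hα : 0 < α) (hα1 : α ≤ 1) (S : Finset (Fin m))
    (i : Fin m) :
    (M.sampleLaw m).real {ω | M.pValues ω i ≤ bhThreshold α (zeroOn S (M.pValues ω))} ≤
      ∫ ω, bhThreshold α (zeroOn (insert i S) (M.pValues ω)) ∂M.sampleLaw m + M.pi1 := by
  have := isProbabilityMeasure_sampleLaw h m
  have h1 : {ω | M.pValues ω i ≤ bhThreshold α (zeroOn S (M.pValues ω))} ⊆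
      {ω | M.pValues ω i ≤ bhThreshold α (zeroOn (insert i S) (M.pValues ω)) ∧
        (ω i).2 = false} ∪ {ω | (ω i).2 = true} := by
    intro ω hω
    rcases hb : (ω i).2 with _ | _
    · refine Or.inl ⟨le_trans hω ?_, hb⟩
      exact bhThreshold_anti α (zeroOn_anti (Finset.subset_insert _ _) (pValues_nonneg h ω))
    · exact Or.inr hb
  refine (measureReal_mono h1).trans ((measureReal_union_le _ _).trans ?_)
  rw [sampleLaw_label_true h]
  refine add_le_add ?_ le_rfl
  rw [sampleLaw_falsePos_eq h (T := fun p => bhThreshold α (zeroOn (insert i S) p))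
    (measurable_bh_zeroOn hα hα1 _) (fun p => bh_mem_Icc hα hα1 _) i
    (fun p v => by rw [zeroOn_update (Finset.mem_insert_self i S)])]
  have h0 := h.pi0_add_pi1
  have h2 := h.pi1_pos
  exact mul_le_of_le_one_left (integral_nonneg fun ω => bhThreshold_nonneg α _) (by linarith)

/-- Expected number of rejections when the `p`-values in `S` are set to zero. -/
lemma integral_bh_zeroOn_le (h : M.Regular) (hα : 0 < α) (hα1 : α ≤ 1 / 2)
    (S : Finset (Fin m)) :
    m * ∫ ω, bhThreshold α (zeroOn S (M.pValues ω)) ∂M.sampleLaw m ≤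
      α * (2 * (S.card + m * M.pi1) + 2) := by
  have hP := isProbabilityMeasure_sampleLaw h m
  have hα1' : α ≤ 1 := by linarith
  have hp1 := h.pi1_pos
  -- Downward induction on the zeroed set: the bound for `S` uses the bounds for `insert i S` with
  -- `i ∉ S`, and the case `S = univ` needs none.
  induction hn : m - S.card using Nat.strong_induction_on generalizing S with
  | _ n ih =>
    rcases Nat.eq_zero_or_pos m with rfl | hm
    · simp only [Nat.cast_zero, zero_mul]
      positivity
    have hm' : (0 : ℝ) < m := by exact_mod_cast hm
    set T : (Fin m → ℝ × Bool) → ℝ := fun ω => bhThreshold α (zeroOn S (M.pValues ω)) with hT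
    have hTm : Measurable T := (measurable_bh_zeroOn hα hα1' S).comp (measurable_pValues h)
    have hTi : Integrable T (M.sampleLaw m) := integrable_comp_pValues h
      (measurable_bh_zeroOn hα hα1' S) fun p => bh_mem_Icc hα hα1' _
    have hset : ∀ i, MeasurableSet {ω | zeroOn S (M.pValues ω) i ≤ T ω} := fun i =>
      measurableSet_le ((measurable_pi_apply i).comp
        ((measurable_zeroOn S).comp (measurable_pValues h))) hTm
    have hpt : ∀ ω, m * T ω ≤ α * ∑ i : Fin m,
        {ω | zeroOn S (M.pValues ω) i ≤ T ω}.indicator (1 : (Fin m → ℝ × Bool) → ℝ) ω := by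
      intro ω
      have h1 := bhThreshold_le_empCdf hα (zeroOn S (M.pValues ω))
      rw [empCdf_eq_sum] at h1
      have h2 := mul_le_mul_of_nonneg_left h1 hm'.le
      refine h2.trans (le_of_eq ?_)
      rw [show ∀ s : ℝ, (m : ℝ) * (α * ((m : ℝ)⁻¹ * s)) = α * s from fun s => by field_simp]
      congr 1
    have hint : m * ∫ ω, T ω ∂M.sampleLaw m ≤
        α * ∑ i : Fin m, (M.sampleLaw m).real {ω | zeroOn S (M.pValues ω) i ≤ T ω} := by
      rw [← integral_const_mul]
      refine (integral_mono (hTi.const_mul _) ((integrable_finsetSum _ fun i _ =>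
        (integrable_const (1 : ℝ)).indicator (hset i)).const_mul _) hpt).trans (le_of_eq ?_)
      rw [integral_const_mul, integral_finsetSum _ fun i _ =>
        (integrable_const (1 : ℝ)).indicator (hset i)]
      congr 1
      refine Finset.sum_congr rfl fun i _ => ?_
      exact integral_indicator_one (hset i)
    -- A coordinate in `S` is always rejected. Any other is rejected with probability at most the
    -- mean threshold after zeroing it as well, plus `π₁`.
    have hterm : ∀ i : Fin m, (M.sampleLaw m).real {ω | zeroOn S (M.pValues ω) i ≤ T ω} ≤
        (if i ∈ S then 1 else 0) + M.pi1 + α * (2 * (S.card + 1 + m * M.pi1) + 2) / m := by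
      intro i
      have hnn : 0 ≤ α * (2 * (S.card + 1 + m * M.pi1) + 2) / m := by positivity
      by_cases hi : i ∈ S
      · rw [if_pos hi]
        have : (M.sampleLaw m).real {ω | zeroOn S (M.pValues ω) i ≤ T ω} ≤ 1 := measureReal_le_one
        linarith
      · rw [if_neg hi]
        have h1 := sampleLaw_le_bh_zeroOn h hα hα1' S i
        have hlt : S.card < m := by
          have := Finset.card_lt_univ_of_notMem hi
          simpa using this
        have h2 := ih (m - (insert i S).card) (by
          rw [Finset.card_insert_of_notMem hi]
          omega) (insert i S) rfl
        rw [Finset.card_insert_of_notMem hi] at h2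
        push_cast at h2
        rw [← le_div_iff₀' hm'] at h2
        have h3 : {ω | zeroOn S (M.pValues ω) i ≤ T ω} =
            {ω | M.pValues ω i ≤ bhThreshold α (zeroOn S (M.pValues ω))} := by
          ext ω
          simp [hT, zeroOn, hi]
        rw [h3]
        linarith
    have hsum := Finset.sum_le_sum fun i (_ : i ∈ Finset.univ) => hterm i
    have hcard : ∑ i : Fin m, ((if i ∈ S then (1 : ℝ) else 0) + M.pi1 +
        α * (2 * (S.card + 1 + m * M.pi1) + 2) / m) =
        S.card + m * M.pi1 + α * (2 * (S.card + 1 + m * M.pi1) + 2) := by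
      rw [Finset.sum_add_distrib, Finset.sum_add_distrib]
      simp only [Finset.sum_ite_mem, Finset.univ_inter, Finset.sum_const, nsmul_eq_mul, mul_one,
        Finset.card_univ, Fintype.card_fin]
      field_simp
    rw [hcard] at hsum
    refine hint.trans (mul_le_mul_of_nonneg_left (hsum.trans ?_) hα.le)
    -- With `α ≤ 1 / 2` the recursive term contributes at most `card + 1 + m π₁ + 1`, which closes
    -- the induction; this is how the constants `2` and `2` are fixed.
    have hq : (0 : ℝ) ≤ 2 * (S.card + 1 + m * M.pi1) + 2 := by positivity
    have := mul_le_mul_of_nonneg_right hα1 hq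
    linarith

lemma measurable_fdrThreshold (hα : 0 < α) (hα1 : α ≤ 1) :
    Measurable (fdrThreshold α : (Fin m → ℝ) → ℝ) :=
  (measurable_bhThreshold hα hα1).max measurable_const

lemma bonferroni_mem (hα : 0 < α) (hm : 1 ≤ m) : α / m ∈ Icc 0 α :=
  ⟨by positivity, div_le_self hα.le (by exact_mod_cast hm)⟩

lemma fdrThreshold_mem_Icc (hα : 0 < α) (hα1 : α ≤ 1) (hm : 1 ≤ m) (p : Fin m → ℝ) :
    fdrThreshold α p ∈ Icc (0 : ℝ) 1 :=
  ⟨(bonferroni_mem hα hm).1.trans (le_max_right _ _),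
    max_le (bh_mem_Icc hα hα1 p).2 ((bonferroni_mem hα hm).2.trans hα1)⟩

/-- The singleton case serves the transductive risk and the empty case the inductive one. The `5` is
`2 + 2` from the expected threshold and `1` from the Bonferroni floor. -/
lemma integral_bh_max_le (h : M.Regular) (hα : 0 < α) (hα1 : α ≤ 1 / 2) (hm : 1 ≤ m)
    {S : Finset (Fin m)} (hS : S.card ≤ 1) :
    ∫ ω, max (bhThreshold α (zeroOn S (M.pValues ω))) (α / m) ∂M.sampleLaw m ≤
      α * (5 + 2 * (m * M.pi1)) / m := by
  have hP := isProbabilityMeasure_sampleLaw h m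
  have hα1' : α ≤ 1 := by linarith
  have hm' : (0 : ℝ) < m := by exact_mod_cast hm
  have h1 := integral_bh_zeroOn_le h hα hα1 S
  have hTi : Integrable (fun ω => bhThreshold α (zeroOn S (M.pValues ω))) (M.sampleLaw m) :=
    integrable_comp_pValues h (measurable_bh_zeroOn hα hα1' S) fun p => bh_mem_Icc hα hα1' _
  have h2 : ∫ ω, max (bhThreshold α (zeroOn S (M.pValues ω))) (α / m) ∂M.sampleLaw m ≤
      ∫ ω, (bhThreshold α (zeroOn S (M.pValues ω)) + α / m) ∂M.sampleLaw m := by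
    refine integral_mono (hTi.sup (integrable_const _)) (hTi.add (integrable_const _)) fun ω => ?_
    have hb := (bonferroni_mem hα hm).1
    exact max_le (le_add_of_nonneg_right hb) (le_add_of_nonneg_left (bhThreshold_nonneg α _))
  rw [integral_add hTi (integrable_const _)] at h2
  simp only [integral_const, probReal_univ, one_smul] at h2
  refine h2.trans ?_
  rw [← le_div_iff₀' hm'] at h1
  have hS' : (S.card : ℝ) ≤ 1 := by exact_mod_cast hS
  have h3 : α * (2 * (S.card + m * M.pi1) + 2) / m ≤ α * (4 + 2 * (m * M.pi1)) / m := by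
    refine div_le_div_of_nonneg_right (mul_le_mul_of_nonneg_left ?_ hα.le) hm'.le
    linarith
  calc _ ≤ α * (4 + 2 * (m * M.pi1)) / m + α / m := by linarith
    _ = _ := by ring

/-- Upper bound on both risks of FDR thresholding. -/
lemma risk_fdrThreshold_le (h : M.Regular) (k : RiskKind) (hα : 0 < α) (hα1 : α ≤ 1 / 2)
    (hm : 1 ≤ m) (t : ℝ) :
    M.risk k m (fdrThreshold α) ≤ M.pi0 * (α * (5 + 2 * (m * M.pi1)) / m) +
      M.pi1 * (1 - M.altCdf t) +
        (M.sampleLaw m).real {ω | fdrThreshold α (M.pValues ω) < t} := by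
  have hP := isProbabilityMeasure_sampleLaw h m
  have hα1' : α ≤ 1 := by linarith
  have hm' : (0 : ℝ) < m := by exact_mod_cast hm
  have hp0 := h.pi0_pos
  have hp1 := h.pi1_pos
  have hT := measurable_fdrThreshold (m := m) hα hα1'
  have hT1 := fdrThreshold_mem_Icc (m := m) hα hα1' hm
  set Q := (M.sampleLaw m).real {ω | fdrThreshold α (M.pValues ω) < t} with hQ
  cases k
  · simp only [risk]
    have h1 : ∀ i : Fin m, (M.sampleLaw m).real
        {ω | M.pValues ω i ≤ fdrThreshold α (M.pValues ω) ∧ (ω i).2 = false} ≤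
        M.pi0 * (α * (5 + 2 * (m * M.pi1)) / m) := fun i => by
      -- Leave-one-out: the larger threshold ignores the `i`-th `p`-value, so the false positive
      -- probability factors.
      have hsub : {ω : Fin m → ℝ × Bool | M.pValues ω i ≤ fdrThreshold α (M.pValues ω) ∧
          (ω i).2 = false} ⊆ {ω | M.pValues ω i ≤
            max (bhThreshold α (zeroOn {i} (M.pValues ω))) (α / m) ∧ (ω i).2 = false} := by
        intro ω hω
        refine ⟨hω.1.trans (max_le_max ?_ le_rfl), hω.2⟩
        refine bhThreshold_anti α ?_
        have := zeroOn_anti (Finset.empty_subset {i}) (pValues_nonneg h ω)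
        rwa [zeroOn_empty] at this
      refine (measureReal_mono hsub).trans ?_
      rw [sampleLaw_falsePos_eq h
        (T := fun p => max (bhThreshold α (zeroOn {i} p)) (α / m))
        ((measurable_bh_zeroOn hα hα1' _).max measurable_const)
        (fun p => fdrThreshold_mem_Icc hα hα1' hm _) i
        (fun p v => by rw [zeroOn_update (Finset.mem_singleton_self i)])]
      exact mul_le_mul_of_nonneg_left (integral_bh_max_le h hα hα1 hm (by simp)) hp0.le
    have h2 : ∀ i : Fin m, (M.sampleLaw m).real
        {ω | fdrThreshold α (M.pValues ω) < M.pValues ω i ∧ (ω i).2 = true} ≤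
        M.pi1 * (1 - M.altCdf t) + Q := fun i => by
      have hsub : {ω : Fin m → ℝ × Bool | fdrThreshold α (M.pValues ω) < M.pValues ω i ∧
          (ω i).2 = true} ⊆ {ω | t < M.pValues ω i ∧ (ω i).2 = true} ∪
            {ω | fdrThreshold α (M.pValues ω) < t} := by
        intro ω hω
        by_cases hlt : fdrThreshold α (M.pValues ω) < t
        · exact Or.inr hlt
        · exact Or.inl ⟨(not_lt.1 hlt).trans_lt hω.1, hω.2⟩
      refine (measureReal_mono hsub).trans ((measureReal_union_le _ _).trans ?_)
      rw [sampleLaw_falseNeg_const h]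
    have h3 := Finset.sum_le_sum fun i (_ : i ∈ Finset.univ) => h1 i
    have h4 := Finset.sum_le_sum fun i (_ : i ∈ Finset.univ) => h2 i
    simp only [Finset.sum_const, Finset.card_univ, Fintype.card_fin, nsmul_eq_mul] at h3 h4
    rw [← inv_mul_le_iff₀ hm'] at h3 h4
    linarith
  · simp only [risk]
    have hTi := integrable_comp_pValues h hT hT1
    have hset : MeasurableSet {ω | fdrThreshold α (M.pValues ω) < t} :=
      measurableSet_lt (hT.comp (measurable_pValues h)) measurable_const
    have hi := (integrable_const (μ := M.sampleLaw m) (1 : ℝ)).indicator hset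
    have h1 : ∫ ω, fdrThreshold α (M.pValues ω) ∂M.sampleLaw m ≤
        α * (5 + 2 * (m * M.pi1)) / m := by
      have := integral_bh_max_le h hα hα1 hm (S := ∅) (by simp)
      simp only [zeroOn_empty] at this
      exact this
    have h2 : ∀ ω : Fin m → ℝ × Bool, M.pi0 * fdrThreshold α (M.pValues ω) +
        M.pi1 * (1 - M.altCdf (fdrThreshold α (M.pValues ω))) ≤
        M.pi0 * fdrThreshold α (M.pValues ω) + M.pi1 * (1 - M.altCdf t) +
          {ω | fdrThreshold α (M.pValues ω) < t}.indicator (fun _ => (1 : ℝ)) ω := fun ω => by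
      -- On the bad event the type II part is at most `π₁ ≤ 1`, which is charged to the indicator;
      -- elsewhere the power is at least `F t`.
      by_cases hlt : fdrThreshold α (M.pValues ω) < t
      · rw [indicator_of_mem (show ω ∈ {ω | fdrThreshold α (M.pValues ω) < t} from hlt)]
        have e1 := altCdf_nonneg (M := M) (fdrThreshold α (M.pValues ω))
        have e2 := mul_nonneg hp1.le (sub_nonneg.2 (altCdf_le_one h t))
        have e3 := h.pi1_le_one
        have e4 := mul_nonneg hp1.le e1
        linarith
      · rw [indicator_of_notMem (show ω ∉ {ω | fdrThreshold α (M.pValues ω) < t} from hlt)]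
        have e1 : M.pi1 * M.altCdf t ≤ M.pi1 * M.altCdf (fdrThreshold α (M.pValues ω)) :=
          mul_le_mul_of_nonneg_left (altCdf_mono h (not_lt.1 hlt)) hp1.le
        linarith
    refine (integral_mono ((hTi.const_mul _).add
      (((integrable_const 1).sub (integrable_altCdf_comp h hT)).const_mul _))
      (((hTi.const_mul _).add (integrable_const _)).add hi) h2).trans ?_
    have e1 : ∫ ω, {ω | fdrThreshold α (M.pValues ω) < t}.indicator (fun _ => (1 : ℝ)) ω
        ∂M.sampleLaw m = Q := integral_indicator_one hset
    rw [integral_add' ((hTi.const_mul _).add (integrable_const _)) hi,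
      integral_add' (hTi.const_mul _) (integrable_const _), integral_const_mul, e1]
    simp only [integral_const, probReal_univ, one_smul]
    have := mul_le_mul_of_nonneg_left h1 hp0.le
    linarith

/-- Probability that Benjamini-Hochberg thresholding stops below a given point. -/
lemma sampleLaw_bh_lt_le (h : M.Regular) (hm : 1 ≤ m) {t : ℝ}
    (ht : t ∈ Icc (0 : ℝ) 1) (hq : 2 * t / α ≤ M.pi1 * M.altCdf t) :
    (M.sampleLaw m).real {ω | bhThreshold α (M.pValues ω) < t} ≤
      Real.exp (-(m * (M.pi1 * M.altCdf t) / 10)) := by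
  classical
  have hP := isProbabilityMeasure_sampleLaw h m
  have hP2 := isProbabilityMeasure_pairLaw h
  have hm' : (0 : ℝ) < m := by exact_mod_cast hm
  set A : Set (ℝ × Bool) := {z | pValue M.kind M.shape z.1 ≤ t} with hA
  have hAm : MeasurableSet A := ((measurable_pValue h).comp measurable_fst) measurableSet_Iic
  have hAq : M.pi1 * M.altCdf t ≤ M.pairLaw.real A := by
    rw [pairLaw_real h hAm]
    refine le_add_of_nonneg_left (mul_nonneg h.pi0_pos.le measureReal_nonneg)
  have hsub : {ω : Fin m → ℝ × Bool | bhThreshold α (M.pValues ω) < t} ⊆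
      {ω | ((Finset.univ.filter fun i => ω i ∈ A).card : ℝ) ≤ m * (t / α)} := by
    intro ω hω
    -- More than `m t / α` `p`-values below `t` would make `t` admissible for the supremum. By `hq`
    -- their expected number is at least twice that.
    by_contra hcon
    refine absurd (show bhThreshold α (M.pValues ω) < t from hω) (not_lt.2 (le_bhThreshold ht ?_))
    have h1 : m * (t / α) < ((Finset.univ.filter fun i => ω i ∈ A).card : ℝ) := not_le.1 hcon
    rw [empCdf, le_inv_mul_iff₀ hm']
    refine h1.le.trans (le_of_eq ?_)
    congr!
  refine (measureReal_mono hsub).trans ?_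
  have := pi_real_card_le_half (ι := Fin m) M.pairLaw hAm (b := m * (t / α)) (by
    rw [Fintype.card_fin]
    have h2 : 2 * (t / α) ≤ M.pairLaw.real A := by
      refine le_trans (le_of_eq ?_) (hq.trans hAq)
      ring
    have := mul_le_mul_of_nonneg_left h2 hm'.le
    linarith)
  rw [Fintype.card_fin] at this
  refine this.trans (Real.exp_le_exp.2 ?_)
  have := mul_le_mul_of_nonneg_left hAq hm'.le
  linarith

end BenjaminiHochberg

end Model

/-! ### Local analysis around the Bayes cutoff. -/

lemma mul_exp_le_density {ζ x s : ℝ} (hζ : 1 ≤ ζ) (hx : 0 < x) (hs : 0 ≤ s) :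
    density ζ x * Real.exp (-(s * (x + s) ^ (ζ - 1))) ≤ density ζ (x + s) := by
  unfold density
  have hN := normConst_pos hζ
  have hw : 0 < x + s := by linarith
  rw [mul_assoc, ← Real.exp_add, abs_of_pos hx, abs_of_pos hw]
  gcongr
  have hpos : 0 < ζ := by linarith
  have hsw : s / (x + s) ≤ 1 := (div_le_one hw).2 (by linarith)
  -- Now the tangent is taken at the far point `x + s`, which turns convexity into a lower bound on
  -- the density there.
  have hb := one_add_mul_self_le_rpow_one_add (s := -(s / (x + s))) (p := ζ) (by linarith) hζ
  have h2 : x ^ ζ = (x + s) ^ ζ * (1 + -(s / (x + s))) ^ ζ := by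
    rw [← Real.mul_rpow hw.le (by linarith)]
    congr 1
    field_simp
    ring
  have key : (x + s) ^ ζ - ζ * (s * (x + s) ^ (ζ - 1)) ≤ x ^ ζ := by
    rw [Real.rpow_sub_one hw.ne', h2]
    have := mul_le_mul_of_nonneg_left hb (Real.rpow_nonneg hw.le ζ)
    calc _ = (x + s) ^ ζ * (1 + ζ * -(s / (x + s))) := by
          field_simp
          ring
      _ ≤ _ := this
  have : (x + s) ^ ζ / ζ - s * (x + s) ^ (ζ - 1) ≤ x ^ ζ / ζ := by
    rw [le_div_iff₀ hpos]
    calc _ = (x + s) ^ ζ - ζ * (s * (x + s) ^ (ζ - 1)) := by field_simp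
      _ ≤ _ := key
  linarith

lemma exists_tailP_bracket {k : ModelKind} {ζ Cm Cp : ℝ} (hζ : 1 ≤ ζ) (hCm : 0 < Cm)
    (hCp : Cp < 1) (hC : Cm ≤ Cp) :
    ∃ ylo ∈ k.domain, ∃ yhi, ∀ y, Cm ≤ tailP k ζ y → tailP k ζ y ≤ Cp → ylo ≤ y ∧ y ≤ yhi := by
  obtain ⟨ylo, hlo, hloe⟩ := exists_tailP_eq (k := k) hζ ⟨hCm.trans_le hC, hCp⟩
  obtain ⟨yhi, -, hhie⟩ := exists_tailP_eq (k := k) hζ ⟨hCm, hC.trans_lt hCp⟩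
  have ha := tailP_strictAnti (k := k) hζ
  exact ⟨ylo, hlo, yhi, fun y h1 h2 =>
    ⟨ha.le_iff_ge.1 (hloe ▸ h2), ha.le_iff_ge.1 (hhie ▸ h1)⟩⟩

namespace Model

variable {M : Model}

/-- The Bayes rule rejects for observations at least `x`, whose standardized value is `y`;
the remaining parameters are uniform bounds, and `L` is the order of the log-slope at `x`. -/
structure BayesPoint (M : Model) (c K Y e L x y : ℝ) : Prop where
  y_abs : |y| ≤ Y
  x_eq : x = M.shift + M.dilation * y
  x_pos : 0 < x
  threshold : M.bayesThreshold = tailP M.kind M.shape x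
  power : M.bayesPower = tailP M.kind M.shape y
  ratio : density M.shape y = M.sparsity * (M.dilation * density M.shape x)
  slope_ge : c * L ≤ M.dilation * x ^ (M.shape - 1)
  slope_le : M.dilation * x ^ (M.shape - 1) ≤ K * L
  dilation_le : M.dilation * e ≤ x

lemma mem_domain_of_pos {k : ModelKind} {x : ℝ} (hx : 0 < x) : x ∈ k.domain := by
  cases k
  · trivial
  · exact hx

lemma exists_bayes_observation (h : M.Regular) :
    ∃ y, 0 < M.shift + M.dilation * y ∧
      M.bayesThreshold = tailP M.kind M.shape (M.shift + M.dilation * y) ∧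
      M.bayesPower = tailP M.kind M.shape y ∧
      density M.shape y = M.sparsity * (M.dilation *
        density M.shape (M.shift + M.dilation * y)) := by
  have hb := h.dilation_pos
  obtain ⟨x, hx, hxt, hxl⟩ := exists_bayesThreshold_eq h
  have he : M.shift + M.dilation * ((x - M.shift) / M.dilation) = x := by
    field_simp
    ring
  refine ⟨(x - M.shift) / M.dilation, ?_, by rw [he, hxt], ?_, ?_⟩
  · rw [he]
    by_contra hneg
    have h1 := likRatio_half_shift_le h
    have h2 : M.likRatio x ≤ M.likRatio (M.shift / 2) := by
      have hs := h.signal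
      refine likRatio_mono h ?_
      obtain ⟨k, ζ, τ, θ⟩ := M
      cases k
      · simp only [AdmissibleSignal] at hs
        simp only [ModelKind.statistic, shift, ModelKind.shift]
        linarith
      · exact absurd hx hneg
    linarith [h.sparsity]
  · rw [bayesPower, hxt, ← he]
    conv_rhs => rw [he]
    exact altCdf_tailP h ((mem_domain_iff h).1 (by rwa [he]))
  · rw [he, ← hxl, likRatio]
    have := density_pos h.one_le x
    field_simp

/-- Logarithms of the likelihood ratio equation. This identity ties the cutoff to `log τ` and so
produces the powers of `log m`. -/
lemma rpow_bayes_observation (h : M.Regular) {x y : ℝ} (hx : 0 < x)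
    (he : density M.shape y = M.sparsity * (M.dilation * density M.shape x)) :
    x ^ M.shape / M.shape =
      Real.log M.sparsity + Real.log M.dilation + |y| ^ M.shape / M.shape := by
  have hN := inv_pos.2 (normConst_pos h.one_le)
  have h1 := congrArg Real.log he
  have hb := h.dilation_pos
  have ht := h.sparsity_pos
  unfold density at h1
  rw [Real.log_mul ht.ne' (by positivity), Real.log_mul hb.ne' (by positivity),
    Real.log_mul hN.ne' (Real.exp_pos _).ne', Real.log_mul hN.ne' (Real.exp_pos _).ne',
    Real.log_exp, Real.log_exp, abs_of_pos hx] at h1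
  linarith

section BayesPoint

variable {c K Y e L x y : ℝ}

lemma BayesPoint.mem_domain (h : M.Regular) (bp : BayesPoint M c K Y e L x y) {s : ℝ}
    (hs : 0 < x + M.dilation * s) : y + s ∈ M.kind.domain := by
  refine (mem_domain_iff h).1 (mem_domain_of_pos ?_)
  have := bp.x_eq
  rw [mul_add]
  linarith

lemma BayesPoint.altCdf_eq (h : M.Regular) (bp : BayesPoint M c K Y e L x y) {s : ℝ}
    (hs : 0 < x + M.dilation * s) :
    M.altCdf (tailP M.kind M.shape (x + M.dilation * s)) = tailP M.kind M.shape (y + s) := by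
  rw [← altCdf_tailP h (bp.mem_domain h hs), bp.x_eq]
  congr 2
  ring

lemma BayesPoint.le_density (h : M.Regular) (bp : BayesPoint M c K Y e L x y) :
    density M.shape Y ≤ density M.shape y :=
  density_anti_abs h.one_le (bp.y_abs.trans (le_abs_self Y))

/-- The Mills bound at the shifted cutoff, followed by exponential decay from `x`. The equation
`ratio` turns `τ * dilation * density x` into `density y`, which is bounded, and the Mills factor
supplies `1 / (c L)`. -/
lemma BayesPoint.sparsity_mul_tailP_le (h : M.Regular) (bp : BayesPoint M c K Y e L x y)
    (hc : 0 < c) (hL : 0 < L) {s : ℝ} (hs : 0 ≤ s) :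
    M.sparsity * tailP M.kind M.shape (x + M.dilation * s) ≤
      M.kind.tails * density M.shape 0 / (c * L) * Real.exp (-(s * (c * L))) := by
  have hζ := h.one_le
  have hb := h.dilation_pos
  have hτ := h.sparsity_pos
  have hk := M.kind.tails_pos
  have hx := bp.x_pos
  have hp : 0 < x ^ (M.shape - 1) := Real.rpow_pos_of_pos hx _
  have hbs : 0 ≤ M.dilation * s := by positivity
  have hcL : 0 < c * L := by positivity
  have h1 := upperTail_mul_rpow_le (x := x + M.dilation * s) hζ (by linarith)
  have h2 := density_div_rpow (x := x) (s := M.dilation * s) hζ hx.le hbs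
  have h3 : x ^ (M.shape - 1) ≤ (x + M.dilation * s) ^ (M.shape - 1) :=
    Real.rpow_le_rpow hx.le (by linarith) (by linarith)
  set Λ := M.dilation * x ^ (M.shape - 1) with hΛ
  have h4 : upperTail M.shape (x + M.dilation * s) * x ^ (M.shape - 1) ≤
      density M.shape x * Real.exp (-(s * Λ)) := by
    refine (mul_le_mul_of_nonneg_left h3 (upperTail_nonneg hζ _)).trans (h1.trans (h2.trans
      (le_of_eq ?_)))
    rw [hΛ]
    ring_nf
  have hΛ0 : 0 < Λ := by positivity
  have h5 : M.sparsity * upperTail M.shape (x + M.dilation * s) * Λ ≤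
      density M.shape 0 * Real.exp (-(s * Λ)) := by
    calc _ = (M.sparsity * M.dilation) *
          (upperTail M.shape (x + M.dilation * s) * x ^ (M.shape - 1)) := by rw [hΛ]; ring
      _ ≤ (M.sparsity * M.dilation) * (density M.shape x * Real.exp (-(s * Λ))) :=
          mul_le_mul_of_nonneg_left h4 (by positivity)
      _ = density M.shape y * Real.exp (-(s * Λ)) := by rw [bp.ratio]; ring
      _ ≤ _ := mul_le_mul_of_nonneg_right (density_le_zero hζ y) (Real.exp_pos _).le
  have h6 : M.sparsity * upperTail M.shape (x + M.dilation * s) ≤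
      density M.shape 0 * Real.exp (-(s * (c * L))) / (c * L) := by
    rw [le_div_iff₀ hcL]
    have hu := mul_nonneg hτ.le (upperTail_nonneg hζ (x + M.dilation * s))
    refine (mul_le_mul_of_nonneg_left bp.slope_ge hu).trans (h5.trans ?_)
    refine mul_le_mul_of_nonneg_left (Real.exp_le_exp.2 ?_) (density_pos hζ 0).le
    exact neg_le_neg (mul_le_mul_of_nonneg_left bp.slope_ge hs)
  calc _ = M.kind.tails * (M.sparsity * upperTail M.shape (x + M.dilation * s)) := by
        rw [tailP]; ring
    _ ≤ M.kind.tails * (density M.shape 0 * Real.exp (-(s * (c * L))) / (c * L)) :=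
        mul_le_mul_of_nonneg_left h6 hk.le
    _ = _ := by ring

/-- The slab from `x + dilation * s` to `x + 2 * dilation * s` already carries enough mass. By
`dilation_le` its far end is at most `(1 + 2 / e) * x`, whence the constant in the exponent. -/
lemma BayesPoint.le_sparsity_mul_tailP_right (h : M.Regular) (bp : BayesPoint M c K Y e L x y)
    (he : 0 < e) {s : ℝ} (hs : 0 < s) (hs1 : s ≤ 1) :
    density M.shape Y * s * Real.exp (-(s * (2 * (1 + 2 / e) ^ (M.shape - 1) * K * L))) ≤
      M.sparsity * tailP M.kind M.shape (x + M.dilation * s) := by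
  have hζ := h.one_le
  have hb := h.dilation_pos
  have hτ := h.sparsity_pos
  have hx := bp.x_pos
  have hbs : 0 < M.dilation * s := by positivity
  have h1 := mul_density_le_upperTail (u := x + M.dilation * s) (s := M.dilation * s) hζ
    (by linarith) hbs.le
  have h2 := mul_exp_le_density (x := x) (s := M.dilation * s + M.dilation * s) hζ hx (by linarith)
  rw [← add_assoc] at h2
  have h3 : x + M.dilation * s + M.dilation * s ≤ (1 + 2 / e) * x := by
    have e1 : M.dilation * s ≤ x / e := by
      rw [le_div_iff₀ he]
      have : M.dilation * s * e ≤ M.dilation * e := by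
        have := mul_le_mul_of_nonneg_left hs1 (mul_pos hb he).le
        linarith
      exact this.trans bp.dilation_le
    have e2 : (1 + 2 / e) * x = x + x / e + x / e := by ring
    linarith
  have h4 : (x + M.dilation * s + M.dilation * s) ^ (M.shape - 1) ≤
      (1 + 2 / e) ^ (M.shape - 1) * x ^ (M.shape - 1) := by
    rw [← Real.mul_rpow (by positivity) hx.le]
    exact Real.rpow_le_rpow (by linarith) h3 (by linarith)
  have h5 : (M.dilation * s + M.dilation * s) *
      (x + M.dilation * s + M.dilation * s) ^ (M.shape - 1) ≤
      s * (2 * (1 + 2 / e) ^ (M.shape - 1) * K * L) := by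
    have hq : 0 ≤ (1 + 2 / e) ^ (M.shape - 1) := Real.rpow_nonneg (by positivity) _
    calc _ ≤ (M.dilation * s + M.dilation * s) *
          ((1 + 2 / e) ^ (M.shape - 1) * x ^ (M.shape - 1)) :=
          mul_le_mul_of_nonneg_left h4 (by linarith)
      _ = s * (2 * (1 + 2 / e) ^ (M.shape - 1)) * (M.dilation * x ^ (M.shape - 1)) := by ring
      _ ≤ s * (2 * (1 + 2 / e) ^ (M.shape - 1)) * (K * L) :=
          mul_le_mul_of_nonneg_left bp.slope_le (by positivity)
      _ = _ := by ring
  set E := Real.exp (-(s * (2 * (1 + 2 / e) ^ (M.shape - 1) * K * L))) with hE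
  have hE0 : 0 < E := Real.exp_pos _
  have h6 : density M.shape x * E ≤ density M.shape (x + M.dilation * s + M.dilation * s) := by
    refine le_trans (mul_le_mul_of_nonneg_left (Real.exp_le_exp.2 ?_) (density_pos hζ x).le) h2
    exact neg_le_neg h5
  have h7 : density M.shape x * E * (M.dilation * s) ≤
      upperTail M.shape (x + M.dilation * s) :=
    (mul_le_mul_of_nonneg_right h6 hbs.le).trans h1
  have hu := upperTail_nonneg hζ (x + M.dilation * s)
  calc _ ≤ density M.shape y * s * E := by
        have := bp.le_density h
        gcongr
    _ = M.sparsity * (density M.shape x * E * (M.dilation * s)) := by rw [bp.ratio]; ring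
    _ ≤ M.sparsity * upperTail M.shape (x + M.dilation * s) :=
        mul_le_mul_of_nonneg_left h7 hτ.le
    _ ≤ _ := by
        refine mul_le_mul_of_nonneg_left ?_ hτ.le
        exact le_mul_of_one_le_left hu M.kind.one_le_tails

/-- The left half of the interval between the shifted cutoff and `x` is used: the density there
exceeds `density x` by an exponential factor, and `s ≤ e` keeps the midpoint above `x / 2`. -/
lemma BayesPoint.le_sparsity_mul_tailP_left (h : M.Regular) (bp : BayesPoint M c K Y e L x y)
    {s : ℝ} (hs : 0 < s) (hse : s ≤ e) :
    density M.shape Y * (s / 2) * Real.exp (s / 2 * ((1 / 2) ^ (M.shape - 1) * c * L)) ≤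
      M.sparsity * tailP M.kind M.shape (x + M.dilation * -s) := by
  have hζ := h.one_le
  have hb := h.dilation_pos
  have hτ := h.sparsity_pos
  have hx := bp.x_pos
  have hbs : 0 < M.dilation * s := by positivity
  have hbx : M.dilation * s ≤ x :=
    (mul_le_mul_of_nonneg_left hse hb.le).trans bp.dilation_le
  have h1 := mul_density_le_upperTail (u := x + M.dilation * -s) (s := M.dilation * (s / 2)) hζ
    (by linarith) (by positivity)
  have e1 : x + M.dilation * -s + M.dilation * (s / 2) = x - M.dilation * (s / 2) := by ring
  rw [e1] at h1
  have h2 := density_div_rpow (x := x - M.dilation * (s / 2)) (s := M.dilation * (s / 2)) hζ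
    (by linarith) (by positivity)
  rw [sub_add_cancel] at h2
  have h3 : (1 / 2) ^ (M.shape - 1) * x ^ (M.shape - 1) ≤
      (x - M.dilation * (s / 2)) ^ (M.shape - 1) := by
    rw [← Real.mul_rpow (by norm_num) hx.le]
    exact Real.rpow_le_rpow (by linarith) (by linarith) (by linarith)
  have h4 : s / 2 * ((1 / 2) ^ (M.shape - 1) * c * L) ≤
      M.dilation * (s / 2) * (x - M.dilation * (s / 2)) ^ (M.shape - 1) := by
    have hq : (0 : ℝ) ≤ (1 / 2) ^ (M.shape - 1) := Real.rpow_nonneg (by norm_num) _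
    calc _ = s / 2 * (1 / 2) ^ (M.shape - 1) * (c * L) := by ring
      _ ≤ s / 2 * (1 / 2) ^ (M.shape - 1) * (M.dilation * x ^ (M.shape - 1)) :=
          mul_le_mul_of_nonneg_left bp.slope_ge (by positivity)
      _ = M.dilation * (s / 2) * ((1 / 2) ^ (M.shape - 1) * x ^ (M.shape - 1)) := by ring
      _ ≤ _ := mul_le_mul_of_nonneg_left h3 (by positivity)
  set E := Real.exp (s / 2 * ((1 / 2) ^ (M.shape - 1) * c * L)) with hE
  have hE0 : 0 < E := Real.exp_pos _
  have h5 : density M.shape x * E ≤ density M.shape (x - M.dilation * (s / 2)) := by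
    rw [Real.exp_neg, ← div_eq_mul_inv, le_div_iff₀ (Real.exp_pos _)] at h2
    refine le_trans (mul_le_mul_of_nonneg_left ?_ (density_pos hζ x).le) h2
    exact Real.exp_le_exp.2 h4
  have h7 : density M.shape x * E * (M.dilation * (s / 2)) ≤
      upperTail M.shape (x + M.dilation * -s) :=
    (mul_le_mul_of_nonneg_right h5 (by positivity)).trans h1
  have hu := upperTail_nonneg hζ (x + M.dilation * -s)
  calc _ ≤ density M.shape y * (s / 2) * E := by
        have := bp.le_density h
        gcongr
    _ = M.sparsity * (density M.shape x * E * (M.dilation * (s / 2))) := by rw [bp.ratio]; ring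
    _ ≤ M.sparsity * upperTail M.shape (x + M.dilation * -s) :=
        mul_le_mul_of_nonneg_left h7 hτ.le
    _ ≤ _ := by
        refine mul_le_mul_of_nonneg_left ?_ hτ.le
        exact le_mul_of_one_le_left hu M.kind.one_le_tails

/-- A threshold close to the Bayes threshold whose false discovery proportion is below `α / A`. -/
lemma BayesPoint.exists_threshold (h : M.Regular) (bp : BayesPoint M c K Y e L x y)
    (hc : 0 < c) (hL : 0 < L) {α A B s : ℝ} (hα : 0 < α) (hA : 0 ≤ A) (hB : 0 ≤ B)
    (hAB : A * (M.kind.tails * density M.shape 0) / c * Real.exp (-B) ≤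
      tailP M.kind M.shape (Y + 1))
    (hs : s = (B + max (Real.log (α⁻¹ / L)) 0) / (c * L)) (hs1 : s ≤ 1) :
    ∃ t ∈ Ioo (0 : ℝ) 1, A * (M.sparsity * t) ≤ α * M.altCdf t ∧
      tailP M.kind M.shape (Y + 1) ≤ M.altCdf t ∧
      M.bayesPower - M.altCdf t ≤ M.kind.tails * density M.shape 0 * s := by
  have hζ := h.one_le
  have hb := h.dilation_pos
  have hcL : 0 < c * L := by positivity
  set l := max (Real.log (α⁻¹ / L)) 0 with hl
  have hl0 : 0 ≤ l := le_max_right _ _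
  have hs0 : 0 ≤ s := by rw [hs]; positivity
  have hpos : 0 < x + M.dilation * s := by
    have := bp.x_pos
    positivity
  have hF := bp.altCdf_eq h hpos
  have hge : tailP M.kind M.shape (Y + 1) ≤ tailP M.kind M.shape (y + s) :=
    (tailP_strictAnti hζ).antitone (add_le_add ((le_abs_self y).trans bp.y_abs) hs1)
  refine ⟨tailP M.kind M.shape (x + M.dilation * s),
    tailP_mem_Ioo hζ (mem_domain_of_pos hpos), ?_, by rwa [hF], ?_⟩
  · have h1 := bp.sparsity_mul_tailP_le h hc hL hs0
    have h2 : s * (c * L) = B + l := by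
      rw [hs]
      field_simp
    rw [h2, neg_add, Real.exp_add] at h1
    -- The logarithmic part of the shift contributes `α L`. Its `L` cancels the `1 / L` of the Mills
    -- bound, and `B` absorbs the remaining constants.
    have h3 : Real.exp (-l) ≤ α * L := by
      have hal : 0 < α⁻¹ / L := by positivity
      have : Real.exp (-l) ≤ Real.exp (-Real.log (α⁻¹ / L)) :=
        Real.exp_le_exp.2 (neg_le_neg (le_max_left _ _))
      rw [Real.exp_neg (Real.log _), Real.exp_log hal] at this
      refine this.trans (le_of_eq ?_)
      field_simp
    rw [hF]
    have hd := density_pos hζ 0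
    have hk := M.kind.tails_pos
    calc _ ≤ A * (M.kind.tails * density M.shape 0 / (c * L) *
          (Real.exp (-B) * Real.exp (-l))) := mul_le_mul_of_nonneg_left h1 hA
      _ ≤ A * (M.kind.tails * density M.shape 0 / (c * L) * (Real.exp (-B) * (α * L))) := by
          gcongr
      _ = α * (A * (M.kind.tails * density M.shape 0) / c * Real.exp (-B)) := by
          field_simp
      _ ≤ α * tailP M.kind M.shape (y + s) := by
          have := hAB.trans hge
          gcongr
  · rw [hF, bp.power]
    exact tailP_sub_le hζ hs0

lemma BayesPoint.sparsity_mul_bayesThreshold_le (h : M.Regular)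
    (bp : BayesPoint M c K Y e L x y) (hc : 0 < c) (hL : 0 < L) :
    M.sparsity * M.bayesThreshold ≤ M.kind.tails * density M.shape 0 / (c * L) := by
  have := bp.sparsity_mul_tailP_le h hc hL le_rfl
  rw [bp.threshold]
  simpa using this

end BayesPoint

/-- At the BFDR threshold `F / id` equals `(1 - α) τ / α < τ / α`, whereas at `t` it is at least `2
τ / α`. As this quotient is nonincreasing, `t` cannot lie to the right. -/
lemma bfdrThreshold_ge (h : M.Regular) {α t : ℝ} (hα : α ∈ Ioo 0 M.pi0) (ht : t ∈ Ioo (0 : ℝ) 1)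
    (hA : 2 * (M.sparsity * t) ≤ α * M.altCdf t) : t ≤ M.bfdrThreshold α := by
  by_contra hlt
  push Not at hlt
  have hm := bfdrThreshold_mem h hα
  have he := bfdrThreshold_eq h hα
  set u := M.bfdrThreshold α
  have h1 := altCdf_mul_le h hm ht.2.le hlt.le
  have hFu := altCdf_pos h hm
  have hFt := altCdf_pos h ht
  have hτ := h.sparsity_pos
  have h2 : α * M.altCdf u * M.altCdf t ≤ (1 - α) * M.sparsity * (M.altCdf u * t) := by
    rw [← he]
    have hα1 : 0 ≤ 1 - α := by
      have := h.pi0_add_pi1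
      have := h.pi1_pos
      linarith [hα.2]
    calc _ = (1 - α) * M.sparsity * (M.altCdf t * u) := by ring
      _ ≤ _ := mul_le_mul_of_nonneg_left h1 (by positivity)
  have h3 : (1 - α) * M.sparsity * (M.altCdf u * t) ≤ M.sparsity * t * M.altCdf u := by
    have : 0 ≤ α * (M.sparsity * (M.altCdf u * t)) := by
      have := hα.1
      have := ht.1
      positivity
    linarith
  have h4 := mul_le_mul_of_nonneg_right hA hFu.le
  have h5 : 0 < α * M.altCdf u * M.altCdf t := by
    have := hα.1
    positivity
  linarith

end Model

/-! ### Location of the Bayes cutoff along the sequence of models. -/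

section Sequence

variable {kind : ModelKind} {ζ β : ℝ} {signal : ℕ → ℝ}

lemma modelSeq_regular (hζ : AdmissibleShape kind ζ) (hβ0 : 0 < β)
    (hsignal : ∀ m ≥ 2, AdmissibleSignal kind (signal m)) {m : ℕ} (hm : 2 ≤ m) :
    (modelSeq kind ζ β signal m).Regular where
  shape := hζ
  signal := hsignal m hm
  sparsity := Real.one_lt_rpow (by exact_mod_cast hm) hβ0

lemma gammaExp_pos (hζ : AdmissibleShape kind ζ) : 0 < gammaExp kind ζ := by
  cases kind
  · have h : 1 < ζ := hζ
    have : 1 / ζ < 1 := (div_lt_one (by linarith)).2 h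
    simp only [gammaExp]
    linarith
  · simp [gammaExp]

lemma gammaExp_le_one (hζ : AdmissibleShape kind ζ) : gammaExp kind ζ ≤ 1 := by
  cases kind
  · have h : 1 < ζ := hζ
    have : 0 ≤ 1 / ζ := by positivity
    simp only [gammaExp]
    linarith
  · simp [gammaExp]

lemma tendsto_log_natCast : Tendsto (fun m : ℕ => Real.log m) atTop atTop :=
  Real.tendsto_log_atTop.comp tendsto_natCast_atTop_atTop

lemma tendsto_log_rpow {γ : ℝ} (hγ : 0 < γ) :
    Tendsto (fun m : ℕ => Real.log m ^ γ) atTop atTop :=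
  (tendsto_rpow_atTop hγ).comp tendsto_log_natCast

/-- In the scale model `log dilation` contains `log x`, which must be absorbed by half of `x ^ ζ /
ζ`. -/
lemma log_le_rpow_div {ζ x : ℝ} (hζ : 0 < ζ) (hx : 0 < x) : Real.log x ≤ x ^ ζ / (2 * ζ) := by
  have h0 : 0 < x ^ ζ / 2 := by positivity
  have h1 := Real.log_le_sub_one_of_pos h0
  rw [Real.log_div (by positivity) (by norm_num), Real.log_rpow hx] at h1
  have h2 : Real.log 2 ≤ 1 := by linarith [Real.log_two_lt_d9]
  rw [le_div_iff₀ (by positivity)]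
  linarith

lemma exists_bayesPoint_of_location {Y : ℝ} (hζ : 1 < ζ) (hβ0 : 0 < β)
    (hsignal : ∀ m ≥ 2, AdmissibleSignal .location (signal m))
    (hY : ∀ m ≥ 2, ∀ y, (modelSeq .location ζ β signal m).bayesPower = tailP .location ζ y →
      |y| ≤ Y) :
    ∃ c K e : ℝ, 0 < c ∧ 0 < K ∧ 0 < e ∧ ∀ᶠ m : ℕ in atTop, ∃ x y,
      (modelSeq .location ζ β signal m).BayesPoint c K Y e
        (Real.log m ^ gammaExp .location ζ) x y := by
  have hpos : 0 < ζ := by linarith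
  refine ⟨(ζ * β) ^ (1 - 1 / ζ), (ζ * β + 1) ^ (1 - 1 / ζ), 1, by positivity, by positivity,
    one_pos, ?_⟩
  filter_upwards [eventually_ge_atTop 2, tendsto_log_natCast.eventually_ge_atTop (Y ^ ζ),
    tendsto_log_natCast.eventually_ge_atTop (1 / (ζ * β)),
    tendsto_log_natCast.eventually_ge_atTop 0] with m hm hmY hm1 hm0
  have h := modelSeq_regular (kind := .location) hζ hβ0 hsignal hm
  obtain ⟨y, hx, ht, hp, hd⟩ := Model.exists_bayes_observation h
  have hr := Model.rpow_bayes_observation h hx hd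
  have hy := hY m hm y hp
  set x := (modelSeq .location ζ β signal m).shift +
    (modelSeq .location ζ β signal m).dilation * y with hxdef
  have hm' : (0 : ℝ) < m := by exact_mod_cast (by omega : 0 < m)
  have hb : (modelSeq .location ζ β signal m).dilation = 1 := rfl
  have hs : (modelSeq .location ζ β signal m).shape = ζ := rfl
  have ht' : (modelSeq .location ζ β signal m).sparsity = (m : ℝ) ^ β := rfl
  rw [hb, hs, ht', Real.log_one, add_zero, Real.log_rpow hm'] at hr
  have hX : x ^ ζ = ζ * β * Real.log m + |y| ^ ζ := by
    field_simp at hr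
    linarith
  have hyζ : |y| ^ ζ ≤ Y ^ ζ := Real.rpow_le_rpow (abs_nonneg y) hy hpos.le
  have hy0 : 0 ≤ |y| ^ ζ := Real.rpow_nonneg (abs_nonneg y) _
  -- Since `x ^ ζ` is of order `log m`, the exponent `1 - 1 / ζ` here is the origin of `γ` for
  -- location.
  have hpow : x ^ (ζ - 1) = (x ^ ζ) ^ (1 - 1 / ζ) := by
    rw [← Real.rpow_mul hx.le]
    congr 1
    field_simp
  have hγ : 0 ≤ 1 - 1 / ζ := by
    have : 1 / ζ ≤ 1 := (div_le_one hpos).2 hζ.le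
    linarith
  refine ⟨x, y, hy, hxdef, hx, ht, hp, hd, ?_, ?_, ?_⟩
  · rw [hb, hs, one_mul, hpow, gammaExp, ← Real.mul_rpow (by positivity) hm0]
    exact Real.rpow_le_rpow (by positivity) (by linarith) hγ
  · rw [hb, hs, one_mul, hpow, gammaExp, ← Real.mul_rpow (by positivity) hm0]
    exact Real.rpow_le_rpow (by positivity) (by linarith) hγ
  · rw [hb, one_mul]
    have h1 : 1 ≤ x ^ ζ := by
      rw [div_le_iff₀' (by positivity)] at hm1
      linarith
    by_contra hlt
    exact absurd h1 (not_le.2 (Real.rpow_lt_one hx.le (not_le.1 hlt) hpos))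

lemma exists_bayesPoint_of_scale {ylo Y : ℝ} (hζ : 1 ≤ ζ) (hβ0 : 0 < β) (hlo : 0 < ylo)
    (hsignal : ∀ m ≥ 2, AdmissibleSignal .scale (signal m))
    (hY : ∀ m ≥ 2, ∀ y, (modelSeq .scale ζ β signal m).bayesPower = tailP .scale ζ y →
      ylo ≤ y ∧ |y| ≤ Y) :
    ∃ c K e : ℝ, 0 < c ∧ 0 < K ∧ 0 < e ∧ ∀ᶠ m : ℕ in atTop, ∃ x y,
      (modelSeq .scale ζ β signal m).BayesPoint c K Y e
        (Real.log m ^ gammaExp .scale ζ) x y := by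
  have hpos : 0 < ζ := by linarith
  have hY0 : 0 < Y := by
    have h := modelSeq_regular (kind := .scale) hζ hβ0 hsignal le_rfl
    obtain ⟨y, -, -, hp, -⟩ := Model.exists_bayes_observation h
    obtain ⟨h1, h2⟩ := hY 2 le_rfl y hp
    linarith [le_abs_self y]
  refine ⟨ζ * β / Y, 2 * ζ * (β + 1) / ylo, ylo, by positivity, by positivity, hlo, ?_⟩
  filter_upwards [eventually_ge_atTop 2,
    tendsto_log_natCast.eventually_ge_atTop (Y ^ ζ / ζ - Real.log ylo)] with m hm hmY
  have h := modelSeq_regular (kind := .scale) hζ hβ0 hsignal hm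
  obtain ⟨y, hx, ht, hp, hd⟩ := Model.exists_bayes_observation h
  have hr := Model.rpow_bayes_observation h hx hd
  obtain ⟨hyl, hyY⟩ := hY m hm y hp
  have hy0 : 0 < y := hlo.trans_le hyl
  rw [abs_of_pos hy0] at hyY
  set x := (modelSeq .scale ζ β signal m).shift +
    (modelSeq .scale ζ β signal m).dilation * y with hxdef
  have hm' : (0 : ℝ) < m := by exact_mod_cast (by omega : 0 < m)
  have hb := h.dilation_pos
  have hb1 := h.one_le_dilation
  have hs : (modelSeq .scale ζ β signal m).shape = ζ := rfl
  have ht' : (modelSeq .scale ζ β signal m).sparsity = (m : ℝ) ^ β := rfl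
  have hxb : x = (modelSeq .scale ζ β signal m).dilation * y := by
    rw [hxdef]
    change 0 + _ = _
    rw [zero_add]
  set b := (modelSeq .scale ζ β signal m).dilation
  rw [hs, ht', Real.log_rpow hm', abs_of_pos hy0] at hr
  have hlogx : Real.log b = Real.log x - Real.log y := by
    rw [hxb, Real.log_mul hb.ne' hy0.ne']
    ring
  have h1 := log_le_rpow_div hpos hx
  have h2 : Real.log ylo ≤ Real.log y := Real.log_le_log hlo hyl
  have h3 : y ^ ζ / ζ ≤ Y ^ ζ / ζ :=
    div_le_div_of_nonneg_right (Real.rpow_le_rpow hy0.le hyY hpos.le) hpos.le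
  have h4 : x ^ ζ / (2 * ζ) = x ^ ζ / ζ / 2 := by ring
  have hup : x ^ ζ ≤ 2 * ζ * (β + 1) * Real.log m := by
    have : x ^ ζ / ζ ≤ 2 * (β + 1) * Real.log m := by linarith
    rw [div_le_iff₀ hpos] at this
    linarith
  have hlow : ζ * β * Real.log m ≤ x ^ ζ := by
    have e1 := Real.log_nonneg hb1
    have e2 : 0 ≤ y ^ ζ / ζ := by positivity
    have : β * Real.log m ≤ x ^ ζ / ζ := by linarith
    rw [le_div_iff₀ hpos] at this
    linarith
  -- As `dilation = x / y`, the slope is `x ^ ζ / y` with `y` bounded away from zero and infinity;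
  -- hence `γ = 1` for scale.
  have hΛ : b * x ^ (ζ - 1) = x ^ ζ / y := by
    rw [Real.rpow_sub_one hx.ne']
    conv_lhs => rw [hxb]
    rw [← hxb]
    field_simp
    rw [hxb]
  refine ⟨x, y, by rwa [abs_of_pos hy0], hxdef, hx, ht, hp, hd, ?_, ?_, ?_⟩
  · rw [hs, hΛ, gammaExp, Real.rpow_one, le_div_iff₀ hy0]
    have hlog : 0 ≤ Real.log m := Real.log_nonneg (by exact_mod_cast (by omega : 1 ≤ m))
    refine le_trans ?_ hlow
    calc _ ≤ ζ * β / Y * Real.log m * Y := by gcongr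
      _ = _ := by field_simp
  · rw [hs, hΛ, gammaExp, Real.rpow_one, div_le_iff₀ hy0]
    have hlog : 0 ≤ Real.log m := Real.log_nonneg (by exact_mod_cast (by omega : 1 ≤ m))
    refine hup.trans ?_
    calc _ = 2 * ζ * (β + 1) / ylo * Real.log m * ylo := by field_simp
      _ ≤ _ := by gcongr
  · rw [hxb]
    gcongr

/-- Bounded power localizes the Bayes rule uniformly in the sample size. -/
lemma exists_bayesPoint (hζ : AdmissibleShape kind ζ) (hβ0 : 0 < β)
    (hsignal : ∀ m ≥ 2, AdmissibleSignal kind (signal m))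
    (hBP : BoundedPower (modelSeq kind ζ β signal)) :
    ∃ Y c K e : ℝ, 0 < c ∧ 0 < K ∧ 0 < e ∧ ∀ᶠ m : ℕ in atTop, ∃ x y,
      (modelSeq kind ζ β signal m).BayesPoint c K Y e (Real.log m ^ gammaExp kind ζ) x y := by
  obtain ⟨Cm, Cp, hCm, hCp, hC⟩ := hBP
  obtain ⟨ylo, hlo, yhi, hy⟩ := exists_tailP_bracket (k := kind) hζ.one_le hCm hCp
    ((hC 2 le_rfl).1.trans (hC 2 le_rfl).2)
  have habs : ∀ y, ylo ≤ y ∧ y ≤ yhi → |y| ≤ max |ylo| |yhi| := fun y h =>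
    abs_le_max_abs_abs h.1 h.2
  refine ⟨max |ylo| |yhi|, ?_⟩
  cases kind
  · refine exists_bayesPoint_of_location hζ hβ0 hsignal fun m hm y hp => habs y ?_
    exact hy y (hp ▸ (hC m hm).1) (hp ▸ (hC m hm).2)
  · refine exists_bayesPoint_of_scale hζ hβ0 hlo hsignal fun m hm y hp => ?_
    have := hy y (hp ▸ (hC m hm).1) (hp ▸ (hC m hm).2)
    exact ⟨this.1, habs y this⟩

end Sequence

/-! ### Comparison of rates and level conditions. -/

section Rates

variable {R RB ρ ρ' α : ℕ → ℝ} {γ : ℝ}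

/-- The rate bounds the excess only from above, so the equivalence also needs that the Bayes risk is
a lower bound. -/
lemma AsympOptimalAtRate.asympOptimal (h : AsympOptimalAtRate R RB ρ)
    (hle : ∀ᶠ m in atTop, RB m ≤ R m) (hpos : ∀ᶠ m in atTop, 0 < RB m) : AsympOptimal R RB := by
  obtain ⟨hρ, D, hD, hR⟩ := h
  refine isLittleO_iff.2 fun ε hε => ?_
  have h1 : Tendsto (fun m => D * ρ m) atTop (𝓝 0) := by simpa using hρ.const_mul D
  filter_upwards [hle, hpos, hR, h1.eventually (ge_mem_nhds hε)] with m h2 h3 h4 h5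
  rw [Pi.sub_apply, Real.norm_of_nonneg (sub_nonneg.2 h2), Real.norm_of_nonneg h3.le]
  calc R m - RB m ≤ D * ρ m * RB m := h4.trans (le_of_eq (by ring))
    _ ≤ ε * RB m := mul_le_mul_of_nonneg_right h5 h3.le

lemma AsympOptimalAtRate.mono (h : AsympOptimalAtRate R RB ρ) (hρ' : Tendsto ρ' atTop (𝓝 0))
    {K : ℝ} (hK : 0 < K) (hle : ∀ᶠ m in atTop, ρ m ≤ K * ρ' m)
    (hpos : ∀ᶠ m in atTop, 0 < RB m) : AsympOptimalAtRate R RB ρ' := by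
  obtain ⟨-, D, hD, hR⟩ := h
  refine ⟨hρ', D * K, by positivity, ?_⟩
  filter_upwards [hle, hpos, hR] with m h1 h2 h3
  calc _ ≤ D * RB m * ρ m := h3
    _ ≤ D * RB m * (K * ρ' m) := mul_le_mul_of_nonneg_left h1 (by positivity)
    _ = _ := by ring

lemma tendsto_explicitRate (hγ : 0 < γ) (hα : ∀ᶠ m in atTop, 0 < α m)
    (h : LevelCondition γ α) : Tendsto (explicitRate γ α) atTop (𝓝 0) := by
  have h1 : Tendsto (fun m => α m + |Real.log (α m) / Real.log m ^ γ|) atTop (𝓝 0) := by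
    simpa using h.1.add (h.2.tendsto_div_nhds_zero.abs)
  refine tendsto_of_tendsto_of_tendsto_of_le_of_le' tendsto_const_nhds h1 ?_ ?_
  · filter_upwards [hα, (tendsto_log_rpow hγ).eventually_gt_atTop 0] with m hm hL
    unfold explicitRate
    positivity
  · filter_upwards [hα, (tendsto_log_rpow hγ).eventually_ge_atTop 1] with m hm hL
    unfold explicitRate
    have hL0 : 0 < Real.log m ^ γ := by linarith
    rw [abs_div, abs_of_pos hL0]
    refine add_le_add le_rfl (div_le_div_of_nonneg_right (max_le ?_ (abs_nonneg _)) hL0.le)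
    rw [Real.log_div (inv_pos.2 hm).ne' hL0.ne', Real.log_inv]
    have := Real.log_nonneg hL
    have := neg_abs_le (Real.log (α m))
    linarith

/-- Either `α L ≥ 1 / 3`, and the first term of the rate suffices, or `log (1 / (α L)) ≥ log 3 ≥ 1`,
and the second does. Errors of order `1 / L` can thus be absorbed. -/
lemma inv_le_explicitRate {m : ℕ} (hα : 0 < α m) (hL : 0 < Real.log m ^ γ) :
    (Real.log m ^ γ)⁻¹ ≤ 3 * explicitRate γ α m := by
  unfold explicitRate
  set L := Real.log m ^ γ
  have hnn : 0 ≤ max (Real.log ((α m)⁻¹ / L)) 0 / L := by positivity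
  by_cases h : 1 ≤ 3 * (α m * L)
  · have : L⁻¹ ≤ 3 * α m := by
      rw [inv_le_iff_one_le_mul₀ hL]
      linarith
    linarith
  · have h3 : 3 ≤ (α m)⁻¹ / L := by
      rw [le_div_iff₀ hL, le_inv_comm₀ (by positivity) hα, inv_eq_one_div, le_div_iff₀ (by positivity)]
      linarith
    have h1 : 1 ≤ Real.log ((α m)⁻¹ / L) := by
      rw [Real.le_log_iff_exp_le (by linarith)]
      linarith [Real.exp_one_lt_d9]
    have h2 : L⁻¹ ≤ max (Real.log ((α m)⁻¹ / L)) 0 / L := by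
      rw [inv_eq_one_div]
      exact div_le_div_of_nonneg_right (h1.trans (le_max_left _ _)) hL.le
    linarith

lemma levelCondition_of_isTheta (hγ : 0 < γ) (hα : ∀ᶠ m in atTop, 0 < α m)
    (h : α =Θ[atTop] fun m : ℕ => (Real.log m ^ γ)⁻¹) :
    LevelCondition γ α ∧ ∃ K : ℝ, 0 < K ∧
      ∀ᶠ m in atTop, explicitRate γ α m ≤ K * (Real.log m ^ γ)⁻¹ := by
  have hL := tendsto_log_rpow hγ
  have hLi : Tendsto (fun m : ℕ => (Real.log m ^ γ)⁻¹) atTop (𝓝 0) := hL.inv_tendsto_atTop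
  have hα0 := h.1.trans_tendsto hLi
  obtain ⟨C, hC, hup⟩ := h.1.exists_pos
  obtain ⟨c, hc, hlo⟩ := h.2.exists_pos
  rw [IsBigOWith_def] at hup hlo
  have hlow : ∀ᶠ m : ℕ in atTop, (α m)⁻¹ / Real.log m ^ γ ≤ c := by
    filter_upwards [hα, hlo, hL.eventually_gt_atTop 0] with m h1 h2 h3
    rw [Real.norm_of_nonneg (inv_nonneg.2 h3.le), Real.norm_of_nonneg h1.le] at h2
    rw [div_eq_mul_inv, inv_mul_le_iff₀ h1, mul_comm]
    exact h2
  refine ⟨⟨hα0, ?_⟩, C + |Real.log c|, by positivity, ?_⟩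
  · have h1 : (fun m : ℕ => |Real.log c| + Real.log (Real.log m ^ γ)) =o[atTop]
        fun m : ℕ => Real.log m ^ γ := by
      refine IsLittleO.add ?_ (Real.isLittleO_log_id_atTop.comp_tendsto hL)
      exact (isLittleO_const_id_atTop (|Real.log c|)).comp_tendsto hL
    refine IsBigO.trans_isLittleO (IsBigO.of_bound 1 ?_) h1
    filter_upwards [hα, hlow, hL.eventually_ge_atTop 1, hα0.eventually (ge_mem_nhds one_pos)]
      with m h1 h2 h3 h4
    have hL0 : 0 < Real.log m ^ γ := by linarith
    have h5 := Real.log_le_log (by positivity) h2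
    rw [Real.log_div (inv_pos.2 h1).ne' hL0.ne', Real.log_inv] at h5
    have h6 := Real.log_nonneg h3
    have h7 := Real.log_nonpos h1.le h4
    rw [one_mul, Real.norm_of_nonpos h7, Real.norm_of_nonneg (by positivity)]
    linarith [le_abs_self (Real.log c)]
  · filter_upwards [hα, hlow, hup, hL.eventually_gt_atTop 0] with m h1 h2 h3 h4
    rw [Real.norm_of_nonneg (inv_nonneg.2 h4.le), Real.norm_of_nonneg h1.le] at h3
    unfold explicitRate
    rw [add_mul, div_eq_mul_inv]
    refine add_le_add h3 (mul_le_mul_of_nonneg_right (max_le ?_ (abs_nonneg _))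
      (inv_nonneg.2 h4.le))
    exact (Real.log_le_log (by positivity) h2).trans (le_abs_self _)

end Rates

/-! ### The explicit rate for BFDR thresholding. -/

section Optimality

variable {kind : ModelKind} {ζ β : ℝ} {signal : ℕ → ℝ} {α : ℕ → ℝ}

/-- The Bayes risk is of the order of the proportion of alternatives. -/
lemma bayesRiskSeq_bounds (hζ : AdmissibleShape kind ζ) (hβ0 : 0 < β)
    (hsignal : ∀ m ≥ 2, AdmissibleSignal kind (signal m))
    (hBP : BoundedPower (modelSeq kind ζ β signal)) (k : RiskKind) :
    ∃ η : ℝ, 0 < η ∧ ∀ m ≥ 2,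
      bayesRiskSeq (modelSeq kind ζ β signal) k m =
        (modelSeq kind ζ β signal m).pointRisk (modelSeq kind ζ β signal m).bayesThreshold ∧
      η * (modelSeq kind ζ β signal m).pi1 ≤ bayesRiskSeq (modelSeq kind ζ β signal) k m ∧
      bayesRiskSeq (modelSeq kind ζ β signal) k m ≤ (modelSeq kind ζ β signal m).pi1 := by
  obtain ⟨Cm, Cp, hCm, hCp, hC⟩ := hBP
  refine ⟨1 - Cp, by linarith, fun m hm => ?_⟩
  have h := modelSeq_regular (β := β) hζ hβ0 hsignal hm
  have hCm := (hC m hm).2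
  set M := modelSeq kind ζ β signal m with hM
  obtain ⟨x, hx, hxt, -⟩ := Model.exists_bayesThreshold_eq h
  have hB : M.bayesThreshold ∈ Ioo (0 : ℝ) 1 := hxt ▸ tailP_mem_Ioo h.one_le hx
  have he : bayesRiskSeq (modelSeq kind ζ β signal) k m = M.pointRisk M.bayesThreshold :=
    Model.detRisk_eq_pointRisk h k (by omega) ⟨hB.1.le, hB.2.le⟩
  have h1 := h.pi1_pos
  refine ⟨he, ?_, ?_⟩
  · rw [he, Model.pointRisk_eq, mul_comm]
    refine mul_le_mul_of_nonneg_left ?_ h1.le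
    have := mul_pos h.sparsity_pos hB.1
    change M.altCdf M.bayesThreshold ≤ Cp at hCm
    linarith
  -- The competitor that never rejects has risk `π₁`.
  · have hn := Model.isProbabilityMeasure_altLaw h
    have := Model.pointRisk_bayes_le h MeasurableSet.empty
    rw [he]
    simpa using this

/-- Under the level condition there is a threshold of small false discovery rate that loses at
most the explicit rate in power. -/
lemma exists_good_threshold (hζ : AdmissibleShape kind ζ) (hβ0 : 0 < β)
    (hsignal : ∀ m ≥ 2, AdmissibleSignal kind (signal m))
    (hBP : BoundedPower (modelSeq kind ζ β signal)) (hα : ∀ᶠ m in atTop, 0 < α m)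
    (hlev : LevelCondition (gammaExp kind ζ) α) {A : ℝ} (hA : 0 < A) :
    ∃ D c₁ : ℝ, 0 < D ∧ 0 < c₁ ∧ ∀ᶠ m : ℕ in atTop, ∃ t ∈ Ioo (0 : ℝ) 1,
      A * ((modelSeq kind ζ β signal m).sparsity * t) ≤
        α m * (modelSeq kind ζ β signal m).altCdf t ∧
      c₁ ≤ (modelSeq kind ζ β signal m).altCdf t ∧
      (modelSeq kind ζ β signal m).bayesPower - (modelSeq kind ζ β signal m).altCdf t ≤
        D * explicitRate (gammaExp kind ζ) α m := by
  obtain ⟨Y, c, K, e, hc, hK, he, hbp⟩ := exists_bayesPoint hζ hβ0 hsignal hBP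
  have hγ := gammaExp_pos hζ
  have hρ := tendsto_explicitRate hγ hα hlev
  have hd := density_pos hζ.one_le 0
  have hk := kind.tails_pos
  have hc₁ : 0 < tailP kind ζ (Y + 1) := tailP_pos hζ.one_le _
  set q := A * (kind.tails * density ζ 0) / c with hq
  have hq0 : 0 < q := by positivity
  obtain ⟨B, hB, hBq⟩ : ∃ B : ℝ, 0 ≤ B ∧ q * Real.exp (-B) ≤ tailP kind ζ (Y + 1) := by
    refine ⟨max (Real.log (q / tailP kind ζ (Y + 1))) 0, le_max_right _ _, ?_⟩
    have h1 : Real.exp (-max (Real.log (q / tailP kind ζ (Y + 1))) 0) ≤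
        Real.exp (-Real.log (q / tailP kind ζ (Y + 1))) :=
      Real.exp_le_exp.2 (neg_le_neg (le_max_left _ _))
    rw [Real.exp_neg (Real.log _), Real.exp_log (by positivity)] at h1
    calc _ ≤ q * (q / tailP kind ζ (Y + 1))⁻¹ := mul_le_mul_of_nonneg_left h1 hq0.le
      _ = _ := by field_simp
  -- The `3 B` pays for the constant part of the shift via `inv_le_explicitRate`, the `1` for its
  -- logarithmic part.
  set S := (3 * B + 1) / c with hS
  have hS0 : 0 < S := by positivity
  have hSρ : Tendsto (fun m => S * explicitRate (gammaExp kind ζ) α m) atTop (𝓝 0) := by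
    simpa using hρ.const_mul S
  refine ⟨kind.tails * density ζ 0 * S, _, by positivity, hc₁, ?_⟩
  filter_upwards [eventually_ge_atTop 2, hbp, hα, (tendsto_log_rpow hγ).eventually_gt_atTop 0,
    hSρ.eventually (ge_mem_nhds one_pos)] with m hm ⟨x, y, bp⟩ hαm hL hs1
  have h := modelSeq_regular (β := β) hζ hβ0 hsignal hm
  set L := Real.log m ^ gammaExp kind ζ with hLdef
  have hs : (B + max (Real.log ((α m)⁻¹ / L)) 0) / (c * L) ≤
      S * explicitRate (gammaExp kind ζ) α m := by
    have h1 := inv_le_explicitRate (γ := gammaExp kind ζ) hαm hL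
    have h2 : max (Real.log ((α m)⁻¹ / L)) 0 / L ≤ explicitRate (gammaExp kind ζ) α m :=
      le_add_of_nonneg_left hαm.le
    have h3 := mul_le_mul_of_nonneg_left h1 hB
    calc _ = (B * L⁻¹ + max (Real.log ((α m)⁻¹ / L)) 0 / L) / c := by field_simp
      _ ≤ (B * (3 * explicitRate (gammaExp kind ζ) α m) +
          explicitRate (gammaExp kind ζ) α m) / c :=
        div_le_div_of_nonneg_right (add_le_add h3 h2) hc.le
      _ = _ := by rw [hS]; ring
  obtain ⟨t, ht, h1, h2, h3⟩ := bp.exists_threshold h hc hL hαm hA.le hB hBq rfl (hs.trans hs1)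
  refine ⟨t, ht, h1, h2, h3.trans ?_⟩
  calc _ ≤ kind.tails * density ζ 0 * (S * explicitRate (gammaExp kind ζ) α m) :=
        mul_le_mul_of_nonneg_left hs (by positivity)
    _ = _ := by ring

lemma eventually_bayesRiskSeq_pos (hζ : AdmissibleShape kind ζ) (hβ0 : 0 < β)
    (hsignal : ∀ m ≥ 2, AdmissibleSignal kind (signal m))
    (hBP : BoundedPower (modelSeq kind ζ β signal)) (k : RiskKind) :
    ∀ᶠ m in atTop, 0 < bayesRiskSeq (modelSeq kind ζ β signal) k m := by
  obtain ⟨η, hη, h⟩ := bayesRiskSeq_bounds hζ hβ0 hsignal hBP k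
  filter_upwards [eventually_ge_atTop 2] with m hm
  exact (mul_pos hη (modelSeq_regular hζ hβ0 hsignal hm).pi1_pos).trans_le (h m hm).2.1

lemma bfdrRiskSeq_eq (hζ : AdmissibleShape kind ζ) (hβ0 : 0 < β)
    (hsignal : ∀ m ≥ 2, AdmissibleSignal kind (signal m)) (k : RiskKind) {m : ℕ} (hm : 2 ≤ m)
    (hα : α m ∈ Ioo 0 (modelSeq kind ζ β signal m).pi0) :
    bfdrRiskSeq (modelSeq kind ζ β signal) k α m =
      (modelSeq kind ζ β signal m).pointRisk
        ((modelSeq kind ζ β signal m).bfdrThreshold (α m)) := by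
  have h := modelSeq_regular (β := β) hζ hβ0 hsignal hm
  have ht := Model.bfdrThreshold_mem h hα
  exact Model.detRisk_eq_pointRisk h k (by omega) ⟨ht.1.le, ht.2.le⟩

lemma asympOptimalAtRate_of_excess {R : ℕ → ℝ} {M : ℕ → Model} {k : RiskKind} {ρ : ℕ → ℝ}
    {η D : ℝ} (hη : 0 < η) (hD : 0 < D) (hρ : Tendsto ρ atTop (𝓝 0))
    (hρ0 : ∀ᶠ m in atTop, 0 ≤ ρ m)
    (hB : ∀ᶠ m in atTop, η * (M m).pi1 ≤ bayesRiskSeq M k m)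
    (hR : ∀ᶠ m in atTop, R m - bayesRiskSeq M k m ≤ (M m).pi1 * (D * ρ m)) :
    AsympOptimalAtRate R (bayesRiskSeq M k) ρ := by
  refine ⟨hρ, D / η, by positivity, ?_⟩
  filter_upwards [hρ0, hB, hR] with m h1 h2 h3
  have h4 : (M m).pi1 ≤ bayesRiskSeq M k m / η := by
    rw [le_div_iff₀ hη]
    linarith
  calc _ ≤ (M m).pi1 * (D * ρ m) := h3
    _ ≤ bayesRiskSeq M k m / η * (D * ρ m) := mul_le_mul_of_nonneg_right h4 (by positivity)
    _ = _ := by ring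

lemma explicitRate_ge {γ : ℝ} {m : ℕ} (hL : 0 < Real.log m ^ γ) : α m ≤ explicitRate γ α m :=
  le_add_of_nonneg_right (by positivity)

/-- BFDR thresholding attains the explicit rate under the level condition. -/
theorem bfdr_asympOptimalAtRate (hζ : AdmissibleShape kind ζ) (hβ0 : 0 < β)
    (hsignal : ∀ m ≥ 2, AdmissibleSignal kind (signal m))
    (hBP : BoundedPower (modelSeq kind ζ β signal)) (k : RiskKind)
    (hα : ∀ᶠ m in atTop, α m ∈ Ioo 0 (modelSeq kind ζ β signal m).pi0)
    (hlev : LevelCondition (gammaExp kind ζ) α) :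
    AsympOptimalAtRate (bfdrRiskSeq (modelSeq kind ζ β signal) k α)
      (bayesRiskSeq (modelSeq kind ζ β signal) k) (explicitRate (gammaExp kind ζ) α) := by
  have hα0 : ∀ᶠ m in atTop, 0 < α m := hα.mono fun m h => h.1
  obtain ⟨D, c₁, hD, hc₁, ht⟩ :=
    exists_good_threshold hζ hβ0 hsignal hBP hα0 hlev (A := 2) two_pos
  obtain ⟨η, hη, hB⟩ := bayesRiskSeq_bounds hζ hβ0 hsignal hBP k
  have hLev := (tendsto_log_rpow (gammaExp_pos hζ)).eventually_gt_atTop 0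
  -- The `2` comes from the weighted level `τ t⋆ ≤ 2 α`, the `D` from the loss of power at `t`.
  refine asympOptimalAtRate_of_excess hη (D := 2 + D) (by positivity)
    (tendsto_explicitRate (gammaExp_pos hζ) hα0 hlev) ?_
    ((eventually_ge_atTop 2).mono fun m hm => (hB m hm).2.1) ?_
  · filter_upwards [hα0, hLev] with m h1 h2
    exact h1.le.trans (explicitRate_ge h2)
  filter_upwards [eventually_ge_atTop 2, hα, ht, hLev,
    hlev.1.eventually (ge_mem_nhds (show (0 : ℝ) < 1 / 2 by norm_num))]
    with m hm hαm ⟨t, htI, ht1, ht2, ht3⟩ hL hα2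
  have h := modelSeq_regular (β := β) hζ hβ0 hsignal hm
  rw [(hB m hm).1, bfdrRiskSeq_eq hζ hβ0 hsignal k hm hαm, Model.pointRisk_eq,
    Model.pointRisk_eq, ← mul_sub]
  refine mul_le_mul_of_nonneg_left ?_ h.pi1_pos.le
  have hge := Model.altCdf_mono h (Model.bfdrThreshold_ge h hαm htI ht1)
  have heq := Model.bfdrThreshold_eq h hαm
  have hmem := Model.bfdrThreshold_mem h hαm
  have hρα := explicitRate_ge (α := α) hL
  obtain ⟨x, hx, hxt, -⟩ := Model.exists_bayesThreshold_eq h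
  set M := modelSeq kind ζ β signal m
  have hB0 : 0 < M.sparsity * M.bayesThreshold :=
    mul_pos h.sparsity_pos (hxt ▸ tailP_pos h.one_le x)
  have hF1 := Model.altCdf_le_one h (M.bfdrThreshold (α m))
  have hu0 : 0 < M.sparsity * M.bfdrThreshold (α m) := mul_pos h.sparsity_pos hmem.1
  have hu : M.sparsity * M.bfdrThreshold (α m) ≤ 2 * α m := by
    have h1 : α m * M.altCdf (M.bfdrThreshold (α m)) ≤ α m * 1 :=
      mul_le_mul_of_nonneg_left hF1 hαm.1.le
    have h2 : 1 / 2 * (M.sparsity * M.bfdrThreshold (α m)) ≤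
        (1 - α m) * (M.sparsity * M.bfdrThreshold (α m)) :=
      mul_le_mul_of_nonneg_right (by linarith) hu0.le
    linarith
  change M.altCdf M.bayesThreshold - _ ≤ _ at ht3
  linarith

lemma bayesRiskSeq_le_bfdrRiskSeq (hζ : AdmissibleShape kind ζ) (hβ0 : 0 < β)
    (hsignal : ∀ m ≥ 2, AdmissibleSignal kind (signal m))
    (hBP : BoundedPower (modelSeq kind ζ β signal)) (k : RiskKind)
    (hα : ∀ᶠ m in atTop, α m ∈ Ioo 0 (modelSeq kind ζ β signal m).pi0) :
    ∀ᶠ m in atTop, bayesRiskSeq (modelSeq kind ζ β signal) k m ≤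
      bfdrRiskSeq (modelSeq kind ζ β signal) k α m := by
  obtain ⟨η, hη, hB⟩ := bayesRiskSeq_bounds hζ hβ0 hsignal hBP k
  filter_upwards [eventually_ge_atTop 2, hα] with m hm hαm
  have h := modelSeq_regular (β := β) hζ hβ0 hsignal hm
  have ht := Model.bfdrThreshold_mem h hαm
  rw [(hB m hm).1, bfdrRiskSeq_eq hζ hβ0 hsignal k hm hαm]
  exact Model.pointRisk_bayes_le_pointRisk h ⟨ht.1.le, ht.2.le⟩

end Optimality

/-! ### The explicit rate for FDR thresholding. -/

section FDR

variable {kind : ModelKind} {ζ β : ℝ} {signal : ℕ → ℝ} {α : ℕ → ℝ}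

lemma Model.Regular.inv_two_mul_le_pi1 {M : Model} (h : M.Regular) :
    (2 * M.sparsity)⁻¹ ≤ M.pi1 := by
  have := h.sparsity
  unfold Model.pi1
  rw [inv_eq_one_div]
  exact one_div_le_one_div_of_le (by linarith) (by linarith)

lemma eventually_exp_neg_rpow_le {γ c : ℝ} (hγ1 : γ ≤ 1) (hβ0 : 0 < β) (hβ1 : β < 1)
    (hc : 0 < c) :
    ∀ᶠ m : ℕ in atTop,
      Real.exp (-(c * (m : ℝ) ^ (1 - β))) ≤ (2 * (m : ℝ) ^ β)⁻¹ * (Real.log m ^ γ)⁻¹ := by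
  have h1β : 0 < 1 - β := by linarith
  have ht : Tendsto (fun m : ℕ => (m : ℝ) ^ (1 - β)) atTop atTop :=
    (tendsto_rpow_atTop h1β).comp tendsto_natCast_atTop_atTop
  -- The exponent is chosen so that the power of `m ^ (1 - β)` becomes `m ^ (-β - 1)`; the spare `1
  -- / m` dominates the logarithmic factor.
  have ho := (isLittleO_exp_neg_mul_rpow_atTop hc (-((1 + β) / (1 - β)))).comp_tendsto ht
  filter_upwards [isLittleO_iff.1 ho (show (0 : ℝ) < 1 / 2 by norm_num), eventually_ge_atTop 1,
    tendsto_log_natCast.eventually_ge_atTop 1] with m hm hm1 hlog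
  have hm0 : (0 : ℝ) < m := by exact_mod_cast hm1
  simp only [Function.comp_apply] at hm
  rw [Real.norm_of_nonneg (Real.exp_pos _).le, Real.norm_of_nonneg (by positivity),
    ← Real.rpow_mul hm0.le, neg_mul] at hm
  have e1 : (1 - β) * -((1 + β) / (1 - β)) = -β - 1 := by
    field_simp
    ring
  rw [e1, Real.rpow_sub_one hm0.ne', Real.rpow_neg hm0.le] at hm
  refine hm.trans ?_
  have hL : Real.log m ^ γ ≤ m := by
    calc Real.log m ^ γ ≤ Real.log m ^ (1 : ℝ) := Real.rpow_le_rpow_of_exponent_le hlog hγ1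
      _ = Real.log m := Real.rpow_one _
      _ ≤ m := (Real.log_le_sub_one_of_pos hm0).trans (by linarith)
  have hL0 : 0 < Real.log m ^ γ := Real.rpow_pos_of_pos (by linarith) _
  have hinv : (m : ℝ)⁻¹ ≤ (Real.log m ^ γ)⁻¹ := inv_anti₀ hL0 hL
  calc _ = (2 * (m : ℝ) ^ β)⁻¹ * (m : ℝ)⁻¹ := by
        rw [mul_inv]
        ring
    _ ≤ _ := mul_le_mul_of_nonneg_left hinv (by positivity)

/-- FDR thresholding rarely stops below a threshold of false discovery rate at most `α / 4`. -/
lemma eventually_fdrThreshold_lt_le (hζ : AdmissibleShape kind ζ) (hβ0 : 0 < β) (hβ1 : β ≤ 1)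
    (hsignal : ∀ m ≥ 2, AdmissibleSignal kind (signal m)) (hα : ∀ᶠ m in atTop, 0 < α m)
    {c₁ : ℝ} (hc₁ : 0 < c₁) :
    ∀ᶠ m : ℕ in atTop, ∀ t ∈ Ioo (0 : ℝ) 1,
      4 * ((modelSeq kind ζ β signal m).sparsity * t) ≤
        α m * (modelSeq kind ζ β signal m).altCdf t →
      c₁ ≤ (modelSeq kind ζ β signal m).altCdf t →
      ((modelSeq kind ζ β signal m).sampleLaw m).real
          {ω | fdrThreshold (α m) ((modelSeq kind ζ β signal m).pValues ω) < t} ≤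
        (modelSeq kind ζ β signal m).pi1 * (Real.log m ^ gammaExp kind ζ)⁻¹ := by
  rcases hβ1.eq_or_lt with rfl | hβ1
  · filter_upwards [eventually_ge_atTop 2, hα] with m hm hαm t ht ht1 _
    have h := modelSeq_regular (β := 1) hζ hβ0 hsignal hm
    have hm' : (0 : ℝ) < m := by exact_mod_cast (by omega : 0 < m)
    have hτ : (modelSeq kind ζ 1 signal m).sparsity = m := Real.rpow_one _
    have hL : 0 ≤ (Real.log m ^ gammaExp kind ζ)⁻¹ :=
      inv_nonneg.2 (Real.rpow_nonneg (Real.log_natCast_nonneg m) _)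
    -- Here `τ = m`, so the level constraint puts `t` below the Bonferroni floor and the event is
    -- empty.
    have htα : t ≤ α m / m := by
      rw [le_div_iff₀ hm']
      rw [hτ] at ht1
      have h1 := mul_le_mul_of_nonneg_left
        (Model.altCdf_le_one h t) hαm.le
      have h2 := mul_pos hm' ht.1
      linarith
    have he : {ω : Fin m → ℝ × Bool |
        fdrThreshold (α m) ((modelSeq kind ζ 1 signal m).pValues ω) < t} = ∅ := by
      ext ω
      simp only [mem_ofPred_eq, mem_empty_iff_false, iff_false, not_lt]
      exact htα.trans (le_max_right _ _)
    rw [he, measureReal_empty]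
    exact mul_nonneg h.pi1_pos.le hL
  · filter_upwards [eventually_ge_atTop 2, hα, eventually_exp_neg_rpow_le (gammaExp_le_one hζ)
      hβ0 hβ1 (c := c₁ / 20) (by positivity)] with m hm hαm hexp t ht ht1 ht2
    have h := modelSeq_regular (β := β) hζ hβ0 hsignal hm
    have hP := Model.isProbabilityMeasure_sampleLaw h m
    have hm' : (0 : ℝ) < m := by exact_mod_cast (by omega : 0 < m)
    have hτ : (modelSeq kind ζ β signal m).sparsity = (m : ℝ) ^ β := rfl
    have hL : 0 ≤ (Real.log m ^ gammaExp kind ζ)⁻¹ :=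
      inv_nonneg.2 (Real.rpow_nonneg (Real.log_natCast_nonneg m) _)
    have hpi := h.inv_two_mul_le_pi1
    have hτ0 := h.sparsity_pos
    set M := modelSeq kind ζ β signal m
    have hF0 := Model.altCdf_nonneg (M := M) t
    -- The factor `4` is spent here: one `2` on the Chernoff bound, the other on `π₁ ≥ 1 / (2 τ)`.
    have hq : 2 * t / α m ≤ M.pi1 * M.altCdf t := by
      refine le_trans ?_ (mul_le_mul_of_nonneg_right hpi hF0)
      rw [div_le_iff₀ hαm, inv_mul_eq_div, div_mul_eq_mul_div, le_div_iff₀ (by positivity)]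
      linarith
    have hm1 : 1 ≤ m := by omega
    have hbh := Model.sampleLaw_bh_lt_le h hm1 ⟨ht.1.le, ht.2.le⟩ hq
    have hsub : {ω : Fin m → ℝ × Bool | fdrThreshold (α m) (M.pValues ω) < t} ⊆
        {ω | bhThreshold (α m) (M.pValues ω) < t} := fun ω hω =>
      show bhThreshold (α m) (M.pValues ω) < t from lt_of_le_of_lt (le_max_left _ _) hω
    refine (measureReal_mono hsub).trans (hbh.trans ?_)
    refine le_trans (Real.exp_le_exp.2 (neg_le_neg ?_)) (hexp.trans
      (mul_le_mul_of_nonneg_right (by rwa [hτ] at hpi) hL))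
    have h1 : (2 * M.sparsity)⁻¹ * c₁ ≤ M.pi1 * M.altCdf t :=
      mul_le_mul hpi ht2 hc₁.le h.pi1_pos.le
    have h2 : (m : ℝ) ^ (1 - β) = m / m ^ β := by
      rw [Real.rpow_sub hm', Real.rpow_one]
    have h3 : (0 : ℝ) < (m : ℝ) ^ β := by positivity
    calc c₁ / 20 * (m : ℝ) ^ (1 - β) = m * ((2 * M.sparsity)⁻¹ * c₁) / 10 := by
          rw [h2, hτ]
          field_simp
          norm_num
      _ ≤ _ := by gcongr

/-- FDR thresholding attains the explicit rate under the level condition. -/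
theorem fdr_asympOptimalAtRate (hζ : AdmissibleShape kind ζ) (hβ0 : 0 < β) (hβ1 : β ≤ 1)
    (hsignal : ∀ m ≥ 2, AdmissibleSignal kind (signal m))
    (hBP : BoundedPower (modelSeq kind ζ β signal)) (k : RiskKind)
    (hα : ∀ᶠ m in atTop, 0 < α m) (hlev : LevelCondition (gammaExp kind ζ) α) :
    AsympOptimalAtRate (fdrRiskSeq (modelSeq kind ζ β signal) k α)
      (bayesRiskSeq (modelSeq kind ζ β signal) k) (explicitRate (gammaExp kind ζ) α) := by
  obtain ⟨D, c₁, hD, hc₁, ht⟩ :=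
    exists_good_threshold hζ hβ0 hsignal hBP hα hlev (A := 4) four_pos
  obtain ⟨η, hη, hB⟩ := bayesRiskSeq_bounds hζ hβ0 hsignal hBP k
  have hLev := (tendsto_log_rpow (gammaExp_pos hζ)).eventually_gt_atTop 0
  -- The `7 = 5 + 2` bounds the false positives, using `τ ≤ m` and `π₀ ≤ 1`; `D` is the power loss;
  -- `3` converts the failure probability, of order `π₁ / L`, into the rate.
  refine asympOptimalAtRate_of_excess hη (D := 7 + D + 3) (by positivity)
    (tendsto_explicitRate (gammaExp_pos hζ) hα hlev) ?_
    ((eventually_ge_atTop 2).mono fun m hm => (hB m hm).2.1) ?_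
  · filter_upwards [hα, hLev] with m h1 h2
    exact h1.le.trans (explicitRate_ge h2)
  filter_upwards [eventually_ge_atTop 2, hα, ht, hLev,
    eventually_fdrThreshold_lt_le hζ hβ0 hβ1 hsignal hα hc₁,
    hlev.1.eventually (ge_mem_nhds (show (0 : ℝ) < 1 / 2 by norm_num))]
    with m hm hαm ⟨t, htI, ht1, ht2, ht3⟩ hL hP hα2
  have h := modelSeq_regular (β := β) hζ hβ0 hsignal hm
  have hm' : (1 : ℝ) ≤ m := by exact_mod_cast (by omega : 1 ≤ m)
  have hprob := hP t htI ht1 ht2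
  have hrisk := Model.risk_fdrThreshold_le h k hαm hα2 (by omega : 1 ≤ m) t
  have hτm : (modelSeq kind ζ β signal m).sparsity ≤ m := by
    change (m : ℝ) ^ β ≤ m
    calc (m : ℝ) ^ β ≤ (m : ℝ) ^ (1 : ℝ) := Real.rpow_le_rpow_of_exponent_le hm' hβ1
      _ = m := Real.rpow_one _
  obtain ⟨x, hx, hxt, -⟩ := Model.exists_bayesThreshold_eq h
  have hsum := h.pi0_add_pi1
  have hp1 := h.pi1_pos
  have hρα := explicitRate_ge (α := α) hL
  have hρL := inv_le_explicitRate hαm hL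
  rw [(hB m hm).1, Model.pointRisk_eq]
  change (modelSeq kind ζ β signal m).risk k m (fdrThreshold (α m)) - _ ≤ _
  set M := modelSeq kind ζ β signal m
  set ρ := explicitRate (gammaExp kind ζ) α m
  have hB0 : 0 < M.sparsity * M.bayesThreshold :=
    mul_pos h.sparsity_pos (hxt ▸ tailP_pos h.one_le x)
  have hFP : M.pi0 * (α m * (5 + 2 * (m * M.pi1)) / m) ≤ M.pi1 * (7 * ρ) := by
    have h1 : M.sparsity * (5 + 2 * (m * M.pi1)) / m ≤ 7 := by
      rw [div_le_iff₀ (by linarith)]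
      have h2 : M.sparsity * M.pi1 ≤ 1 := by
        rw [← Model.pi0_eq]
        linarith
      have h3 := mul_le_mul_of_nonneg_left h2 (by linarith : (0 : ℝ) ≤ m)
      linarith
    calc _ = M.pi1 * (α m * (M.sparsity * (5 + 2 * (m * M.pi1)) / m)) := by
          rw [Model.pi0_eq]
          ring
      _ ≤ M.pi1 * (α m * 7) := by gcongr
      _ ≤ _ := by
          refine mul_le_mul_of_nonneg_left ?_ hp1.le
          linarith
  have hQ := hprob.trans (mul_le_mul_of_nonneg_left hρL hp1.le)
  change M.altCdf M.bayesThreshold - _ ≤ _ at ht3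
  have h4 := mul_le_mul_of_nonneg_left ht3 hp1.le
  have h5 := mul_pos hp1 hB0
  linarith

lemma bayesRiskSeq_le_fdrRiskSeq (hζ : AdmissibleShape kind ζ) (hβ0 : 0 < β)
    (hsignal : ∀ m ≥ 2, AdmissibleSignal kind (signal m))
    (hBP : BoundedPower (modelSeq kind ζ β signal)) (k : RiskKind)
    (hα : ∀ᶠ m in atTop, α m ∈ Ioo (0 : ℝ) 1) :
    ∀ᶠ m in atTop, bayesRiskSeq (modelSeq kind ζ β signal) k m ≤
      fdrRiskSeq (modelSeq kind ζ β signal) k α m := by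
  obtain ⟨η, hη, hB⟩ := bayesRiskSeq_bounds hζ hβ0 hsignal hBP k
  filter_upwards [eventually_ge_atTop 2, hα] with m hm hαm
  have h := modelSeq_regular (β := β) hζ hβ0 hsignal hm
  rw [(hB m hm).1]
  exact Model.pointRisk_bayes_le_risk h k (by omega)
    (Model.measurable_fdrThreshold hαm.1 hαm.2.le)
    (Model.fdrThreshold_mem_Icc hαm.1 hαm.2.le (by omega))

end FDR

/-! ### Necessity of the level condition. -/

section Converse

variable {kind : ModelKind} {ζ β : ℝ} {signal : ℕ → ℝ} {α : ℕ → ℝ}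

/-- Excess risk of BFDR thresholding, relative to the proportion of alternatives. -/
lemma tendsto_bfdr_excess (hζ : AdmissibleShape kind ζ) (hβ0 : 0 < β)
    (hsignal : ∀ m ≥ 2, AdmissibleSignal kind (signal m))
    (hBP : BoundedPower (modelSeq kind ζ β signal)) (k : RiskKind)
    (hα : ∀ᶠ m in atTop, α m ∈ Ioo 0 (modelSeq kind ζ β signal m).pi0)
    (hopt : AsympOptimal (bfdrRiskSeq (modelSeq kind ζ β signal) k α)
      (bayesRiskSeq (modelSeq kind ζ β signal) k)) {ε : ℝ} (hε : 0 < ε) :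
    ∀ᶠ m : ℕ in atTop,
      |(modelSeq kind ζ β signal m).sparsity *
          (modelSeq kind ζ β signal m).bfdrThreshold (α m) -
        (modelSeq kind ζ β signal m).altCdf ((modelSeq kind ζ β signal m).bfdrThreshold (α m)) +
        (modelSeq kind ζ β signal m).bayesPower| ≤ ε := by
  obtain ⟨Y, c, K, e, hc, hK, he, hbp⟩ := exists_bayesPoint hζ hβ0 hsignal hBP
  obtain ⟨η, hη, hB⟩ := bayesRiskSeq_bounds hζ hβ0 hsignal hBP k
  have hL := tendsto_log_rpow (gammaExp_pos hζ)
  have hd := density_pos hζ.one_le 0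
  have hk := kind.tails_pos
  have hsmall : Tendsto (fun m : ℕ => kind.tails * density ζ 0 /
      (c * Real.log m ^ gammaExp kind ζ)) atTop (𝓝 0) :=
    Tendsto.const_div_atTop (hL.const_mul_atTop hc) _
  filter_upwards [eventually_ge_atTop 2, hα, hbp, hL.eventually_gt_atTop 0,
    isLittleO_iff.1 hopt (half_pos hε), hsmall.eventually (ge_mem_nhds (half_pos hε))]
    with m hm hαm ⟨x, y, bp⟩ hLm hrisk hsm
  have h := modelSeq_regular (β := β) hζ hβ0 hsignal hm
  have hthr := (bp.sparsity_mul_bayesThreshold_le h hc hLm).trans hsm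
  have hp1 := h.pi1_pos
  obtain ⟨hB1, hB2, hB3⟩ := hB m hm
  rw [Pi.sub_apply, Real.norm_eq_abs, Real.norm_of_nonneg ((by positivity : (0 : ℝ) ≤
    η * (modelSeq kind ζ β signal m).pi1).trans hB2)] at hrisk
  replace hrisk := hrisk.trans (mul_le_mul_of_nonneg_left hB3 (half_pos hε).le)
  rw [hB1, bfdrRiskSeq_eq hζ hβ0 hsignal k hm hαm, Model.pointRisk_eq, Model.pointRisk_eq,
    ← mul_sub, abs_mul, abs_of_pos hp1, mul_comm (ε / 2)] at hrisk
  replace hrisk := le_of_mul_le_mul_left hrisk hp1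
  obtain ⟨z, hz, hzt, -⟩ := Model.exists_bayesThreshold_eq h
  set M := modelSeq kind ζ β signal m
  have hB0 : 0 < M.sparsity * M.bayesThreshold :=
    mul_pos h.sparsity_pos (hzt ▸ tailP_pos h.one_le z)
  rw [abs_le] at hrisk ⊢
  change _ ≤ _ - M.altCdf _ + M.altCdf M.bayesThreshold ∧
    _ - M.altCdf _ + M.altCdf M.bayesThreshold ≤ _
  constructor <;> linarith [hrisk.1, hrisk.2]

/-- An optimal BFDR threshold cannot exceed the power of the Bayes rule. -/
lemma eventually_bfdr_power_le (hζ : AdmissibleShape kind ζ) (hβ0 : 0 < β)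
    (hsignal : ∀ m ≥ 2, AdmissibleSignal kind (signal m))
    (hBP : BoundedPower (modelSeq kind ζ β signal)) (k : RiskKind)
    (hα : ∀ᶠ m in atTop, α m ∈ Ioo 0 (modelSeq kind ζ β signal m).pi0)
    (hopt : AsympOptimal (bfdrRiskSeq (modelSeq kind ζ β signal) k α)
      (bayesRiskSeq (modelSeq kind ζ β signal) k)) {ε : ℝ} (hε : 0 < ε) :
    ∀ᶠ m : ℕ in atTop,
      (modelSeq kind ζ β signal m).altCdf ((modelSeq kind ζ β signal m).bfdrThreshold (α m)) ≤
        (modelSeq kind ζ β signal m).bayesPower + ε := by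
  obtain ⟨Y, c, K, e, hc, hK, he, hbp⟩ := exists_bayesPoint hζ hβ0 hsignal hBP
  have hζ1 := hζ.one_le
  have hd := density_pos hζ1 0
  have hk := kind.tails_pos
  -- A left shift by this `s` gains power at most `ε`. A larger gain would put the threshold beyond
  -- the shifted one, where `τ t ≥ 3`, against an excess of at most `1`.
  obtain ⟨s, hs, hse, hsε⟩ : ∃ s : ℝ, 0 < s ∧ s ≤ e / 2 ∧ kind.tails * density ζ 0 * s ≤ ε := by
    refine ⟨min (e / 2) (ε / (kind.tails * density ζ 0)), by positivity, min_le_left _ _, ?_⟩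
    rw [← le_div_iff₀' (by positivity)]
    exact min_le_right _ _
  have hL := tendsto_log_rpow (gammaExp_pos hζ)
  have hgrow : Tendsto (fun m : ℕ => density ζ Y * (s / 2) * Real.exp (s / 2 *
      ((1 / 2) ^ (ζ - 1) * c * Real.log m ^ gammaExp kind ζ))) atTop atTop := by
    have hdY := density_pos hζ1 Y
    refine Tendsto.const_mul_atTop (by positivity) (Real.tendsto_exp_atTop.comp ?_)
    exact Tendsto.const_mul_atTop (by positivity) (Tendsto.const_mul_atTop (by positivity) hL)
  filter_upwards [eventually_ge_atTop 2, hα, hbp, hgrow.eventually_ge_atTop 3,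
    tendsto_bfdr_excess hζ hβ0 hsignal hBP k hα hopt one_pos]
    with m hm hαm ⟨x, y, bp⟩ hg hex
  have h := modelSeq_regular (β := β) hζ hβ0 hsignal hm
  have hleft := bp.le_sparsity_mul_tailP_left h hs (by linarith)
  have hpos : 0 < x + (modelSeq kind ζ β signal m).dilation * -s := by
    have h1 := bp.dilation_le
    have h2 := mul_le_mul_of_nonneg_left hse h.dilation_pos.le
    have h3 := bp.x_pos
    linarith
  have hF := bp.altCdf_eq h hpos
  have hτ := h.sparsity_pos
  have hpow := bp.power
  have hC1 : (modelSeq kind ζ β signal m).bayesPower ≥ 0 := Model.altCdf_nonneg _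
  have hF1 := Model.altCdf_le_one h ((modelSeq kind ζ β signal m).bfdrThreshold (α m))
  have hmono := Model.altCdf_mono h
  have hstep := tailP_sub_le (k := kind) hζ1 (u := y + -s) hs.le
  rw [neg_add_cancel_right] at hstep
  set M := modelSeq kind ζ β signal m
  change M.altCdf _ = tailP kind ζ (y + -s) at hF
  change M.bayesPower = tailP kind ζ y at hpow
  by_contra hcon
  push Not at hcon
  have hlt : M.altCdf (tailP M.kind M.shape (x + M.dilation * -s)) <
      M.altCdf (M.bfdrThreshold (α m)) := by
    rw [hF]
    linarith
  have hle : tailP M.kind M.shape (x + M.dilation * -s) ≤ M.bfdrThreshold (α m) :=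
    (hmono.reflect_lt hlt).le
  have h3 := mul_le_mul_of_nonneg_left hle hτ.le
  have h4 := hg.trans (hleft.trans h3)
  have h5 := (abs_le.1 hex).2
  linarith

/-- Asymptotic optimality of BFDR thresholding forces the level condition. -/
theorem levelCondition_of_bfdr_asympOptimal (hζ : AdmissibleShape kind ζ) (hβ0 : 0 < β)
    (hsignal : ∀ m ≥ 2, AdmissibleSignal kind (signal m))
    (hBP : BoundedPower (modelSeq kind ζ β signal)) (k : RiskKind)
    (hα : ∀ᶠ m in atTop, α m ∈ Ioo 0 (modelSeq kind ζ β signal m).pi0)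
    (hopt : AsympOptimal (bfdrRiskSeq (modelSeq kind ζ β signal) k α)
      (bayesRiskSeq (modelSeq kind ζ β signal) k)) :
    LevelCondition (gammaExp kind ζ) α := by
  have hpw := fun {ε : ℝ} (hε : 0 < ε) =>
    eventually_bfdr_power_le hζ hβ0 hsignal hBP k hα hopt hε
  have hex := fun {ε : ℝ} (hε : 0 < ε) =>
    tendsto_bfdr_excess hζ hβ0 hsignal hBP k hα hopt hε
  obtain ⟨Y, c, K, e, hc, hK, he, hbp⟩ := exists_bayesPoint hζ hβ0 hsignal hBP
  obtain ⟨Cm, Cp, hCm, -, hC⟩ := hBP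
  have hζ1 := hζ.one_le
  have hk1 := kind.one_le_tails
  have hL := tendsto_log_rpow (gammaExp_pos hζ)
  -- The weighted level of the threshold vanishes.
  have hu : ∀ {ε : ℝ}, 0 < ε → ∀ᶠ m : ℕ in atTop,
      (modelSeq kind ζ β signal m).sparsity *
        (modelSeq kind ζ β signal m).bfdrThreshold (α m) ≤ ε := fun {ε} hε => by
    filter_upwards [hpw (half_pos hε), hex (half_pos hε)] with m h1 h2
    have := (abs_le.1 h2).2
    linarith
  have hαF : ∀ᶠ m : ℕ in atTop, Cm / 2 * α m ≤
      (modelSeq kind ζ β signal m).sparsity *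
        (modelSeq kind ζ β signal m).bfdrThreshold (α m) := by
    filter_upwards [eventually_ge_atTop 2, hα, hex (ε := Cm / 2) (by positivity)]
      with m hm hαm h2
    have h := modelSeq_regular (β := β) hζ hβ0 hsignal hm
    have heq := Model.bfdrThreshold_eq h hαm
    have hC := (hC m hm).1
    set M := modelSeq kind ζ β signal m
    have hu0 : 0 < M.sparsity * M.bfdrThreshold (α m) :=
      mul_pos h.sparsity_pos (Model.bfdrThreshold_mem h hαm).1
    have h3 := (abs_le.1 h2).2
    -- The defining equation reads `τ t⋆ = α (F t⋆ + τ t⋆)`, so a lower bound on the bracket makes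
    -- `α` vanish with `τ t⋆`.
    have h4 : Cm / 2 ≤ M.altCdf (M.bfdrThreshold (α m)) +
        M.sparsity * M.bfdrThreshold (α m) := by
      have := (abs_le.1 h2).1
      linarith
    have h5 := mul_le_mul_of_nonneg_left h4 hαm.1.le
    linarith
  have hα0 : Tendsto α atTop (𝓝 0) := by
    refine Metric.tendsto_nhds.2 fun ε hε => ?_
    filter_upwards [hα, hαF, hu (ε := Cm / 4 * ε) (by positivity)] with m h1 h2 h3
    rw [Real.dist_0_eq_abs, abs_of_pos h1.1]
    by_contra hcon
    push Not at hcon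
    have := mul_le_mul_of_nonneg_left hcon (by positivity : 0 ≤ Cm / 2)
    have : 0 < Cm * ε := by positivity
    linarith
  refine ⟨hα0, isLittleO_iff.2 fun δ hδ => ?_⟩
  have hdY := density_pos hζ1 Y
  have hdY1 := density_pos hζ1 (|Y| + 1)
  set Q := 2 * (1 + 2 / e) ^ (ζ - 1) * K with hQ
  have hQ0 : 0 < Q := by
    have : 0 < (1 + 2 / e) ^ (ζ - 1) := Real.rpow_pos_of_pos (by positivity) _
    positivity
  -- Half of `δ` is for the exponent `s Q L`, the other half for the additive constant in `log α`.
  obtain ⟨s, hs, hs1, hsδ⟩ : ∃ s : ℝ, 0 < s ∧ s ≤ 1 ∧ s * Q ≤ δ / 2 := by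
    refine ⟨min 1 (δ / 2 / Q), by positivity, min_le_left _ _, ?_⟩
    rw [← le_div_iff₀ hQ0]
    exact min_le_right _ _
  filter_upwards [eventually_ge_atTop 2, hα, hbp, hα0.eventually (ge_mem_nhds one_pos), hu one_pos,
    hu (ε := density ζ (|Y| + 1) * s / 4) (by positivity),
    hex (ε := density ζ (|Y| + 1) * s / 4) (by positivity), hL.eventually_gt_atTop 0,
    hL.eventually_ge_atTop (2 / δ * |Real.log (density ζ Y * s / 2)|)]
    with m hm hαm ⟨x, y, bp⟩ hα1 hu1 hus hexs hL0 hLbig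
  have h := modelSeq_regular (β := β) hζ hβ0 hsignal hm
  have hright := bp.le_sparsity_mul_tailP_right h he hs hs1
  have hpos : 0 < x + (modelSeq kind ζ β signal m).dilation * s := by
    have := bp.x_pos
    have := h.dilation_pos
    positivity
  have hF := bp.altCdf_eq h hpos
  have hpow := bp.power
  have heq := Model.bfdrThreshold_eq h hαm
  have hτ := h.sparsity_pos
  have hmono := Model.altCdf_mono h
  have hF1 := Model.altCdf_le_one h ((modelSeq kind ζ β signal m).bfdrThreshold (α m))
  have hmem := Model.bfdrThreshold_mem h hαm
  have hyY := bp.y_abs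
  have hdrop : density ζ (|Y| + 1) * s ≤ upperTail ζ y - upperTail ζ (y + s) := by
    refine mul_le_upperTail_sub hζ1 hs.le fun v hv => density_anti_abs hζ1 ?_
    rw [abs_of_nonneg (by positivity : 0 ≤ |Y| + 1), abs_le]
    have h1 := abs_le.1 (hyY.trans (le_abs_self Y))
    constructor <;> linarith [hv.1, hv.2, h1.1, h1.2]
  have hdropP : density ζ (|Y| + 1) * s ≤ tailP kind ζ y - tailP kind ζ (y + s) := by
    have h0 : 0 < density ζ (|Y| + 1) * s := by positivity
    have h1 : 0 ≤ upperTail ζ y - upperTail ζ (y + s) := by linarith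
    calc _ ≤ 1 * (upperTail ζ y - upperTail ζ (y + s)) := by rwa [one_mul]
      _ ≤ kind.tails * (upperTail ζ y - upperTail ζ (y + s)) :=
          mul_le_mul_of_nonneg_right hk1 h1
      _ = _ := by simp only [tailP]; ring
  set M := modelSeq kind ζ β signal m
  set L := Real.log m ^ gammaExp kind ζ
  set u := M.sparsity * M.bfdrThreshold (α m) with hudef
  have hu0 : 0 < u := mul_pos hτ hmem.1
  change M.altCdf _ = tailP kind ζ (y + s) at hF
  change M.bayesPower = tailP kind ζ y at hpow
  change density ζ Y * s * Real.exp (-(s * (Q * L))) ≤ _ at hright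
  -- Near-optimality leaves `F t⋆` closer to the Bayes power than the drop caused by a right shift
  -- of `s`, so `t⋆` is above the shifted threshold.
  have hlt : M.altCdf (tailP M.kind M.shape (x + M.dilation * s)) <
      M.altCdf (M.bfdrThreshold (α m)) := by
    rw [hF]
    have h1 := (abs_le.1 hexs).2
    have : 0 < density ζ (|Y| + 1) * s := by positivity
    linarith
  have hle := (hmono.reflect_lt hlt).le
  have hlow : density ζ Y * s * Real.exp (-(s * (Q * L))) ≤ u :=
    hright.trans (mul_le_mul_of_nonneg_left hle hτ.le)
  have hαu : u / 2 ≤ α m := by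
    have h1 := mul_le_mul_of_nonneg_left hF1 hαm.1.le
    have h2 := mul_le_mul_of_nonneg_left hu1 hαm.1.le
    linarith
  have hαlow : density ζ Y * s / 2 * Real.exp (-(s * (Q * L))) ≤ α m := by linarith
  have hlog := Real.log_le_log (by positivity) hαlow
  rw [Real.log_mul (by positivity) (Real.exp_pos _).ne', Real.log_exp] at hlog
  rw [Real.norm_of_nonpos (Real.log_nonpos hαm.1.le hα1), Real.norm_of_nonneg hL0.le]
  have h1 := mul_le_mul_of_nonneg_right hsδ hL0.le
  have h2 : |Real.log (density ζ Y * s / 2)| ≤ δ / 2 * L := by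
    have := mul_le_mul_of_nonneg_left hLbig (half_pos hδ).le
    calc _ = δ / 2 * (2 / δ * |Real.log (density ζ Y * s / 2)|) := by field_simp
      _ ≤ _ := this
  linarith [neg_abs_le (Real.log (density ζ Y * s / 2))]

end Converse

end SubbotinFDR

/-! ### The final assembly. -/

theorem corollary4p3 (kind : ModelKind) (ζ β : ℝ) (signal : ℕ → ℝ)
    (hζ : AdmissibleShape kind ζ) (hβ0 : 0 < β) (hβ1 : β ≤ 1)
    (hsignal : ∀ m ≥ 2, AdmissibleSignal kind (signal m))
    (hBP : BoundedPower (modelSeq kind ζ β signal)) (k : RiskKind) :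
    -- (i)
    (∀ α : ℕ → ℝ, (∀ᶠ m in atTop, α m ∈ Ioo 0 (modelSeq kind ζ β signal m).pi0) →
      (AsympOptimal (bfdrRiskSeq (modelSeq kind ζ β signal) k α)
          (bayesRiskSeq (modelSeq kind ζ β signal) k) ↔
        LevelCondition (gammaExp kind ζ) α) ∧
      (LevelCondition (gammaExp kind ζ) α →
        AsympOptimalAtRate (bfdrRiskSeq (modelSeq kind ζ β signal) k α)
          (bayesRiskSeq (modelSeq kind ζ β signal) k) (explicitRate (gammaExp kind ζ) α))) ∧
    -- (ii)
    (∀ α : ℕ → ℝ, (∀ᶠ m in atTop, α m ∈ Ioo (0 : ℝ) 1) →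
      LevelCondition (gammaExp kind ζ) α →
        AsympOptimal (fdrRiskSeq (modelSeq kind ζ β signal) k α)
          (bayesRiskSeq (modelSeq kind ζ β signal) k) ∧
        AsympOptimalAtRate (fdrRiskSeq (modelSeq kind ζ β signal) k α)
          (bayesRiskSeq (modelSeq kind ζ β signal) k) (explicitRate (gammaExp kind ζ) α)) ∧
    -- (iii)
    (∀ α : ℕ → ℝ, (∀ᶠ m in atTop, 0 < α m) →
      (α =Θ[atTop] fun m : ℕ => (Real.log m ^ gammaExp kind ζ)⁻¹) →
        (AsympOptimal (bfdrRiskSeq (modelSeq kind ζ β signal) k α)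
            (bayesRiskSeq (modelSeq kind ζ β signal) k) ∧
          AsympOptimalAtRate (bfdrRiskSeq (modelSeq kind ζ β signal) k α)
            (bayesRiskSeq (modelSeq kind ζ β signal) k)
            fun m : ℕ => (Real.log m ^ gammaExp kind ζ)⁻¹) ∧
        AsympOptimal (fdrRiskSeq (modelSeq kind ζ β signal) k α)
            (bayesRiskSeq (modelSeq kind ζ β signal) k) ∧
          AsympOptimalAtRate (fdrRiskSeq (modelSeq kind ζ β signal) k α)
            (bayesRiskSeq (modelSeq kind ζ β signal) k)
            fun m : ℕ => (Real.log m ^ gammaExp kind ζ)⁻¹) := by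
  have hγ := gammaExp_pos hζ
  have hpos := eventually_bayesRiskSeq_pos hζ hβ0 hsignal hBP k
  have hi : ∀ α : ℕ → ℝ, (∀ᶠ m in atTop, α m ∈ Ioo 0 (modelSeq kind ζ β signal m).pi0) →
      LevelCondition (gammaExp kind ζ) α →
      AsympOptimal (bfdrRiskSeq (modelSeq kind ζ β signal) k α)
          (bayesRiskSeq (modelSeq kind ζ β signal) k) ∧
        AsympOptimalAtRate (bfdrRiskSeq (modelSeq kind ζ β signal) k α)
          (bayesRiskSeq (modelSeq kind ζ β signal) k) (explicitRate (gammaExp kind ζ) α) := by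
    intro α hα hlev
    have hr := bfdr_asympOptimalAtRate hζ hβ0 hsignal hBP k hα hlev
    exact ⟨hr.asympOptimal (bayesRiskSeq_le_bfdrRiskSeq hζ hβ0 hsignal hBP k hα) hpos, hr⟩
  have hii : ∀ α : ℕ → ℝ, (∀ᶠ m in atTop, α m ∈ Ioo (0 : ℝ) 1) →
      LevelCondition (gammaExp kind ζ) α →
      AsympOptimal (fdrRiskSeq (modelSeq kind ζ β signal) k α)
          (bayesRiskSeq (modelSeq kind ζ β signal) k) ∧
        AsympOptimalAtRate (fdrRiskSeq (modelSeq kind ζ β signal) k α)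
          (bayesRiskSeq (modelSeq kind ζ β signal) k) (explicitRate (gammaExp kind ζ) α) := by
    intro α hα hlev
    have hr := fdr_asympOptimalAtRate hζ hβ0 hβ1 hsignal hBP k (hα.mono fun m h => h.1) hlev
    exact ⟨hr.asympOptimal (bayesRiskSeq_le_fdrRiskSeq hζ hβ0 hsignal hBP k hα) hpos, hr⟩
  refine ⟨fun α hα => ⟨⟨levelCondition_of_bfdr_asympOptimal hζ hβ0 hsignal hBP k hα,
    fun hlev => (hi α hα hlev).1⟩, fun hlev => (hi α hα hlev).2⟩, hii, fun α hα hΘ => ?_⟩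
  obtain ⟨hlev, K, hK, hρ⟩ := levelCondition_of_isTheta hγ hα hΘ
  have hρ' : Tendsto (fun m : ℕ => (Real.log m ^ gammaExp kind ζ)⁻¹) atTop (𝓝 0) :=
    (tendsto_log_rpow hγ).inv_tendsto_atTop
  -- Levels tending to zero are eventually below `1 / 2`, hence below `π₀`, because `τ > 1`; both
  -- procedures are then covered by the first two parts.
  have hsmall := hlev.1.eventually (gt_mem_nhds (show (0 : ℝ) < 1 / 2 by norm_num))
  have hα1 : ∀ᶠ m in atTop, α m ∈ Ioo (0 : ℝ) 1 := by
    filter_upwards [hα, hsmall] with m h1 h2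
    exact ⟨h1, by linarith⟩
  have hα2 : ∀ᶠ m in atTop, α m ∈ Ioo 0 (modelSeq kind ζ β signal m).pi0 := by
    filter_upwards [hα, hsmall, eventually_ge_atTop 2] with m h1 h2 hm
    have h := modelSeq_regular (β := β) hζ hβ0 hsignal hm
    have h3 := h.pi0_add_pi1
    have h4 := mul_lt_mul_of_pos_right h.sparsity h.pi1_pos
    rw [← Model.pi0_eq] at h4
    exact ⟨h1, by linarith⟩
  obtain ⟨h1, h2⟩ := hi α hα2 hlev
  obtain ⟨h3, h4⟩ := hii α hα1 hlev
  exact ⟨⟨h1, h2.mono hρ' hK hρ hpos⟩, h3, h4.mono hρ' hK hρ hpos⟩
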